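/- Let $n\ge 3$, $\lambda>0$ and $\delta\in(\tfrac35,\tfrac23)$. For $T>0$ consider $u\in C^0([0,T];H^\infty(\mathbb R^n;\mathbb C^n))$ solving the covariant complex Ginzburg--Landau system $$D_0u_\ell=(\lambda-i)\sum_{k=1}^n\bigl(D_kD_ku_\ell+R_{\ell k}u_k\bigr),\qquad \ell=1,\dots,n,$$ under the Coulomb gauge $\sum_{k=1}^n\partial_ka_k=0$. Here $(a_0,a)\in C^0([0,T];H^\infty(\mathbb R^n;\mathbb R^{1+n}))$ is a connection field, $D_\alpha=\partial_\alpha+ia_\alpha$ for $\alpha\in\{0,\dots,n\}$ (with $\alpha=0$ the time index), $R_{\ell k}=[D_\ell,D_k]=i(\partial_\ell a_k-\partial_k a_\ell)$, and the connection is tied to $u$ by the curvature identities $$\partial_\alpha a_\beta-\partial_\beta a_\alpha=\operatorname{Im}(u_\alpha\bar u_\beta)\quad(\alpha,\beta\in\{0,\dots,n\}),\qquad u_0:=(\lambda-i)\sum_{k=1}^nD_ku_k .$$ Here $H^\infty=\bigcap_\sigma H^\sigma$, and $|u|$, $|\nabla u|$ are Euclidean norms. Let $S(t)f=S_t*f$,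 $t>0$, be the semigroup generated by $(\lambda-i)\Delta$, i.e. with Fourier multiplier $e^{(i-\lambda)|\xi|^2t}$. For a family $v(\tau)$, $\tau>0$, put $$R[v](t)=\max\Bigl\{\sup_{0<\tau<t}\tau^{\frac{1-\delta}2}\|v(\tau)\|_{L^{n/\delta}},\ \sup_{0<\tau<t}\tau^{\frac12}\|\nabla v(\tau)\|_{L^n}\Bigr\}$$ (a supremum over the empty set being $0$), and let $R(t)=R[u](t)$ and $R_0(t)=R[\tau\mapsto S(\tau)u(0)](t)$. (a) There are positive constants $c_0,r_0$ depending only on $\delta,\lambda,n$ such that, for every $T>0$ and every such solution, $R(t)$ is finite and $$R(t)\le R_0(t)+c_0\bigl(R(t)^3+R(t)^5\bigr)\qquad\text{for all }t\in[0,T];$$ moreover, if $\sup_{t\in(0,T)}R_0(t)<r_0$, then $R(t)\le 2R_0(t)$ for all $t\in[0,T]$. (b) There are positive constants $\rho,c$ depending only on $\delta,\lambda,n$ such that, for every $T>0$ and every such solution with $\|u(0)\|_{L^n}<\rho$, $$t^{\frac{1-\delta}2}\|u(t)\|_{L^{n/\delta}}+t^{\frac12}\|\nabla u(t)\|_{L^n}\le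 c\,\|u(0)\|_{L^n}\qquad\text{for all }t\in(0,T].$$ -/

import Mathlib

open MeasureTheory Filter Topology
open scoped ENNReal ContDiff FourierTransform ComplexConjugate

noncomputable section

namespace CovLLG

/-- The space `ℝⁿ` with its Euclidean norm. -/
abbrev Rn (n : ℕ) : Type := EuclideanSpace ℝ (Fin n)

/-- The space `ℂⁿ` with its Euclidean norm. -/
abbrev Cn (n : ℕ) : Type := EuclideanSpace ℂ (Fin n)

/-- `f ∈ H^∞(ℝⁿ; F)`, expressed through the smooth representative: `f` is smooth and all its
derivatives are square integrable. -/
def MemHInfty {n : ℕ} {F : Type*} [NormedAddCommGroup F] [NormedSpace ℝ F]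
    (f : Rn n → F) : Prop :=
  ContDiff ℝ ∞ f ∧ ∀ m : ℕ, MemLp (iteratedFDeriv ℝ m f) 2 volume

/-- `f ∈ C⁰([0,T]; H^∞(ℝⁿ; F))`: every `f t` is in `H^∞`, and `t ↦ f t` is continuous on `[0,T]`
for each of the seminorms `‖∇^m f‖_{L²}`. -/
def ContHInfty {n : ℕ} {F : Type*} [NormedAddCommGroup F] [NormedSpace ℝ F]
    (T : ℝ) (f : ℝ → Rn n → F) : Prop :=
  (∀ t ∈ Set.Icc 0 T, MemHInfty (f t)) ∧
  ∀ m : ℕ, ∀ s ∈ Set.Icc 0 T,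
    Tendsto
      (fun t => eLpNorm
        (fun x => iteratedFDeriv ℝ m (f t) x - iteratedFDeriv ℝ m (f s) x) 2 volume)
      (𝓝[Set.Icc 0 T] s) (𝓝 0)

/-- The spatial partial derivative `∂_k f`. -/
def pd {n : ℕ} {F : Type*} [NormedAddCommGroup F] [NormedSpace ℝ F]
    (k : Fin n) (f : Rn n → F) (x : Rn n) : F :=
  fderiv ℝ f x (EuclideanSpace.single k 1)

/-- The spatial covariant derivative `D_k f = ∂_k f + i a_k f`, for a given spatial connection
field `a`. -/
def covD {n : ℕ} (a : Rn n → Rn n) (k : Fin n) (f : Rn n → ℂ) (x : Rn n) : ℂ :=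
  pd k f x + Complex.I * (a x k : ℂ) * f x

/-- The time component `u₀ = (λ - i) ∑_k D_k u_k`. -/
def timeComp {n : ℕ} (lam : ℝ) (a : Rn n → Rn n) (u : Rn n → Cn n) (x : Rn n) : ℂ :=
  ((lam : ℂ) - Complex.I) * ∑ k, covD a k (fun y => u y k) x

/-- The spatial curvature `R_{ℓk} = [D_ℓ, D_k] = i (∂_ℓ a_k - ∂_k a_ℓ)`. -/
def curv {n : ℕ} (a : Rn n → Rn n) (l k : Fin n) (x : Rn n) : ℂ :=
  Complex.I * ((pd l (fun y => a y k) x - pd k (fun y => a y l) x : ℝ) : ℂ)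

/-- `u`, with the connection field `(a₀, a)`, is a solution on `[0,T]` of the covariant complex
Ginzburg-Landau system
`D₀ u_ℓ = (λ - i) ∑_k (D_k D_k u_ℓ + R_{ℓk} u_k)`, `D₀ = ∂_t + i a₀`,
where the connection is tied to `u` by the curvature identities
`∂_α a_β - ∂_β a_α = Im (u_α conj u_β)`, `α, β ∈ {0, …, n}`, with `u₀ = (λ - i) ∑_k D_k u_k`,
and by the Coulomb gauge condition `div a = 0`. The equations containing a time derivative are
required on the open interval `(0,T)` only. -/
structure IsCoulombSolution (n : ℕ) (lam T : ℝ)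
    (u : ℝ → Rn n → Cn n) (a₀ : ℝ → Rn n → ℝ) (a : ℝ → Rn n → Rn n) : Prop where
  u_mem : ContHInfty T u
  a₀_mem : ContHInfty T a₀
  a_mem : ContHInfty T a
  /-- `div a = 0`. -/
  coulomb : ∀ t ∈ Set.Icc 0 T, ∀ x, ∑ k, pd k (fun y => a t y k) x = 0
  /-- `∂_k a_ℓ - ∂_ℓ a_k = Im (u_k conj u_ℓ)`. -/
  curvature_space : ∀ t ∈ Set.Icc 0 T, ∀ x, ∀ k l : Fin n,
    pd k (fun y => a t y l) x - pd l (fun y => a t y k) x = (u t x k * conj (u t x l)).im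
  /-- `∂_t a_ℓ - ∂_ℓ a₀ = Im (u₀ conj u_ℓ)`. -/
  curvature_time : ∀ t ∈ Set.Ioo 0 T, ∀ x, ∀ l : Fin n,
    HasDerivAt (fun s => a s x l)
      (pd l (a₀ t) x + (timeComp lam (a t) (u t) x * conj (u t x l)).im) t
  /-- `∂_t u_ℓ = - i a₀ u_ℓ + (λ - i) ∑_k (D_k D_k u_ℓ + R_{ℓk} u_k)`. -/
  ginzburg_landau : ∀ t ∈ Set.Ioo 0 T, ∀ x, ∀ l : Fin n,
    HasDerivAt (fun s => u s x l)
      (-(Complex.I * (a₀ t x : ℂ) * u t x l) +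
        ((lam : ℂ) - Complex.I) *
          ∑ k, (covD (a t) k (covD (a t) k (fun y => u t y l)) x
            + curv (a t) l k x * u t x k)) t

/-- The matrix `(∂_k u_ℓ)_{k,ℓ}` of first spatial derivatives, with the Frobenius norm
`|∇u|² = ∑_{k,ℓ} |∂_k u_ℓ|²`. -/
def grad {n : ℕ} (u : Rn n → Cn n) (x : Rn n) : EuclideanSpace ℂ (Fin n × Fin n) :=
  WithLp.toLp 2 (fun p => pd p.1 (fun y => u y p.2) x)

/-- The kernel `S_t` of the dissipative Schrödinger semigroup generated by `(λ - i) Δ`. Its Fourier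
transform is `e^{(i-λ)|ξ|²t}` in the angular frequency `ξ`, which is `2π` times the
frequency variable of Mathlib's Fourier transform. -/
def kernelS (n : ℕ) (lam t : ℝ) : Rn n → ℂ :=
  𝓕⁻ (fun ξ : Rn n =>
    Complex.exp ((Complex.I - (lam : ℂ)) * (((2 * Real.pi * ‖ξ‖) ^ 2 * t : ℝ) : ℂ)))

/-- The semigroup `S(t) f = S_t ∗ f`. -/
def semigroupS {n : ℕ} (lam t : ℝ) (f : Rn n → Cn n) (x : Rn n) : Cn n :=
  ∫ y, kernelS n lam t (x - y) • f y

/-- `K(t) = sup_{0<τ<t} τ^{(1-δ)/2} ‖v(τ)‖_{L^{n/δ}}`. -/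
def weightK {n : ℕ} (δ : ℝ) (v : ℝ → Rn n → Cn n) (t : ℝ) : ℝ≥0∞ :=
  ⨆ τ ∈ Set.Ioo 0 t,
    ENNReal.ofReal (τ ^ ((1 - δ) / 2)) * eLpNorm (v τ) (ENNReal.ofReal (n / δ)) volume

/-- `K'(t) = sup_{0<τ<t} τ^{1/2} ‖∇v(τ)‖_{L^n}`. -/
def weightK' {n : ℕ} (v : ℝ → Rn n → Cn n) (t : ℝ) : ℝ≥0∞ :=
  ⨆ τ ∈ Set.Ioo 0 t,
    ENNReal.ofReal (τ ^ (1 / 2 : ℝ)) * eLpNorm (grad (v τ)) (n : ℝ≥0∞) volume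

/-- The Fujita-Kato quantity `max {K(t), K'(t)}`. -/
def weightR {n : ℕ} (δ : ℝ) (v : ℝ → Rn n → Cn n) (t : ℝ) : ℝ≥0∞ :=
  max (weightK δ v t) (weightK' v t)

/-- `R₀(t)`: the Fujita-Kato quantity of the free evolution `τ ↦ S(τ) f`. -/
def weightR₀ {n : ℕ} (lam δ : ℝ) (f : Rn n → Cn n) (t : ℝ) : ℝ≥0∞ :=
  weightR δ (fun τ => semigroupS lam τ f) t

end CovLLG

end

/-! The proof is the Fujita–Kato method. In the Coulomb gauge the connection is a function of `u`:
taking the divergence of the curvature identities gives `Δ a_l = ∑ ∂_k Im(u_k ū_l)` and `Δ a₀ = -∑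
∂_k Im(u₀ ū_k)`. Writing a function with `Δ f = div q` as an integral of its heat evolution bounds
it by the order-one potential `I₁|q|` (`enorm_le_riesz`). Hence `|a| ≲ I₁(|u|²)` and `|a₀| ≲
I₁((|∇u| + I₁(|u|²)|u|)|u|)` pointwise (`enorm_a_le`, `enorm_a₀_le`). Expanding the covariant
derivatives gives `∂_t u = (λ - i) Δu + N`, where `|N| ≲ |a||∇u| + |a|²|u| + |u|³ + |a₀||u|` after
inserting these bounds, a sum of cubic and quintic terms.

Lebesgue spaces are indexed by `b`, for `L^{n/b}`. Hölder adds indices, `I₁` lowers the index by one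
(Hardy–Littlewood–Sobolev, `nr_riesz_le`), passing from index `b` to `β` under the flow costs
`t^{-(b-β)/2}`, and a derivative costs `t^{-1/2}`; the flow has Gaussian bounds because `λ > 0`. The
quantity `R` says that `u` has index `δ` with weight `s^{-(1-δ)/2}` and `∇u` index `1` with weight
`s^{-1/2}`. Then `N` splits into pieces of index `b = 2δ, 3δ, 5δ - 2`, each with weight
`s^{-(3-b)/2}`. For a kernel of parabolic order `κ`, the Duhamel integral of such a piece in
`L^{n/β}` is at most a multiple of `∫ (t-s)^{-(κ+b-β)/2} s^{-(3-b)/2} ds`, which is of size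
`t^{-(1+κ-β)/2}` whatever `b` is. The choices `(β, κ) = (δ, 0)` and `(1, 1)` reproduce the two
weights of `R`. Convergence at `s = 0` needs `b > 1`, and at `s = t` the choice `(1, 1)` needs `b <
2`; the conditions `5δ - 2 > 1` and `3δ < 2` are exactly the range of `δ`.

This gives `R ≤ R₀ + c(R³ + R⁵)` (`weightR_le`). The weighted norm of `u` is continuous on `[0,T]`
and vanishes at `0`, so for small `R₀` it can never reach the region where the nonlinear term
competes with `R`, and `R ≤ 2R₀` (`bootstrap`). Part (b) follows from the linear bound `R₀ ≲
‖u(0)‖_{L^n}` (`wgt_semigroupS_le`). -/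

namespace CovLLG

open scoped NNReal

/-! ### Powers of time and Jensen's inequality. -/

/-- The power `s ^ θ` as an extended nonnegative real. -/
noncomputable def pw (s θ : ℝ) : ℝ≥0∞ := ENNReal.ofReal (s ^ θ)

lemma pw_ne_top (s θ : ℝ) : pw s θ ≠ ⊤ := ENNReal.ofReal_ne_top

lemma pw_ne_zero {s : ℝ} (hs : 0 < s) (θ : ℝ) : pw s θ ≠ 0 := by
  simp [pw, Real.rpow_pos_of_pos hs θ]

lemma pw_add {s : ℝ} (hs : 0 < s) (a b : ℝ) : pw s (a + b) = pw s a * pw s b := by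
  rw [pw, Real.rpow_add hs, ENNReal.ofReal_mul (by positivity)]; rfl

lemma pw_zero (s : ℝ) : pw s 0 = 1 := by simp [pw]

lemma pw_rpow {s : ℝ} (hs : 0 < s) (a r : ℝ) : pw s a ^ r = pw s (a * r) := by
  rw [pw, ENNReal.ofReal_rpow_of_pos (by positivity), ← Real.rpow_mul hs.le]; rfl

@[fun_prop]
lemma measurable_pw (θ : ℝ) : Measurable (fun s => pw s θ) := by
  unfold pw; fun_prop

lemma lintegral_pw_Ioc {a A : ℝ} (ha : -1 < a) (hA : 0 ≤ A) :
    ∫⁻ s in Set.Ioc 0 A, pw s a = ENNReal.ofReal (A ^ (a + 1) / (a + 1)) := by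
  have hi : IntegrableOn (fun s : ℝ => s ^ a) (Set.Ioc 0 A) := by
    have := intervalIntegral.intervalIntegrable_rpow' (a := 0) (b := A) ha
    rwa [intervalIntegrable_iff_integrableOn_Ioc_of_le hA] at this
  unfold pw
  rw [← ofReal_integral_eq_lintegral_ofReal hi, ← intervalIntegral.integral_of_le hA,
    integral_rpow (Or.inl ha), Real.zero_rpow (by linarith), sub_zero]
  filter_upwards [ae_restrict_mem measurableSet_Ioc] with s hs
  exact Real.rpow_nonneg hs.1.le _

lemma lintegral_pw_Ioi {a A : ℝ} (ha : a < -1) (hA : 0 < A) :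
    ∫⁻ s in Set.Ioi A, pw s a = ENNReal.ofReal (-A ^ (a + 1) / (a + 1)) := by
  unfold pw
  rw [← ofReal_integral_eq_lintegral_ofReal (integrableOn_Ioi_rpow_of_lt ha hA),
    integral_Ioi_rpow_of_lt ha hA]
  filter_upwards [ae_restrict_mem measurableSet_Ioi] with s hs
  exact Real.rpow_nonneg (hA.le.trans (le_of_lt hs)) _

section Jensen

variable {α : Type*} [MeasurableSpace α] {μ : Measure α}

/-- Jensen's inequality for an unnormalised weight. -/
lemma lintegral_mul_rpow_le {k f : α → ℝ≥0∞} (hk : AEMeasurable k μ) (hf : AEMeasurable f μ)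
    {p : ℝ} (hp : 1 ≤ p) :
    (∫⁻ a, k a * f a ∂μ) ^ p ≤ (∫⁻ a, k a ∂μ) ^ (p - 1) * ∫⁻ a, k a * f a ^ p ∂μ := by
  have hp0 : 0 < p := by linarith
  -- Hölder for `k * f ^ p` and `k` with exponents `1 / p` and `1 - 1 / p`; the second may vanish,
  -- so `p = 1` needs no separate treatment.
  have h := ENNReal.lintegral_mul_norm_pow_le (μ := μ) (f := fun a => k a * f a ^ p) (g := k)
    (by fun_prop) hk (p := 1 / p) (q := 1 - 1 / p) (by positivity)
    (by rw [sub_nonneg, div_le_one hp0]; exact hp) (by ring)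
  have e : ∀ a, (k a * f a ^ p) ^ (1 / p) * k a ^ (1 - 1 / p) = k a * f a := by
    intro a
    rw [ENNReal.mul_rpow_of_nonneg _ _ (by positivity), ← ENNReal.rpow_mul,
      mul_one_div_cancel hp0.ne', ENNReal.rpow_one, mul_right_comm,
      ← ENNReal.rpow_add_of_nonneg _ _ (by positivity)
        (by rw [sub_nonneg, div_le_one hp0]; exact hp)]
    simp
  simp_rw [e] at h
  calc (∫⁻ a, k a * f a ∂μ) ^ p
      ≤ ((∫⁻ a, k a * f a ^ p ∂μ) ^ (1 / p) * (∫⁻ a, k a ∂μ) ^ (1 - 1 / p)) ^ p := by gcongr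
    _ = _ := by
      rw [ENNReal.mul_rpow_of_nonneg _ _ hp0.le, ← ENNReal.rpow_mul, ← ENNReal.rpow_mul,
        one_div_mul_cancel hp0.ne', ENNReal.rpow_one, mul_comm]
      congr 2; field_simp

end Jensen

/-! ### The scale of norms of `L^{n/b}`: Hölder and Minkowski inequalities. -/

variable {n : ℕ}

/-- The norm of `L^{n/b}`. -/
noncomputable def nr (b : ℝ) (f : Rn n → ℝ≥0∞) : ℝ≥0∞ := (∫⁻ x, f x ^ ((n : ℝ) / b)) ^ (b / n)

lemma nr_mono {b : ℝ} (hb : 0 ≤ b) {f g : Rn n → ℝ≥0∞} (h : ∀ x, f x ≤ g x) :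
    nr b f ≤ nr b g := by
  unfold nr
  gcongr with x
  exact h x

lemma nr_congr_ae {b : ℝ} {f g : Rn n → ℝ≥0∞} (h : f =ᵐ[volume] g) : nr b f = nr b g := by
  unfold nr
  rw [lintegral_congr_ae (h.mono fun x hx => by rw [hx])]

lemma nr_const_mul (hn : 0 < n) {b : ℝ} (hb : 0 < b) {c : ℝ≥0∞} (f : Rn n → ℝ≥0∞)
    (hf : Measurable f) :
    nr b (fun x => c * f x) = c * nr b f := by
  unfold nr
  have : (0:ℝ) < n := by exact_mod_cast hn
  simp_rw [ENNReal.mul_rpow_of_nonneg _ _ (show 0 ≤ (n:ℝ) / b by positivity)]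
  rw [lintegral_const_mul _ (by fun_prop), ENNReal.mul_rpow_of_nonneg _ _ (by positivity),
    ← ENNReal.rpow_mul, div_mul_div_cancel₀ hb.ne', div_self this.ne', ENNReal.rpow_one]

lemma nr_rpow (hn : 0 < n) {b : ℝ} (hb : 0 < b) (f : Rn n → ℝ≥0∞) :
    nr b f ^ ((n:ℝ) / b) = ∫⁻ x, f x ^ ((n : ℝ) / b) := by
  have : (0:ℝ) < n := by exact_mod_cast hn
  rw [nr, ← ENNReal.rpow_mul, div_mul_div_cancel₀ this.ne', div_self hb.ne', ENNReal.rpow_one]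

lemma nr_le_of_lintegral_le (hn : 0 < n) {b : ℝ} (hb : 0 < b) {f : Rn n → ℝ≥0∞} {c : ℝ≥0∞}
    (h : ∫⁻ x, f x ^ ((n : ℝ) / b) ≤ c ^ ((n : ℝ) / b)) : nr b f ≤ c := by
  have : (0:ℝ) < n := by exact_mod_cast hn
  rw [← nr_rpow hn hb] at h
  exact (ENNReal.rpow_le_rpow_iff (by positivity)).1 h

lemma nr_mul (hn : 0 < n) {a b : ℝ} (ha : 0 < a) (hb : 0 < b) {f g : Rn n → ℝ≥0∞}
    (hf : Measurable f) (hg : Measurable g) :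
    nr (a + b) (fun x => f x * g x) ≤ nr a f * nr b g := by
  have hn' : (0:ℝ) < n := by exact_mod_cast hn
  have := ENNReal.lintegral_Lp_mul_le_Lq_mul_Lr (p := n / (a + b)) (q := n / a) (r := n / b)
    (by positivity) (by gcongr; linarith) (by field_simp) volume hf.aemeasurable hg.aemeasurable
  simpa [nr] using this

lemma nr_add {b : ℝ} (hb : 0 < b) (hbn : b ≤ n) {f g : Rn n → ℝ≥0∞}
    (hf : Measurable f) (hg : Measurable g) :
    nr b (fun x => f x + g x) ≤ nr b f + nr b g := by
  have := ENNReal.lintegral_Lp_add_le (μ := volume) (p := n / b) hf.aemeasurable hg.aemeasurable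
    (by rwa [le_div_iff₀ hb, one_mul])
  simpa [nr] using this

lemma nr_sum (hn : 0 < n) {b : ℝ} (hb : 0 < b) (hbn : b ≤ n) {ι : Type*} (s : Finset ι)
    {f : ι → Rn n → ℝ≥0∞} (hf : ∀ i, Measurable (f i)) :
    nr b (fun x => ∑ i ∈ s, f i x) ≤ ∑ i ∈ s, nr b (f i) := by
  classical
  induction s using Finset.induction with
  | empty =>
    have hn' : (0:ℝ) < n := by exact_mod_cast hn
    simp [nr, ENNReal.zero_rpow_of_pos (show 0 < (n:ℝ) / b by positivity), hb, hn]
  | insert i s hi ih =>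
    simp_rw [Finset.sum_insert hi]
    refine (nr_add hb hbn (hf i) (by fun_prop)).trans ?_
    gcongr

/-- Minkowski's integral inequality. -/
lemma nr_lintegral_le (hn : 0 < n) {b : ℝ} (hb : 0 < b) (hbn : b ≤ n) {S : Set ℝ}
    (hS : MeasurableSet S) {F : ℝ → Rn n → ℝ≥0∞} (hF : Measurable (Function.uncurry F))
    {m : ℝ → ℝ≥0∞} (hm : Measurable m) (h0 : ∀ s ∈ S, m s ≠ 0) (ht : ∀ s ∈ S, m s ≠ ⊤)
    (h : ∀ s ∈ S, nr b (F s) ≤ m s) :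
    nr b (fun x => ∫⁻ s in S, F s x) ≤ ∫⁻ s in S, m s := by
  have hn' : (0:ℝ) < n := by exact_mod_cast hn
  set p : ℝ := n / b with hp
  have hp1 : 1 ≤ p := by rw [hp, le_div_iff₀ hb, one_mul]; exact hbn
  have hp0 : 0 < p := by linarith
  apply nr_le_of_lintegral_le hn hb
  rw [← hp]
  have hFm : Measurable (fun z : Rn n × ℝ => F z.2 z.1) := hF.comp measurable_swap
  -- Jensen for the weight `m`, applied to `F s x / m s`, whose norm in `x` is at most one. The
  -- division is the reason why `m` must be neither `0` nor `⊤` on `S`.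
  have e : ∀ x, (∫⁻ s in S, F s x) ^ p ≤
      (∫⁻ s in S, m s) ^ (p - 1) * ∫⁻ s in S, m s * (F s x / m s) ^ p := by
    intro x
    have hFx : Measurable (fun s => F s x) := hFm.comp measurable_prodMk_left
    have : ∫⁻ s in S, F s x = ∫⁻ s in S, m s * (F s x / m s) := by
      refine setLIntegral_congr_fun hS fun s hs => ?_
      exact (ENNReal.mul_div_cancel (h0 s hs) (ht s hs)).symm
    rw [this]
    exact lintegral_mul_rpow_le (by fun_prop) (by fun_prop) hp1
  calc ∫⁻ x, (∫⁻ s in S, F s x) ^ p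
      ≤ ∫⁻ x, (∫⁻ s in S, m s) ^ (p - 1) * ∫⁻ s in S, m s * (F s x / m s) ^ p :=
        lintegral_mono e
    _ = (∫⁻ s in S, m s) ^ (p - 1) * ∫⁻ s in S, ∫⁻ x, m s * (F s x / m s) ^ p := by
        rw [lintegral_const_mul, lintegral_lintegral_swap]
        · fun_prop
        · exact Measurable.lintegral_prod_right' (f := fun z : Rn n × ℝ =>
            m z.2 * (F z.2 z.1 / m z.2) ^ p) (by fun_prop)
    _ ≤ (∫⁻ s in S, m s) ^ (p - 1) * ∫⁻ s in S, m s := by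
        gcongr 1
        refine setLIntegral_mono hm fun s hs => ?_
        have hFs : Measurable (F s) := hF.comp measurable_prodMk_left
        rw [lintegral_const_mul _ (by fun_prop)]
        simp_rw [ENNReal.div_rpow_of_nonneg _ _ hp0.le, div_eq_mul_inv]
        rw [lintegral_mul_const _ (by fun_prop), ← nr_rpow hn hb, ← hp, ← div_eq_mul_inv,
          ← ENNReal.div_rpow_of_nonneg _ _ hp0.le]
        have : nr b (F s) / m s ≤ 1 := ENNReal.div_le_of_le_mul (by simpa using h s hs)
        calc m s * (nr b (F s) / m s) ^ p ≤ m s * 1 ^ p := by gcongr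
          _ = m s := by simp
    _ = (∫⁻ s in S, m s) ^ p := by
        nth_rw 2 [← ENNReal.rpow_one (∫⁻ s in S, m s)]
        rw [← ENNReal.rpow_add_of_nonneg _ _ (by linarith) (by norm_num)]
        congr 1; ring

/-! ### Gaussian averages and their smoothing estimates. -/

/-- The Gaussian `t^{-n/2} exp(-c|x|²/t)`. -/
noncomputable def gauss (c t : ℝ) (x : Rn n) : ℝ := t ^ (-(n / 2) : ℝ) * Real.exp (-c * ‖x‖ ^ 2 / t)

/-- Convolution with the Gaussian `t^{-n/2} exp(-c|x|²/t)`. -/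
noncomputable def gconv (c t : ℝ) (f : Rn n → ℝ≥0∞) (x : Rn n) : ℝ≥0∞ :=
  ∫⁻ y, ENNReal.ofReal (gauss c t (x - y)) * f y

@[fun_prop]
lemma measurable_gauss (c : ℝ) {α : Type*} [MeasurableSpace α] {T : α → ℝ} {X : α → Rn n}
    (hT : Measurable T) (hX : Measurable X) : Measurable (fun a => gauss c (T a) (X a)) := by
  unfold gauss; fun_prop

lemma gauss_nonneg (c : ℝ) {t : ℝ} (ht : 0 < t) (x : Rn n) : 0 ≤ gauss c t x := by
  unfold gauss; positivity

lemma gauss_le {c : ℝ} (hc : 0 ≤ c) {t : ℝ} (ht : 0 < t) (x : Rn n) :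
    gauss c t x ≤ t ^ (-(n / 2) : ℝ) := by
  unfold gauss
  refine mul_le_of_le_one_right (by positivity) (Real.exp_le_one_iff.2 ?_)
  have : 0 ≤ c * ‖x‖ ^ 2 / t := by positivity
  rw [neg_mul, neg_div]; linarith

lemma integrable_gauss {c : ℝ} (hc : 0 < c) {t : ℝ} (ht : 0 < t) :
    Integrable (fun x : Rn n => gauss c t x) := by
  unfold gauss
  have := (GaussianFourier.integrable_cexp_neg_mul_sq_norm_add (V := Rn n) (b := (c / t : ℝ))
    (by simpa using by positivity) 0 0).norm
  refine (this.const_mul (t ^ (-(n / 2) : ℝ))).congr (Eventually.of_forall fun x => ?_)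
  simp [Complex.norm_exp, ← Complex.ofReal_pow]
  left; ring

lemma integral_gauss {c : ℝ} (hc : 0 < c) {t : ℝ} (ht : 0 < t) :
    ∫ x : Rn n, gauss c t x = (Real.pi / c) ^ (n / 2 : ℝ) := by
  unfold gauss
  have h := GaussianFourier.integral_rexp_neg_mul_sq_norm (V := Rn n) (b := c / t) (by positivity)
  rw [integral_const_mul]
  have e : ∀ x : Rn n, -c * ‖x‖ ^ 2 / t = -(c / t) * ‖x‖ ^ 2 := fun x => by ring
  simp_rw [e, h]
  rw [show Real.pi / (c / t) = t * (Real.pi / c) by field_simp,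
    Real.mul_rpow ht.le (by positivity), ← mul_assoc, finrank_euclideanSpace_fin,
    ← Real.rpow_add ht]
  simp

lemma lintegral_gauss {c : ℝ} (hc : 0 < c) {t : ℝ} (ht : 0 < t) (x : Rn n) :
    ∫⁻ y, ENNReal.ofReal (gauss c t (x - y)) = ENNReal.ofReal ((Real.pi / c) ^ (n / 2 : ℝ)) := by
  rw [lintegral_sub_left_eq_self (fun y : Rn n => ENNReal.ofReal (gauss c t y)) x,
    ← ofReal_integral_eq_lintegral_ofReal (integrable_gauss hc ht)
      (Eventually.of_forall fun x => gauss_nonneg c ht x), integral_gauss hc ht]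

lemma lintegral_gauss' {c : ℝ} (hc : 0 < c) {t : ℝ} (ht : 0 < t) (y : Rn n) :
    ∫⁻ x, ENNReal.ofReal (gauss c t (x - y)) = ENNReal.ofReal ((Real.pi / c) ^ (n / 2 : ℝ)) := by
  rw [lintegral_sub_right_eq_self (fun y : Rn n => ENNReal.ofReal (gauss c t y)) y,
    ← ofReal_integral_eq_lintegral_ofReal (integrable_gauss hc ht)
      (Eventually.of_forall fun x => gauss_nonneg c ht x), integral_gauss hc ht]

lemma measurable_gconv_uncurry (c : ℝ) {f : ℝ → Rn n → ℝ≥0∞}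
    (hf : Measurable (Function.uncurry f)) {T : ℝ → ℝ} (hT : Measurable T) :
    Measurable (fun p : ℝ × Rn n => gconv c (T p.1) (f p.1) p.2) := by
  unfold gconv
  have : Measurable (fun q : (ℝ × Rn n) × Rn n => f q.1.1 q.2) :=
    hf.comp (by fun_prop : Measurable (fun q : (ℝ × Rn n) × Rn n => (q.1.1, q.2)))
  exact Measurable.lintegral_prod_right' (f := fun q : (ℝ × Rn n) × Rn n =>
    ENNReal.ofReal (gauss c (T q.1.1) (q.1.2 - q.2)) * f q.1.1 q.2) (by fun_prop)

lemma measurable_gconv (c : ℝ) {f : Rn n → ℝ≥0∞} (hf : Measurable f) :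
    Measurable (fun p : ℝ × Rn n => gconv c p.1 f p.2) :=
  measurable_gconv_uncurry c (f := fun _ => f) (hf.comp measurable_snd) measurable_id

lemma measurable_gconv_right (c t : ℝ) {f : Rn n → ℝ≥0∞} (hf : Measurable f) :
    Measurable (gconv c t f) :=
  (measurable_gconv c hf).comp measurable_prodMk_left

/-- The mass of the Gaussian. -/
noncomputable def gmass (n : ℕ) (c : ℝ) : ℝ≥0 := Real.toNNReal ((Real.pi / c) ^ (n / 2 : ℝ))

lemma gconv_rpow_le {c : ℝ} (hc : 0 < c) {t : ℝ} (ht : 0 < t) {f : Rn n → ℝ≥0∞}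
    (hf : Measurable f) {p : ℝ} (hp : 1 ≤ p) (x : Rn n) :
    gconv c t f x ^ p ≤ (gmass n c : ℝ≥0∞) ^ (p - 1) * gconv c t (fun y => f y ^ p) x := by
  have := lintegral_mul_rpow_le (μ := volume)
    (k := fun y => ENNReal.ofReal (gauss c t (x - y))) (f := f) (by fun_prop) (by fun_prop) hp
  rwa [lintegral_gauss hc ht] at this

lemma gconv_le_lintegral {c : ℝ} (hc : 0 ≤ c) {t : ℝ} (ht : 0 < t) {f : Rn n → ℝ≥0∞}
    (hf : Measurable f) (x : Rn n) :
    gconv c t f x ≤ pw t (-(n / 2)) * ∫⁻ y, f y := by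
  rw [← lintegral_const_mul _ hf]
  refine lintegral_mono fun y => ?_
  gcongr
  exact ENNReal.ofReal_le_ofReal (gauss_le hc ht _)

lemma lintegral_gconv {c : ℝ} (hc : 0 < c) {t : ℝ} (ht : 0 < t) {f : Rn n → ℝ≥0∞}
    (hf : Measurable f) : ∫⁻ x, gconv c t f x = gmass n c * ∫⁻ y, f y := by
  unfold gconv
  rw [lintegral_lintegral_swap (by fun_prop), ← lintegral_const_mul _ hf]
  refine lintegral_congr fun y => ?_
  rw [lintegral_mul_const _ (by fun_prop), lintegral_gauss' hc ht]; rfl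

lemma gconv_le_of_le {c : ℝ} (hc : 0 < c) {t : ℝ} (ht : 0 < t) {f : Rn n → ℝ≥0∞} {B : ℝ≥0∞}
    (h : ∀ x, f x ≤ B) (x : Rn n) : gconv c t f x ≤ gmass n c * B := by
  calc gconv c t f x ≤ ∫⁻ y, ENNReal.ofReal (gauss c t (x - y)) * B :=
        lintegral_mono fun y => by gcongr; exact h y
    _ = _ := by rw [lintegral_mul_const _ (by fun_prop), lintegral_gauss hc ht]; rfl

/-- Jensen moves the power `p = n / b` onto `f`; the maximum `t^(-n/2)` of the Gaussian then gives
the rate, since `n/2` divided by `p` is `b/2`. -/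
lemma gconv_le_nr (hn : 0 < n) {b : ℝ} (hb : 0 < b) (hbn : b ≤ n) {c : ℝ} (hc : 0 < c) :
    ∃ C : ℝ≥0, ∀ t : ℝ, 0 < t → ∀ f : Rn n → ℝ≥0∞, Measurable f → ∀ x,
      gconv c t f x ≤ C * pw t (-(b / 2)) * nr b f := by
  have hn' : (0:ℝ) < n := by exact_mod_cast hn
  set p : ℝ := n / b with hp
  have hp1 : 1 ≤ p := by rw [hp, le_div_iff₀ hb, one_mul]; exact hbn
  have hp0 : 0 < p := by linarith
  refine ⟨(gmass n c) ^ ((p - 1) / p), fun t ht f hf x => ?_⟩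
  rw [← ENNReal.rpow_le_rpow_iff hp0]
  refine (gconv_rpow_le hc ht hf hp1 x).trans ?_
  rw [ENNReal.mul_rpow_of_nonneg _ _ hp0.le, ENNReal.mul_rpow_of_nonneg _ _ hp0.le, pw_rpow ht,
    nr_rpow hn hb, ENNReal.coe_rpow_of_nonneg _ (div_nonneg (by linarith) hp0.le),
    ← ENNReal.rpow_mul, div_mul_cancel₀ _ hp0.ne', mul_assoc]
  gcongr
  refine (gconv_le_lintegral hc.le ht (by fun_prop) x).trans (le_of_eq ?_)
  congr 2
  rw [hp]; field_simp

/-- The smoothing estimate `L^{n/b} → L^{n/β}` for the Gaussian semigroup. -/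
lemma nr_gconv_le (hn : 0 < n) {b β : ℝ} (hβ : 0 < β) (hβb : β ≤ b) (hbn : b ≤ n) {c : ℝ}
    (hc : 0 < c) :
    ∃ C : ℝ≥0, ∀ t : ℝ, 0 < t → ∀ f : Rn n → ℝ≥0∞, Measurable f →
      nr β (gconv c t f) ≤ C * pw t (-((b - β) / 2)) * nr b f := by
  have hn' : (0:ℝ) < n := by exact_mod_cast hn
  have hb : 0 < b := by linarith
  obtain ⟨C, hC⟩ := gconv_le_nr hn hb hbn hc
  set p : ℝ := n / b with hp
  set q : ℝ := n / β with hq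
  have hp1 : 1 ≤ p := by rw [hp, le_div_iff₀ hb, one_mul]; exact hbn
  have hp0 : 0 < p := by linarith
  have hpq : p ≤ q := by rw [hp, hq]; gcongr
  have hq0 : 0 < q := by linarith
  refine ⟨(C ^ (q - p) * gmass n c ^ p) ^ (1 / q), fun t ht f hf => ?_⟩
  apply nr_le_of_lintegral_le hn hβ
  rw [← hq]
  -- Interpolation: of the `q` powers, `q - p` are estimated by the supremum and the remaining `p`
  -- by Jensen and the mass of the Gaussian.
  calc ∫⁻ x, gconv c t f x ^ q
      ≤ ∫⁻ x, (C * pw t (-(b / 2)) * nr b f) ^ (q - p) *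
          ((gmass n c : ℝ≥0∞) ^ (p - 1) * gconv c t (fun y => f y ^ p) x) := by
        refine lintegral_mono fun x => ?_
        rw [show q = (q - p) + p by ring, ENNReal.rpow_add_of_nonneg _ _ (by linarith) hp0.le,
          add_sub_cancel_right]
        gcongr
        · exact hC t ht f hf x
        · exact gconv_rpow_le hc ht hf hp1 x
    _ = (C * pw t (-(b / 2)) * nr b f) ^ (q - p) *
          ((gmass n c : ℝ≥0∞) ^ (p - 1) * (gmass n c * nr b f ^ p)) := by
        rw [lintegral_const_mul _ ((measurable_gconv_right c t (by fun_prop)).const_mul _),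
          lintegral_const_mul _ (measurable_gconv_right c t (by fun_prop)),
          lintegral_gconv hc ht (by fun_prop), nr_rpow hn hb]
    _ = _ := by
        rw [ENNReal.coe_rpow_of_nonneg _ (by positivity), ENNReal.coe_mul,
          ENNReal.coe_rpow_of_nonneg _ (by linarith), ENNReal.coe_rpow_of_nonneg _ hp0.le,
          ENNReal.mul_rpow_of_nonneg _ _ hq0.le, ENNReal.mul_rpow_of_nonneg _ _ hq0.le,
          ENNReal.mul_rpow_of_nonneg _ _ (by linarith), ENNReal.mul_rpow_of_nonneg _ _ (by linarith),
          ← ENNReal.rpow_mul, one_div_mul_cancel hq0.ne', ENNReal.rpow_one, pw_rpow ht, pw_rpow ht]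
        have e1 : -(b / 2) * (q - p) = -((b - β) / 2) * q := by
          rw [hp, hq]; field_simp
        have e2 : (gmass n c : ℝ≥0∞) ^ p = (gmass n c : ℝ≥0∞) ^ (p - 1) * gmass n c := by
          conv_rhs => rw [← ENNReal.rpow_one (gmass n c : ℝ≥0∞), ← ENNReal.rpow_mul, one_mul]
          rw [← ENNReal.rpow_add_of_nonneg _ _ (by linarith) (by norm_num), sub_add_cancel]
        have e3 : nr b f ^ q = nr b f ^ (q - p) * nr b f ^ p := by
          rw [← ENNReal.rpow_add_of_nonneg _ _ (by linarith) (by linarith), sub_add_cancel]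
        rw [e1, e2, e3]
        ring

/-! ### The order-one potential and the Hardy–Littlewood–Sobolev inequality. -/

lemma rpow_le_lintegral_lt {q : ℝ} (hq : 0 < q) (F : ℝ≥0∞) :
    F ^ q ≤ ∫⁻ α in Set.Ioi (0:ℝ), ENNReal.ofReal q * pw α (q - 1) *
      (if ENNReal.ofReal α < F then 1 else 0) := by
  -- Layer-cake inequality, tested against every finite `r < F ^ q` so that `F = ⊤` is covered: the
  -- heights `α ≤ r ^ (1 / q)` alone contribute `r`.
  refine ENNReal.le_of_forall_nnreal_lt fun r hr => ?_
  have hA : ((r ^ (1 / q) : ℝ≥0) : ℝ≥0∞) < F := by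
    rw [← ENNReal.rpow_lt_rpow_iff hq, ENNReal.coe_rpow_of_nonneg _ (by positivity),
      ← ENNReal.rpow_mul, one_div_mul_cancel hq.ne', ENNReal.rpow_one]
    exact hr
  set A : ℝ≥0 := r ^ (1 / q) with hAdef
  calc (r : ℝ≥0∞) = ∫⁻ α in Set.Ioc (0:ℝ) A, ENNReal.ofReal q * pw α (q - 1) := by
        rw [lintegral_const_mul _ (by fun_prop), lintegral_pw_Ioc (a := q - 1) (by linarith) A.coe_nonneg,
          ← ENNReal.ofReal_mul hq.le, sub_add_cancel, mul_div_cancel₀ _ hq.ne', hAdef,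
          NNReal.coe_rpow, ← Real.rpow_mul r.coe_nonneg, one_div_mul_cancel hq.ne', Real.rpow_one]
        simp
    _ ≤ ∫⁻ α in Set.Ioc (0:ℝ) A, ENNReal.ofReal q * pw α (q - 1) *
      (if ENNReal.ofReal α < F then 1 else 0) := by
        refine setLIntegral_mono' measurableSet_Ioc fun α hα => ?_
        rw [if_pos, mul_one]
        refine lt_of_le_of_lt ?_ hA
        rw [← ENNReal.ofReal_coe_nnreal]
        exact ENNReal.ofReal_le_ofReal hα.2
    _ ≤ _ := lintegral_mono_set fun α hα => hα.1

/-- The potential `∫₀^∞ s^{-1/2} G_s ∗ f ds`, comparable to the Riesz potential of order one. -/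
noncomputable def riesz (c : ℝ) (f : Rn n → ℝ≥0∞) (x : Rn n) : ℝ≥0∞ :=
  ∫⁻ s in Set.Ioi (0:ℝ), pw s (-(1 / 2)) * gconv c s f x

lemma measurable_riesz (c : ℝ) {f : Rn n → ℝ≥0∞} (hf : Measurable f) :
    Measurable (riesz c f) := by
  have h : Measurable (fun p : Rn n × ℝ => pw p.2 (-(1 / 2)) * gconv c p.2 f p.1) :=
    ((measurable_pw _).comp measurable_snd).mul
      ((measurable_gconv c hf).comp measurable_swap)
  exact h.lintegral_prod_right'

lemma measurable_riesz_uncurry (c : ℝ) {f : ℝ → Rn n → ℝ≥0∞}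
    (hf : Measurable (Function.uncurry f)) :
    Measurable (fun p : ℝ × Rn n => riesz c (f p.1) p.2) := by
  unfold riesz gconv
  have h1 : Measurable (fun q : ((ℝ × Rn n) × ℝ) × Rn n => f q.1.1.1 q.2) :=
    hf.comp (by fun_prop : Measurable (fun q : ((ℝ × Rn n) × ℝ) × Rn n => (q.1.1.1, q.2)))
  have h2 : Measurable (fun q : (ℝ × Rn n) × ℝ =>
      ∫⁻ y, ENNReal.ofReal (gauss c q.2 (q.1.2 - y)) * f q.1.1 y) :=
    Measurable.lintegral_prod_right' (f := fun q : ((ℝ × Rn n) × ℝ) × Rn n =>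
      ENNReal.ofReal (gauss c q.1.2 (q.1.1.2 - q.2)) * f q.1.1.1 q.2) (by fun_prop)
  exact Measurable.lintegral_prod_right' (f := fun q : (ℝ × Rn n) × ℝ =>
    pw q.2 (-(1 / 2)) * ∫⁻ y, ENNReal.ofReal (gauss c q.2 (q.1.2 - y)) * f q.1.1 y)
    (((measurable_pw _).comp measurable_snd).mul h2)

lemma gconv_const_mul (c t : ℝ) {f : Rn n → ℝ≥0∞} (hf : Measurable f) (k : ℝ≥0∞) (x : Rn n) :
    gconv c t (fun y => k * f y) x = k * gconv c t f x := by
  unfold gconv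
  rw [← lintegral_const_mul _ (by fun_prop)]
  exact lintegral_congr fun y => by ring

lemma gconv_add (c t : ℝ) {f g : Rn n → ℝ≥0∞} (hf : Measurable f) (x : Rn n) :
    gconv c t (fun y => f y + g y) x = gconv c t f x + gconv c t g x := by
  unfold gconv
  rw [← lintegral_add_left (by fun_prop)]
  exact lintegral_congr fun y => by ring

lemma gconv_mono (c t : ℝ) {f g : Rn n → ℝ≥0∞} (h : ∀ y, f y ≤ g y) (x : Rn n) :
    gconv c t f x ≤ gconv c t g x := by
  unfold gconv
  gcongr with y
  exact h y

lemma riesz_const_mul (c : ℝ) {f : Rn n → ℝ≥0∞} (hf : Measurable f) (k : ℝ≥0∞) (x : Rn n) :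
    riesz c (fun y => k * f y) x = k * riesz c f x := by
  unfold riesz
  have : Measurable (fun s => pw s (-(1 / 2)) * gconv c s f x) :=
    (measurable_pw _).mul ((measurable_gconv c hf).comp measurable_prodMk_right)
  rw [← lintegral_const_mul _ this]
  refine lintegral_congr fun y => ?_
  rw [gconv_const_mul c y hf]; ring

lemma riesz_add (c : ℝ) {f g : Rn n → ℝ≥0∞} (hf : Measurable f) (x : Rn n) :
    riesz c (fun y => f y + g y) x = riesz c f x + riesz c g x := by
  unfold riesz
  have : Measurable (fun s => pw s (-(1 / 2)) * gconv c s f x) :=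
    (measurable_pw _).mul ((measurable_gconv c hf).comp measurable_prodMk_right)
  rw [← lintegral_add_left this]
  refine lintegral_congr fun y => ?_
  rw [gconv_add c y hf]; ring

lemma riesz_mono (c : ℝ) {f g : Rn n → ℝ≥0∞} (h : ∀ y, f y ≤ g y) (x : Rn n) :
    riesz c f x ≤ riesz c g x := by
  unfold riesz
  gcongr with y
  exact gconv_mono c y h x

/-- The rate `s^(-b/2)` of the Gaussian averages makes the integrand of size `s^(-(b+1)/2)`,
integrable at infinity because `b > 1`. -/
lemma riesz_far_le (hn : 0 < n) {b : ℝ} (hb1 : 1 < b) (hbn : b ≤ n) {c : ℝ} (hc : 0 < c) :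
    ∃ C : ℝ, 0 < C ∧ ∀ A : ℝ, 0 < A → ∀ f : Rn n → ℝ≥0∞, Measurable f → nr b f ≤ 1 → ∀ x,
      ∫⁻ s in Set.Ioi (A ^ 2), pw s (-(1 / 2)) * gconv c s f x ≤ ENNReal.ofReal (C * A ^ (1 - b)) := by
  obtain ⟨C, hC⟩ := gconv_le_nr hn (by linarith) hbn hc
  refine ⟨(C + 1) * (2 / (b - 1)), mul_pos (by positivity) (div_pos (by norm_num) (by linarith)),
    fun A hA f hf h1 x => ?_⟩
  calc ∫⁻ s in Set.Ioi (A ^ 2), pw s (-(1 / 2)) * gconv c s f x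
      ≤ ∫⁻ s in Set.Ioi (A ^ 2), (C + 1 : ℝ≥0) * pw s (-((b + 1) / 2)) := by
        refine setLIntegral_mono' measurableSet_Ioi fun s hs => ?_
        have hs0 : 0 < s := lt_trans (by positivity) hs
        calc pw s (-(1 / 2)) * gconv c s f x
            ≤ pw s (-(1 / 2)) * (C * pw s (-(b / 2)) * 1) := by
              gcongr; exact (hC s hs0 f hf x).trans (by gcongr)
          _ = C * pw s (-((b + 1) / 2)) := by
              rw [show -((b + 1) / 2) = -(1 / 2) + -(b / 2) by ring, pw_add hs0]; ring
          _ ≤ _ := by gcongr; simp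
    _ = _ := by
        rw [lintegral_const_mul _ (by fun_prop), lintegral_pw_Ioi (by linarith) (by positivity),
          ← ENNReal.ofReal_coe_nnreal, ← ENNReal.ofReal_mul (by positivity)]
        congr 1
        rw [← Real.rpow_natCast, ← Real.rpow_mul hA.le,
          show ((2:ℕ):ℝ) * (-((b + 1) / 2) + 1) = 1 - b by push_cast; ring,
          show -((b + 1) / 2) + 1 = -((b - 1) / 2) by ring]
        push_cast
        have : b - 1 ≠ 0 := by linarith
        field_simp

/-- The Hardy–Littlewood–Sobolev inequality, normalised form. -/
lemma lintegral_riesz_rpow_le (hn : 0 < n) {b : ℝ} (hb1 : 1 < b) (hbn : b < n) {c : ℝ}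
    (hc : 0 < c) :
    ∃ C : ℝ≥0, ∀ f : Rn n → ℝ≥0∞, Measurable f → (∀ x, f x ≠ ⊤) → nr b f ≤ 1 →
      ∫⁻ x, riesz c f x ^ ((n:ℝ) / (b - 1)) ≤ C * ∫⁻ x, f x ^ ((n:ℝ) / b) := by
  have hn' : (0:ℝ) < n := by exact_mod_cast hn
  have hb10 : 0 < b - 1 := by linarith
  have hb0 : 0 < b := by linarith
  -- A Marcinkiewicz argument at each height `α`. The radius `A α` makes the contribution of the
  -- times `s > A²` at most `α/2`; the level `γ α` makes the part of `f` below it contribute at most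
  -- `α/4` from the times `s ≤ A²`. If the potential exceeds `α`, the part of `f` above the level
  -- must supply the remaining `α/4`, and Markov's inequality controls this in `L¹`.
  obtain ⟨D, hD, hfar⟩ := riesz_far_le hn hb1 hbn.le hc
  set q : ℝ := n / (b - 1) with hq
  have hq0 : 0 < q := by positivity
  set k : ℝ := gmass n c + 1 with hk
  have hk0 : 0 < k := by positivity
  set e : ℝ := q - 2 - 1 / (b - 1) with he
  have he1 : e + 1 = (n - b) / (b - 1) := by rw [he, hq]; field_simp; ring
  have he0 : 0 < e + 1 := by rw [he1]; apply div_pos <;> linarith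
  -- radius and level attached to the height `α`
  set A : ℝ → ℝ := fun α => (α / (2 * D)) ^ (-(1 / (b - 1))) with hA
  set γ : ℝ → ℝ := fun α => α / (8 * k * A α) with hγ
  set D₁ : ℝ := (2 * D) ^ (1 / (b - 1)) with hD₁
  have hD₁0 : 0 < D₁ := by positivity
  have hAeq : ∀ α, 0 < α → A α = D₁ * α ^ (-(1 / (b - 1))) := by
    intro α hα
    simp only [hA, hD₁]
    rw [Real.div_rpow hα.le (by positivity), Real.rpow_neg (by positivity : 0 ≤ 2 * D)]
    field_simp
  have hApos : ∀ α, 0 < α → 0 < A α := fun α hα => by simp only [hA]; positivity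
  set D₂ : ℝ := (8 * k * D₁) ^ ((b - 1) / b) with hD₂
  -- `γ α` is a multiple of `α^(b/(b-1))`; inverting this, the heights whose level lies below a
  -- value `r` are bounded by a multiple of `r^((b-1)/b)`.
  have hlevel : ∀ α, 0 < α → ∀ r : ℝ, 0 ≤ r → γ α < r → α ≤ D₂ * r ^ ((b - 1) / b) := by
    intro α hα r hr h
    have h1 : γ α * (8 * k * D₁) = α ^ (b / (b - 1)) := by
      simp only [hγ]
      rw [hAeq α hα, show b / (b - 1) = 1 + 1 / (b - 1) by field_simp; ring, Real.rpow_add hα,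
        Real.rpow_one, Real.rpow_neg hα.le]
      field_simp
    have h2 : α ^ (b / (b - 1)) ≤ 8 * k * D₁ * r := by
      rw [← h1, mul_comm]; gcongr
    calc α = (α ^ (b / (b - 1))) ^ ((b - 1) / b) := by
          rw [← Real.rpow_mul hα.le]
          rw [show b / (b - 1) * ((b - 1) / b) = 1 by field_simp, Real.rpow_one]
      _ ≤ (8 * k * D₁ * r) ^ ((b - 1) / b) := by gcongr
      _ = _ := by rw [Real.mul_rpow (by positivity) hr]
  set D₃ : ℝ := q * (8 * k * D₁) with hD₃
  refine ⟨Real.toNNReal (D₃ * (D₂ ^ (e + 1) / (e + 1))), fun f hf hft hf1 => ?_⟩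
  have hmeas : MeasurableSet {z : ℝ × Rn n | ENNReal.ofReal (γ z.1) < f z.2} :=
    measurableSet_lt (by simp only [hγ, hA]; fun_prop) (by fun_prop)
  -- the distribution function
  have hdist : ∀ α, 0 < α → ENNReal.ofReal q * pw α (q - 1) *
      volume {x | ENNReal.ofReal α < riesz c f x} ≤
      ENNReal.ofReal D₃ * pw α e * ∫⁻ x, (if ENNReal.ofReal (γ α) < f x then f x else 0) := by
    intro α hα
    have hAα := hApos α hα
    have hγα : 0 < γ α := by simp only [hγ]; positivity
    set f1 : Rn n → ℝ≥0∞ := fun x => if ENNReal.ofReal (γ α) < f x then f x else 0 with hf1d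
    set f2 : Rn n → ℝ≥0∞ := fun x => if ENNReal.ofReal (γ α) < f x then 0 else f x with hf2d
    have hset : MeasurableSet {x | ENNReal.ofReal (γ α) < f x} :=
      measurableSet_lt measurable_const hf
    have hf1m : Measurable f1 := Measurable.ite hset hf measurable_const
    have hf2m : Measurable f2 := Measurable.ite hset measurable_const hf
    have hsum : f = fun x => f1 x + f2 x := by
      funext x; simp only [hf1d, hf2d]; split_ifs <;> simp
    have hnm : Measurable (fun z : ℝ × Rn n => pw z.1 (-(1 / 2)) * gconv c z.1 f1 z.2) :=
      ((measurable_pw _).comp measurable_fst).mul (measurable_gconv c hf1m)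
    set near : Rn n → ℝ≥0∞ := fun x =>
      ∫⁻ s in Set.Ioc 0 (A α ^ 2), pw s (-(1 / 2)) * gconv c s f1 x with hnear
    have hnearm : Measurable near :=
      Measurable.lintegral_prod_right' (f := fun z : Rn n × ℝ =>
        pw z.2 (-(1 / 2)) * gconv c z.2 f1 z.1) (hnm.comp measurable_swap)
    have hhalf : ∫⁻ s in Set.Ioc 0 (A α ^ 2), pw s (-(1 / 2)) = ENNReal.ofReal (2 * A α) := by
      rw [lintegral_pw_Ioc (by norm_num) (by positivity), ← Real.rpow_natCast,
        ← Real.rpow_mul hAα.le, show ((2:ℕ):ℝ) * (-(1 / 2) + 1) = 1 by norm_num, Real.rpow_one]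
      congr 1; ring
    have hkm : (gmass n c : ℝ≥0∞) ≤ ENNReal.ofReal k := by
      rw [← ENNReal.ofReal_coe_nnreal]
      exact ENNReal.ofReal_le_ofReal (by rw [hk]; linarith)
    have hsub : {x | ENNReal.ofReal α < riesz c f x} ⊆ {x | ENNReal.ofReal (α / 4) ≤ near x} := by
      intro x hx
      by_contra hcon
      simp only [Set.mem_ofPred_eq, not_le] at hcon hx
      refine absurd hx (not_lt.2 ?_)
      have hm1 : Measurable (fun s => pw s (-(1 / 2)) * gconv c s f1 x) :=
        hnm.comp measurable_prodMk_right
      unfold riesz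
      rw [← Set.Ioc_union_Ioi_eq_Ioi (show (0:ℝ) ≤ A α ^ 2 by positivity),
        lintegral_union measurableSet_Ioi (Set.Ioc_disjoint_Ioi le_rfl)]
      have p1 : ∫⁻ s in Set.Ioi (A α ^ 2), pw s (-(1 / 2)) * gconv c s f x
          ≤ ENNReal.ofReal (α / 2) := by
        refine (hfar (A α) hAα f hf hf1 x).trans (le_of_eq ?_)
        congr 1
        simp only [hA]
        rw [← Real.rpow_mul (by positivity), show -(1 / (b - 1)) * (1 - b) = 1 by
          field_simp; ring, Real.rpow_one]
        field_simp
      have p2 : ∫⁻ s in Set.Ioc 0 (A α ^ 2), pw s (-(1 / 2)) * gconv c s f2 x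
          ≤ ENNReal.ofReal (α / 4) := by
        calc ∫⁻ s in Set.Ioc 0 (A α ^ 2), pw s (-(1 / 2)) * gconv c s f2 x
            ≤ ∫⁻ s in Set.Ioc 0 (A α ^ 2), pw s (-(1 / 2)) *
                (ENNReal.ofReal k * ENNReal.ofReal (γ α)) := by
              refine setLIntegral_mono' measurableSet_Ioc fun s hs => ?_
              gcongr
              refine (gconv_le_of_le hc hs.1 (B := ENNReal.ofReal (γ α)) (fun y => ?_) x).trans ?_
              · simp only [hf2d]; split_ifs with h
                · simp
                · exact not_lt.1 h
              · gcongr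
          _ = ENNReal.ofReal (α / 4) := by
              rw [lintegral_mul_const _ (by fun_prop), hhalf, ← ENNReal.ofReal_mul hk0.le,
                ← ENNReal.ofReal_mul (by positivity)]
              congr 1
              simp only [hγ]; field_simp; ring
      calc _ = (near x + ∫⁻ s in Set.Ioc 0 (A α ^ 2), pw s (-(1 / 2)) * gconv c s f2 x)
            + ∫⁻ s in Set.Ioi (A α ^ 2), pw s (-(1 / 2)) * gconv c s f x := by
            congr 1
            rw [hnear, ← lintegral_add_left hm1]
            refine lintegral_congr fun s => ?_
            conv_lhs => rw [hsum]
            rw [gconv_add c s hf1m, mul_add]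
        _ ≤ (ENNReal.ofReal (α / 4) + ENNReal.ofReal (α / 4)) + ENNReal.ofReal (α / 2) := by
            gcongr
        _ = ENNReal.ofReal α := by
            rw [← ENNReal.ofReal_add (by positivity) (by positivity),
              ← ENNReal.ofReal_add (by positivity) (by positivity)]
            congr 1; ring
    have hnint : ∫⁻ x, near x ≤ ENNReal.ofReal (2 * A α * k) * ∫⁻ x, f1 x := by
      have hu : Measurable (Function.uncurry fun (x : Rn n) s => pw s (-(1 / 2)) * gconv c s f1 x) :=
        hnm.comp measurable_swap
      rw [hnear, lintegral_lintegral_swap hu.aemeasurable]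
      calc ∫⁻ s in Set.Ioc 0 (A α ^ 2), ∫⁻ x, pw s (-(1 / 2)) * gconv c s f1 x
          ≤ ∫⁻ s in Set.Ioc 0 (A α ^ 2), pw s (-(1 / 2)) * (ENNReal.ofReal k * ∫⁻ x, f1 x) := by
            refine setLIntegral_mono' measurableSet_Ioc fun s hs => ?_
            rw [lintegral_const_mul _ (measurable_gconv_right c s hf1m), lintegral_gconv hc hs.1 hf1m]
            gcongr
        _ = _ := by
            rw [lintegral_mul_const _ (by fun_prop), hhalf, ← mul_assoc,
              ← ENNReal.ofReal_mul (by positivity)]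
    have hmarkov : ENNReal.ofReal (α / 4) * volume {x | ENNReal.ofReal α < riesz c f x} ≤
        ENNReal.ofReal (2 * A α * k) * ∫⁻ x, f1 x :=
      (mul_le_mul_right (measure_mono hsub) _).trans
        ((mul_meas_ge_le_lintegral hnearm _).trans hnint)
    have hfac : ENNReal.ofReal q * pw α (q - 1) =
        ENNReal.ofReal (q * α ^ (q - 1) * (4 / α)) * ENNReal.ofReal (α / 4) := by
      rw [← ENNReal.ofReal_mul (by positivity), pw, ← ENNReal.ofReal_mul hq0.le]
      congr 1; field_simp
    rw [hfac, mul_assoc]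
    refine (mul_le_mul_right hmarkov _).trans (le_of_eq ?_)
    rw [← mul_assoc, ← ENNReal.ofReal_mul (by positivity), pw, ← ENNReal.ofReal_mul (by positivity)]
    congr 2
    rw [hAeq α hα, hD₃, he, show q - 1 = (q - 2 - 1 / (b - 1)) + 1 + 1 / (b - 1) by ring,
      Real.rpow_add hα, Real.rpow_add hα, Real.rpow_neg hα.le, Real.rpow_one]
    field_simp
    norm_num
  have hrm := measurable_riesz c hf
  calc ∫⁻ x, riesz c f x ^ q
      ≤ ∫⁻ x, ∫⁻ α in Set.Ioi (0:ℝ), ENNReal.ofReal q * pw α (q - 1) *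
          (if ENNReal.ofReal α < riesz c f x then 1 else 0) :=
        lintegral_mono fun x => rpow_le_lintegral_lt hq0 _
    _ = ∫⁻ α in Set.Ioi (0:ℝ), ∫⁻ x, ENNReal.ofReal q * pw α (q - 1) *
          (if ENNReal.ofReal α < riesz c f x then 1 else 0) := by
        refine lintegral_lintegral_swap (Measurable.aemeasurable ?_)
        refine Measurable.mul (by fun_prop) (Measurable.ite ?_ measurable_const measurable_const)
        exact measurableSet_lt (by fun_prop) (hrm.comp measurable_fst)
    _ ≤ ∫⁻ α in Set.Ioi (0:ℝ), ∫⁻ x, ENNReal.ofReal D₃ * pw α e *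
          (if ENNReal.ofReal (γ α) < f x then f x else 0) := by
        refine setLIntegral_mono' measurableSet_Ioi fun α hα => ?_
        rw [lintegral_const_mul _ (Measurable.ite (measurableSet_lt measurable_const hrm)
            measurable_const measurable_const),
          lintegral_const_mul _ (Measurable.ite (measurableSet_lt measurable_const hf)
            hf measurable_const)]
        refine le_trans (le_of_eq ?_) (hdist α hα)
        congr 1
        rw [← lintegral_indicator_one (measurableSet_lt measurable_const hrm)]
        refine lintegral_congr fun x => ?_
        simp [Set.indicator_apply]
    _ = ∫⁻ x, ∫⁻ α in Set.Ioi (0:ℝ), ENNReal.ofReal D₃ * pw α e *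
          (if ENNReal.ofReal (γ α) < f x then f x else 0) := by
        refine lintegral_lintegral_swap (Measurable.aemeasurable ?_)
        exact Measurable.mul (by fun_prop) (Measurable.ite hmeas (by fun_prop) measurable_const)
    _ ≤ ∫⁻ x, (Real.toNNReal (D₃ * (D₂ ^ (e + 1) / (e + 1))) : ℝ≥0∞) * f x ^ ((n:ℝ) / b) := by
        -- Integrating `α^e` over the admissible heights gives `f^((b-1)(e+1)/b) = f^((n-b)/b)` up
        -- to a constant, and the extra factor `f` completes the power `n/b`. Integrability at `α =
        -- 0`, that is `e > -1`, is where `b < n` enters.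
        refine lintegral_mono fun x => ?_
        set r : ℝ := (f x).toReal with hr
        have hfr : f x = ENNReal.ofReal r := (ENNReal.ofReal_toReal (hft x)).symm
        have hr0 : 0 ≤ r := ENNReal.toReal_nonneg
        have hX : 0 ≤ D₂ * r ^ ((b - 1) / b) := by positivity
        calc ∫⁻ α in Set.Ioi (0:ℝ), ENNReal.ofReal D₃ * pw α e *
              (if ENNReal.ofReal (γ α) < f x then f x else 0)
            ≤ ∫⁻ α in Set.Ioi (0:ℝ), (Set.Ioc 0 (D₂ * r ^ ((b - 1) / b))).indicator
                (fun α => ENNReal.ofReal D₃ * f x * pw α e) α := by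
              refine setLIntegral_mono' measurableSet_Ioi fun α hα => ?_
              split_ifs with h
              · rw [Set.indicator_of_mem]
                · exact le_of_eq (by ring)
                · refine ⟨hα, hlevel α hα r hr0 ?_⟩
                  rw [hfr] at h
                  exact (ENNReal.ofReal_lt_ofReal_iff_of_nonneg
                    (by have : 0 < α := hα; have := hApos α hα; simp only [hγ]; positivity)).1 h
              · simp
          _ = ∫⁻ α in Set.Ioc 0 (D₂ * r ^ ((b - 1) / b)), ENNReal.ofReal D₃ * f x * pw α e := by
              rw [lintegral_indicator measurableSet_Ioc, Measure.restrict_restrict measurableSet_Ioc,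
                Set.inter_eq_left.2 (fun α hα => hα.1)]
          _ ≤ _ := by
              rw [lintegral_const_mul _ (by fun_prop), lintegral_pw_Ioc (by linarith) hX, hfr,
                ENNReal.ofReal_rpow_of_nonneg hr0 (by positivity),
                ← ENNReal.ofReal_mul (by positivity), ← ENNReal.ofReal_mul (by positivity)]
              change _ ≤ ENNReal.ofReal _ * _
              rw [← ENNReal.ofReal_mul (by positivity)]
              refine ENNReal.ofReal_le_ofReal (le_of_eq ?_)
              rw [Real.mul_rpow (by positivity) (by positivity), ← Real.rpow_mul hr0, he1]
              rcases hr0.eq_or_lt with h0 | h0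
              · rw [← h0, Real.zero_rpow (by positivity : (n:ℝ) / b ≠ 0)]; simp
              · have : r ^ ((n:ℝ) / b) = r * r ^ ((b - 1) / b * ((n - b) / (b - 1))) := by
                  nth_rw 2 [← Real.rpow_one r]
                  rw [← Real.rpow_add h0]
                  congr 1; field_simp; ring
                rw [this]; ring
    _ = _ := lintegral_const_mul _ (by fun_prop)

/-- The Hardy–Littlewood–Sobolev inequality for the potential of order one. -/
lemma nr_riesz_le_of_ne_top (hn : 0 < n) {b : ℝ} (hb1 : 1 < b) (hbn : b < n) {c : ℝ} (hc : 0 < c) :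
    ∃ C : ℝ≥0, ∀ f : Rn n → ℝ≥0∞, Measurable f → (∀ x, f x ≠ ⊤) →
      nr (b - 1) (riesz c f) ≤ C * nr b f := by
  have hn' : (0:ℝ) < n := by exact_mod_cast hn
  have hb0 : 0 < b := by linarith
  have hb10 : 0 < b - 1 := by linarith
  obtain ⟨C, hC⟩ := lintegral_riesz_rpow_le hn hb1 hbn hc
  refine ⟨(C + 1) ^ ((b - 1) / n), fun f hf hft => ?_⟩
  rcases eq_or_ne (nr b f) 0 with h0 | h0
  · have h1 : f =ᵐ[volume] 0 := by
      have := (nr_rpow hn hb0 f).symm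
      rw [h0, ENNReal.zero_rpow_of_pos (by positivity)] at this
      rw [lintegral_eq_zero_iff (by fun_prop)] at this
      filter_upwards [this] with x hx
      exact (ENNReal.rpow_eq_zero_iff_of_pos (by positivity)).1 hx
    have h2 : ∀ x, riesz c f x = 0 := by
      intro x
      unfold riesz gconv
      have : ∀ s, ∫⁻ y, ENNReal.ofReal (gauss c s (x - y)) * f y = 0 := by
        intro s
        rw [lintegral_congr_ae (g := fun _ => 0) (h1.mono fun y hy => by simp [hy])]
        simp
      simp [this]
    simp [nr, h2, hn, hb10]
  rcases eq_or_ne (nr b f) ⊤ with ht | ht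
  · rw [ht, ENNReal.mul_top]
    · exact le_top
    · simp
  -- The normalised inequality is not homogeneous, so `f` is divided by its norm.
  set B := nr b f with hB
  have hg : ∀ x, B⁻¹ * f x ≠ ⊤ := fun x => ENNReal.mul_ne_top (ENNReal.inv_ne_top.2 h0) (hft x)
  have h1 : nr b (fun x => B⁻¹ * f x) = 1 := by
    rw [nr_const_mul hn hb0 f hf, ENNReal.inv_mul_cancel h0 ht]
  have h2 := hC (fun x => B⁻¹ * f x) (by fun_prop) hg h1.le
  rw [← nr_rpow hn hb0, h1, ENNReal.one_rpow, mul_one] at h2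
  simp_rw [riesz_const_mul c hf] at h2
  have h3 : nr (b - 1) (fun x => B⁻¹ * riesz c f x) ≤ ((C + 1) ^ ((b - 1) / n) : ℝ≥0) := by
    apply nr_le_of_lintegral_le hn hb10
    refine h2.trans ?_
    rw [ENNReal.coe_rpow_of_nonneg _ (by positivity), ← ENNReal.rpow_mul,
      div_mul_div_cancel₀ hn'.ne', div_self hb10.ne', ENNReal.rpow_one]
    simp
  rw [nr_const_mul hn hb10 _ (measurable_riesz c hf)] at h3
  rw [mul_comm] at h3
  exact (ENNReal.div_le_iff h0 ht).1 h3

/-! ### The singular time integral of Duhamel's formula. -/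

/-- A bound for the Beta integral. -/
lemma lintegral_beta_le {p q : ℝ} (hp0 : 0 ≤ p) (hp : p < 1) (hq0 : 0 ≤ q) (hq : q < 1) :
    ∃ C : ℝ≥0, ∀ t : ℝ, 0 < t →
      ∫⁻ s in Set.Ioo 0 t, pw (t - s) (-p) * pw s (-q) ≤ C * pw t (1 - p - q) := by
  set C : ℝ := 2 ^ p / (1 - q) + 2 ^ q / (1 - p) with hC
  have hC0 : 0 ≤ C := by
    have : 0 < 1 - q := by linarith
    have : 0 < 1 - p := by linarith
    positivity
  refine ⟨Real.toNNReal C, fun t ht => ?_⟩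
  have hrefl : ∫⁻ s in Set.Ioo 0 t, pw (t - s) (-p) = ∫⁻ s in Set.Ioo 0 t, pw s (-p) := by
    rw [← lintegral_indicator measurableSet_Ioo, ← lintegral_indicator measurableSet_Ioo,
      ← lintegral_sub_left_eq_self _ t]
    refine lintegral_congr fun s => ?_
    by_cases h : s ∈ Set.Ioo 0 t
    · have h' : t - s ∈ Set.Ioo 0 t := ⟨by linarith [h.2], by linarith [h.1]⟩
      rw [Set.indicator_of_mem h, Set.indicator_of_mem h', sub_sub_cancel]
    · have h' : t - s ∉ Set.Ioo 0 t := fun h' => h ⟨by linarith [h'.2], by linarith [h'.1]⟩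
      rw [Set.indicator_of_notMem h, Set.indicator_of_notMem h']
  -- On each half of `(0,t)` one of the two factors is at most its value at `t/2`; only the other
  -- one is singular there.
  have hpt : ∀ s ∈ Set.Ioo 0 t, pw (t - s) (-p) * pw s (-q) ≤
      pw (t / 2) (-p) * pw s (-q) + pw (t / 2) (-q) * pw (t - s) (-p) := by
    intro s hs
    rcases le_total s (t / 2) with h | h
    · refine le_add_right ?_
      gcongr ?_ * _
      exact ENNReal.ofReal_le_ofReal
        (Real.rpow_le_rpow_of_nonpos (by linarith) (by linarith) (by linarith))
    · refine le_add_left ?_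
      rw [mul_comm]
      gcongr ?_ * _
      exact ENNReal.ofReal_le_ofReal
        (Real.rpow_le_rpow_of_nonpos (by linarith) (by linarith) (by linarith))
  have hIoo : ∀ r, -1 < r → ∫⁻ s in Set.Ioo 0 t, pw s r = ENNReal.ofReal (t ^ (r + 1) / (r + 1)) := by
    intro r hr
    rw [setLIntegral_congr Ioo_ae_eq_Ioc, lintegral_pw_Ioc hr ht.le]
  refine (setLIntegral_mono' measurableSet_Ioo hpt).trans ?_
  rw [lintegral_add_left (by fun_prop), lintegral_const_mul _ (by fun_prop),
    lintegral_const_mul _ (by fun_prop), hrefl, hIoo _ (by linarith), hIoo _ (by linarith)]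
  unfold pw
  have hp1 : 0 < -p + 1 := by linarith
  have hq1 : 0 < -q + 1 := by linarith
  change _ ≤ ENNReal.ofReal C * _
  rw [← ENNReal.ofReal_mul (by positivity), ← ENNReal.ofReal_mul (by positivity),
    ← ENNReal.ofReal_mul hC0, ← ENNReal.ofReal_add (by positivity) (by positivity)]
  refine ENNReal.ofReal_le_ofReal (le_of_eq ?_)
  rw [Real.div_rpow ht.le (by norm_num), Real.div_rpow ht.le (by norm_num),
    Real.rpow_add ht, Real.rpow_add ht, show 1 - p - q = -p + -q + 1 by ring, Real.rpow_add ht,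
    Real.rpow_add ht, Real.rpow_neg (by norm_num : (0:ℝ) ≤ 2), Real.rpow_neg (by norm_num : (0:ℝ) ≤ 2),
    hC, show 1 - q = -q + 1 by ring, show 1 - p = -p + 1 by ring]
  field_simp

/-! ### Complex heat kernels, their derivatives and Gaussian bounds. -/

/-- The `i`-th standard basis vector. -/
noncomputable abbrev bv (i : Fin n) : Rn n := EuclideanSpace.single i (1:ℝ)

/-- The heat kernel `(w / (π t))^{n/2} exp(-w |x|² / t)`. -/
noncomputable def heatK (w : ℂ) (t : ℝ) (x : Rn n) : ℂ :=
  (w / Real.pi) ^ ((n:ℂ) / 2) * ((t ^ (-(n / 2) : ℝ) : ℝ) : ℂ) *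
    Complex.exp (-(w / t) * ((‖x‖ ^ 2 : ℝ) : ℂ))

/-- A kernel solving `∂_t K = z Δ K`, with Gaussian bounds of parabolic order `κ`, together with
its first and pure second spatial derivatives. -/
structure IsHeatKernel (z : ℂ) (c κ : ℝ) (K : ℝ → Rn n → ℂ) (D D2 : Fin n → ℝ → Rn n → ℂ) :
    Prop where
  cont : ∀ t, 0 < t → Continuous (K t)
  contD : ∀ t, 0 < t → ∀ i, Continuous (D i t)
  contD2 : ∀ t, 0 < t → ∀ i, Continuous (D2 i t)
  line : ∀ t, 0 < t → ∀ i x, HasLineDerivAt ℝ (K t) (D i t x) x (bv i)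
  lineD : ∀ t, 0 < t → ∀ i x, HasLineDerivAt ℝ (D i t) (D2 i t x) x (bv i)
  time : ∀ t, 0 < t → ∀ x, HasDerivAt (fun s => K s x) (z * ∑ i, D2 i t x) t
  bound : ∃ C : ℝ, 0 ≤ C ∧ ∀ t, 0 < t → ∀ x, ‖K t x‖ ≤ C * t ^ (-(κ / 2)) * gauss c t x
  boundD : ∃ C : ℝ, 0 ≤ C ∧ ∀ t, 0 < t → ∀ i x,
    ‖D i t x‖ ≤ C * t ^ (-((κ + 1) / 2)) * gauss c t x
  boundD2 : ∃ C : ℝ, 0 ≤ C ∧ ∀ t, 0 < t → ∀ i x,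
    ‖D2 i t x‖ ≤ C * t ^ (-((κ + 2) / 2)) * gauss c t x

lemma continuous_heatK (w : ℂ) (t : ℝ) : Continuous (heatK (n := n) w t) := by
  unfold heatK; fun_prop

lemma norm_add_smul_bv_sq (x : Rn n) (i : Fin n) (r : ℝ) :
    ‖x + r • bv i‖ ^ 2 = ‖x‖ ^ 2 + 2 * r * x i + r ^ 2 := by
  rw [norm_add_sq_real, inner_smul_right, EuclideanSpace.inner_single_right, norm_smul,
    PiLp.norm_single]
  simp; ring

lemma hasDerivAt_coord (x : Rn n) (i j : Fin n) :
    HasDerivAt (fun r : ℝ => (((x + r • bv i) j : ℝ) : ℂ)) (if j = i then 1 else 0) 0 := by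
  have : (fun r : ℝ => (((x + r • bv i) j : ℝ) : ℂ)) =
      fun r : ℝ => ((x j : ℝ) : ℂ) + (r : ℂ) * (if j = i then 1 else 0) := by
    funext r
    simp only [PiLp.add_apply, PiLp.smul_apply, PiLp.single_apply, smul_eq_mul]
    split_ifs <;> simp
  rw [this]
  refine (((hasDerivAt_id (0:ℝ)).ofReal_comp.mul_const (if j = i then (1:ℂ) else 0)).const_add
    ((x j : ℝ) : ℂ)).congr_deriv ?_
  simp

lemma hasDerivAt_heatK_line (w : ℂ) (t : ℝ) (x : Rn n) (i : Fin n) :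
    HasDerivAt (fun r : ℝ => heatK w t (x + r • bv i)) (-(2 * w / t) * x i * heatK w t x) 0 := by
  unfold heatK
  simp_rw [norm_add_smul_bv_sq]
  have h1 : HasDerivAt (fun r : ℝ => ‖x‖ ^ 2 + 2 * r * x i + r ^ 2) (2 * x i) 0 := by
    have h := (((hasDerivAt_id (0:ℝ)).const_mul 2).mul_const (x i)).const_add (‖x‖ ^ 2)
    refine (h.fun_add ((hasDerivAt_id (0:ℝ)).fun_pow 2)).congr_deriv ?_
    simp
  have h2 := ((h1.ofReal_comp).const_mul (-(w / t))).cexp.const_mul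
    ((w / Real.pi) ^ ((n:ℂ) / 2) * ((t ^ (-(n / 2) : ℝ) : ℝ) : ℂ))
  refine h2.congr_deriv ?_
  push_cast; simp; ring

lemma hasDerivAt_heatK_time (w : ℂ) {t : ℝ} (ht : 0 < t) (x : Rn n) :
    HasDerivAt (fun s => heatK w s x)
      ((-(n / (2 * t)) + w * (‖x‖ ^ 2 : ℝ) / t ^ 2) * heatK w t x) t := by
  unfold heatK
  have h1 := ((Real.hasDerivAt_rpow_const (x := t) (p := -(n / 2)) (Or.inl ht.ne')).ofReal_comp).const_mul
    ((w / Real.pi) ^ ((n:ℂ) / 2))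
  have h3 : HasDerivAt (fun s : ℝ => -(w / (s:ℂ))) (w / (t:ℂ) ^ 2) t := by
    have ht' : (t:ℂ) ≠ 0 := by exact_mod_cast ht.ne'
    refine ((hasDerivAt_const (t:ℂ) w).fun_div (hasDerivAt_id (t:ℂ)) ht').fun_neg.comp_ofReal.congr_deriv ?_
    simp; field_simp
  have h2 := (h3.mul_const ((‖x‖ ^ 2 : ℝ) : ℂ)).cexp
  refine (h1.fun_mul h2).congr_deriv ?_
  have ht' : (t:ℂ) ≠ 0 := by exact_mod_cast ht.ne'
  rw [Real.rpow_sub_one ht.ne']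
  push_cast
  field_simp

lemma pow_mul_exp_le {a : ℝ} (ha : 0 < a) (m : ℕ) :
    ∃ C : ℝ, 0 ≤ C ∧ ∀ y : ℝ, 0 ≤ y → y ^ m * Real.exp (-a * y ^ 2) ≤ C := by
  refine ⟨m.factorial * Real.exp (1 / (4 * a)), by positivity, fun y hy => ?_⟩
  have h1 : y ^ m ≤ m.factorial * Real.exp y := by
    have := Real.pow_div_factorial_le_exp y hy m
    rw [div_le_iff₀ (by positivity)] at this
    linarith
  calc y ^ m * Real.exp (-a * y ^ 2) ≤ m.factorial * Real.exp y * Real.exp (-a * y ^ 2) := by gcongr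
    _ = m.factorial * Real.exp (y + -a * y ^ 2) := by rw [Real.exp_add]; ring
    _ ≤ _ := by
      gcongr
      rw [le_div_iff₀ (by positivity)]
      nlinarith [sq_nonneg (2 * a * y - 1)]

/-- Multiplication by `p` turns the heat kernel into a kernel of parabolic order `k`. -/
def KerBound (w : ℂ) (k : ℝ) (p : ℝ → Rn n → ℂ) : Prop :=
  ∃ C : ℝ, 0 ≤ C ∧ ∀ t, 0 < t → ∀ x,
    ‖p t x * heatK w t x‖ ≤ C * t ^ (-(k / 2)) * gauss (w.re / 2) t x

lemma KerBound.add {w : ℂ} {k : ℝ} {p q : ℝ → Rn n → ℂ} (hp : KerBound w k p)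
    (hq : KerBound w k q) : KerBound w k (fun t x => p t x + q t x) := by
  obtain ⟨C, hC, h⟩ := hp
  obtain ⟨C', hC', h'⟩ := hq
  refine ⟨C + C', by positivity, fun t ht x => ?_⟩
  rw [add_mul, add_mul, add_mul]
  exact (norm_add_le _ _).trans (add_le_add (h t ht x) (h' t ht x))

/-- Half of the decay `exp(-w.re ‖x‖²/t)` absorbs `(‖x‖/√t)^m`, the other half remains as the
Gaussian of the bound. Each factor `‖x‖` is therefore worth `√t`, so `t^(-j) ‖x‖^m` has parabolic
order `2j - m`. -/
lemma kerBound_of_norm_le {w : ℂ} (hw : 0 < w.re) {k : ℝ} {p : ℝ → Rn n → ℂ} {A j : ℝ} (m : ℕ)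
    (hA : 0 ≤ A) (hk : k = 2 * j - m)
    (h : ∀ t, 0 < t → ∀ x, ‖p t x‖ ≤ A * t ^ (-j) * ‖x‖ ^ m) : KerBound w k p := by
  obtain ⟨C, hC, hCy⟩ := pow_mul_exp_le (a := w.re / 2) (by linarith) m
  refine ⟨A * C * ‖(w / Real.pi) ^ ((n:ℂ) / 2)‖, by positivity, fun t ht x => ?_⟩
  have hy := hCy (‖x‖ * t ^ (-(1 / 2) : ℝ)) (by positivity)
  have e1 : (‖x‖ * t ^ (-(1 / 2) : ℝ)) ^ 2 = ‖x‖ ^ 2 / t := by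
    rw [mul_pow, ← Real.rpow_natCast (t ^ (-(1 / 2) : ℝ)), ← Real.rpow_mul ht.le]
    norm_num [Real.rpow_neg_one]; rfl
  have e2 : (‖x‖ * t ^ (-(1 / 2) : ℝ)) ^ m = ‖x‖ ^ m * t ^ (-(m / 2) : ℝ) := by
    rw [mul_pow, ← Real.rpow_natCast (t ^ (-(1 / 2) : ℝ)), ← Real.rpow_mul ht.le]
    congr 2; ring
  have e3 : ‖Complex.exp (-(w / t) * ((‖x‖ ^ 2 : ℝ) : ℂ))‖ =
      Real.exp (-(w.re / 2) * (‖x‖ ^ 2 / t)) * Real.exp (-(w.re / 2) * ‖x‖ ^ 2 / t) := by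
    rw [Complex.norm_exp, ← Real.exp_add]
    congr 1
    rw [← neg_div, div_mul_eq_mul_div, Complex.div_ofReal_re, Complex.re_mul_ofReal, Complex.neg_re]
    ring
  rw [e1, e2] at hy
  have e4 : t ^ (-(k / 2)) = t ^ (-j) * t ^ (m / 2 : ℝ) := by
    rw [← Real.rpow_add ht]; congr 1; rw [hk]; ring
  have e5 : t ^ (m / 2 : ℝ) * t ^ (-(m / 2) : ℝ) = 1 := by rw [← Real.rpow_add ht]; simp
  rw [norm_mul, heatK, norm_mul, norm_mul, e3, Complex.norm_real,
    Real.norm_of_nonneg (by positivity : (0:ℝ) ≤ t ^ (-(n / 2) : ℝ)), gauss, e4]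
  set E1 := Real.exp (-(w.re / 2) * (‖x‖ ^ 2 / t))
  set E2 := Real.exp (-(w.re / 2) * ‖x‖ ^ 2 / t)
  set B := ‖(w / Real.pi) ^ ((n:ℂ) / 2)‖
  have hB : 0 ≤ B := norm_nonneg _
  calc ‖p t x‖ * (B * t ^ (-(n / 2) : ℝ) * (E1 * E2))
      ≤ A * t ^ (-j) * ‖x‖ ^ m * (B * t ^ (-(n / 2) : ℝ) * (E1 * E2)) := by
        gcongr; exact h t ht x
    _ = A * t ^ (-j) * B * t ^ (-(n / 2) : ℝ) * E2 * t ^ (m / 2 : ℝ) *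
          (‖x‖ ^ m * t ^ (-(m / 2) : ℝ) * E1) := by
        linear_combination (- A * t ^ (-j) * ‖x‖ ^ m * (B * t ^ (-(n / 2) : ℝ) * (E1 * E2))) * e5
    _ ≤ A * t ^ (-j) * B * t ^ (-(n / 2) : ℝ) * E2 * t ^ (m / 2 : ℝ) * C := by gcongr
    _ = _ := by ring

lemma norm_coord_le (x : Rn n) (i : Fin n) : ‖((x i : ℝ) : ℂ)‖ ≤ ‖x‖ := by
  rw [Complex.norm_real]; exact PiLp.norm_apply_le x i

lemma norm_slope (w : ℂ) {t : ℝ} (ht : 0 < t) : ‖2 * w / (t:ℂ)‖ = 2 * ‖w‖ * t ^ (-1 : ℝ) := by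
  rw [norm_div, norm_mul, Complex.norm_real, Real.norm_of_nonneg ht.le, Real.rpow_neg_one]
  simp; rfl

lemma rpow_neg_one_pow {t : ℝ} (ht : 0 < t) (k : ℕ) : (t ^ (-1:ℝ)) ^ k = t ^ (-(k:ℝ)) := by
  rw [← Real.rpow_natCast, ← Real.rpow_mul ht.le]; simp

/-- First spatial derivatives of the heat kernel. -/
noncomputable def heatD (w : ℂ) (i : Fin n) (t : ℝ) (x : Rn n) : ℂ :=
  -(2 * w / t) * x i * heatK w t x

/-- Second spatial derivatives of the heat kernel. -/
noncomputable def heatD2 (w : ℂ) (j i : Fin n) (t : ℝ) (x : Rn n) : ℂ :=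
  (-(2 * w / t) * (if j = i then 1 else 0) + (2 * w / t) ^ 2 * x j * x i) * heatK w t x

/-- The third spatial derivatives `∂_i ∂_i ∂_j` of the heat kernel. -/
noncomputable def heatD3 (w : ℂ) (j i : Fin n) (t : ℝ) (x : Rn n) : ℂ :=
  ((2 * w / t) ^ 2 * x j + (2 * (2 * w / t) ^ 2 * (if j = i then 1 else 0) * x i
    + -(2 * w / t) ^ 3 * x j * x i ^ 2)) * heatK w t x

lemma kerBound_one {w : ℂ} (hw : 0 < w.re) : KerBound (n := n) w 0 (fun _ _ => 1) :=
  kerBound_of_norm_le (A := 1) (j := 0) hw 0 (by norm_num) (by norm_num)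
    (fun t ht x => by simp)

lemma kerBound_slope_coord {w : ℂ} (hw : 0 < w.re) (i : Fin n) :
    KerBound w 1 (fun t x => -(2 * w / t) * x i) :=
  kerBound_of_norm_le (A := 2 * ‖w‖) (j := 1) hw 1 (by positivity) (by norm_num)
    (fun t ht x => by
      rw [norm_mul, norm_neg, norm_slope w ht, pow_one]
      gcongr; exact norm_coord_le x i)

lemma kerBound_D2 {w : ℂ} (hw : 0 < w.re) (j i : Fin n) :
    KerBound w 2 (fun t x => -(2 * w / t) * (if j = i then 1 else 0) +
      (2 * w / t) ^ 2 * x j * x i) := by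
  refine KerBound.add ?_ ?_
  · refine kerBound_of_norm_le (A := 2 * ‖w‖) (j := 1) hw 0 (by positivity) (by norm_num)
      (fun t ht x => ?_)
    rw [norm_mul, norm_neg, norm_slope w ht, pow_zero]
    gcongr; split_ifs <;> simp
  · refine kerBound_of_norm_le (A := (2 * ‖w‖) ^ 2) (j := 2) hw 2 (by positivity) (by norm_num)
      (fun t ht x => ?_)
    rw [norm_mul, norm_mul, norm_pow, norm_slope w ht, mul_pow, rpow_neg_one_pow ht, sq ‖x‖,
      mul_assoc _ ‖_‖ ‖_‖]
    push_cast
    gcongr <;> exact norm_coord_le x _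

lemma kerBound_D3 {w : ℂ} (hw : 0 < w.re) (j i : Fin n) :
    KerBound w 3 (fun t x => (2 * w / t) ^ 2 * x j + (2 * (2 * w / t) ^ 2 *
      (if j = i then 1 else 0) * x i + -(2 * w / t) ^ 3 * x j * x i ^ 2)) := by
  refine KerBound.add ?_ (KerBound.add ?_ ?_)
  · refine kerBound_of_norm_le (A := (2 * ‖w‖) ^ 2) (j := 2) hw 1 (by positivity) (by norm_num)
      (fun t ht x => ?_)
    rw [norm_mul, norm_pow, norm_slope w ht, mul_pow, rpow_neg_one_pow ht, pow_one]
    push_cast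
    gcongr; exact norm_coord_le x _
  · refine kerBound_of_norm_le (A := 2 * (2 * ‖w‖) ^ 2) (j := 2) hw 1 (by positivity) (by norm_num)
      (fun t ht x => ?_)
    rw [norm_mul, norm_mul, norm_mul, norm_pow, norm_slope w ht, mul_pow, rpow_neg_one_pow ht,
      pow_one]
    push_cast
    calc ‖(2:ℂ)‖ * ((2 * ‖w‖) ^ 2 * t ^ (-2:ℝ)) * ‖(if j = i then 1 else 0 : ℂ)‖ * ‖((x i : ℝ) : ℂ)‖
        ≤ ‖(2:ℂ)‖ * ((2 * ‖w‖) ^ 2 * t ^ (-2:ℝ)) * 1 * ‖x‖ := by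
          gcongr
          · split_ifs <;> simp
          · exact norm_coord_le x _
      _ = _ := by rw [Complex.norm_ofNat]; ring
  · refine kerBound_of_norm_le (A := (2 * ‖w‖) ^ 3) (j := 3) hw 3 (by positivity) (by norm_num)
      (fun t ht x => ?_)
    rw [norm_mul, norm_mul, norm_neg, norm_pow, norm_slope w ht, mul_pow, rpow_neg_one_pow ht,
      norm_pow, show ‖x‖ ^ 3 = ‖x‖ * ‖x‖ ^ 2 by ring, mul_assoc _ ‖_‖ (_ ^ 2)]
    push_cast
    gcongr <;> exact norm_coord_le x _

lemma heatKernel_bound_unif {w : ℂ} {k : ℝ} {p : Fin n → ℝ → Rn n → ℂ}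
    (h : ∀ i, KerBound w k (p i)) : ∃ C : ℝ, 0 ≤ C ∧ ∀ t, 0 < t → ∀ i x,
      ‖p i t x * heatK w t x‖ ≤ C * t ^ (-(k / 2)) * gauss (w.re / 2) t x := by
  choose C hC hb using h
  refine ⟨∑ i, C i, Finset.sum_nonneg fun i _ => hC i, fun t ht i x => (hb i t ht x).trans ?_⟩
  have := gauss_nonneg (w.re / 2) ht x
  gcongr
  exact Finset.single_le_sum (f := C) (fun i _ => hC i) (Finset.mem_univ i)

lemma sum_coord_sq (x : Rn n) : ∑ i, ((x i : ℝ) : ℂ) ^ 2 = ((‖x‖ ^ 2 : ℝ) : ℂ) := by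
  rw [EuclideanSpace.real_norm_sq_eq]; push_cast; rfl

lemma isHeatKernel_heatK {w : ℂ} (hw : 0 < w.re) :
    IsHeatKernel (n := n) (1 / (4 * w)) (w.re / 2) 0 (heatK w) (heatD w)
      (fun i => heatD2 w i i) where
  cont t _ := continuous_heatK w t
  contD t _ i := by have := continuous_heatK (n := n) w t; unfold heatD; fun_prop
  contD2 t _ i := by have := continuous_heatK (n := n) w t; unfold heatD2; fun_prop
  line t _ i x := hasDerivAt_heatK_line w t x i
  lineD t _ i x := by
    have h := ((hasDerivAt_coord x i i).const_mul (-(2 * w / t))).fun_mul (hasDerivAt_heatK_line w t x i)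
    unfold HasLineDerivAt heatD
    refine h.congr_deriv ?_
    simp [heatD2]; ring
  time t ht x := by
    have hw0 : w ≠ 0 := fun h => by simp [h] at hw
    have ht' : (t:ℂ) ≠ 0 := by exact_mod_cast ht.ne'
    refine (hasDerivAt_heatK_time w ht x).congr_deriv ?_
    simp only [heatD2, ← Finset.sum_mul, Finset.sum_add_distrib]
    simp only [if_true, Finset.sum_const, Finset.card_univ, Fintype.card_fin, mul_assoc _ (_ : ℂ) (_ : ℂ),
      ← sq, ← Finset.mul_sum, sum_coord_sq, nsmul_eq_mul]
    field_simp
    ring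
  bound := by
    obtain ⟨C, hC, h⟩ := kerBound_one (n := n) hw
    exact ⟨C, hC, fun t ht x => by simpa using h t ht x⟩
  boundD := by simpa [heatD] using heatKernel_bound_unif fun i : Fin n => kerBound_slope_coord hw i
  boundD2 := by
    simpa [heatD2] using heatKernel_bound_unif fun i : Fin n => kerBound_D2 hw i i

/-- A spatial derivative of the kernel solves the same heat equation with one more power of
`t^(-1/2)`. Treating it as a heat kernel in its own right lets a single Duhamel argument serve both
`u` and `∇u`. -/
lemma isHeatKernel_heatD {w : ℂ} (hw : 0 < w.re) (j : Fin n) :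
    IsHeatKernel (n := n) (1 / (4 * w)) (w.re / 2) 1 (heatD w j) (heatD2 w j) (heatD3 w j) where
  cont t _ := by have := continuous_heatK (n := n) w t; unfold heatD; fun_prop
  contD t _ i := by have := continuous_heatK (n := n) w t; unfold heatD2; fun_prop
  contD2 t _ i := by have := continuous_heatK (n := n) w t; unfold heatD3; fun_prop
  line t _ i x := by
    have h := ((hasDerivAt_coord x i j).const_mul (-(2 * w / t))).fun_mul (hasDerivAt_heatK_line w t x i)
    unfold HasLineDerivAt heatD
    refine h.congr_deriv ?_
    rcases eq_or_ne j i with rfl | hji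
    · simp [heatD2]; ring
    · simp [heatD2, hji]; ring
  lineD t _ i x := by
    have h := ((((hasDerivAt_coord x i j).fun_mul (hasDerivAt_coord x i i)).const_mul
      ((2 * w / t) ^ 2)).const_add (-(2 * w / t) * (if j = i then 1 else 0))).fun_mul
      (hasDerivAt_heatK_line w t x i)
    unfold HasLineDerivAt heatD2
    refine HasDerivAt.congr_deriv (by simpa only [mul_assoc] using h) ?_
    · rcases eq_or_ne j i with rfl | hji
      · simp [heatD3]; ring
      · simp [heatD3, hji]; ring
  time t ht x := by
    have hw0 : w ≠ 0 := fun h => by simp [h] at hw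
    have ht' : (t:ℂ) ≠ 0 := by exact_mod_cast ht.ne'
    have h3 : HasDerivAt (fun s : ℝ => -(2 * w / (s:ℂ))) (2 * w / (t:ℂ) ^ 2) t := by
      refine ((hasDerivAt_const (t:ℂ) (2 * w)).fun_div (hasDerivAt_id (t:ℂ)) ht').fun_neg.comp_ofReal.congr_deriv ?_
      simp; field_simp
    have h := (h3.mul_const ((x j : ℝ) : ℂ)).fun_mul (hasDerivAt_heatK_time w ht x)
    unfold heatD
    refine h.congr_deriv ?_
    simp only [heatD3, ← Finset.sum_mul, Finset.sum_add_distrib]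
    simp only [ite_mul, zero_mul, mul_ite,
      mul_zero, Finset.sum_ite_eq, Finset.mem_univ, if_true, ← Finset.mul_sum, sum_coord_sq,
      Finset.sum_const, Finset.card_univ, Fintype.card_fin, nsmul_eq_mul]
    field_simp
    ring
  bound := by
    obtain ⟨C, hC, h⟩ := kerBound_slope_coord hw j
    exact ⟨C, hC, fun t ht x => by simpa [heatD] using h t ht x⟩
  boundD := by
    have := heatKernel_bound_unif fun i : Fin n => kerBound_D2 hw j i
    norm_num only at this ⊢; exact this
  boundD2 := by
    have := heatKernel_bound_unif fun i : Fin n => kerBound_D3 hw j i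
    norm_num only at this ⊢; exact this

/-- A positive real factor does not change the argument, so the principal branch is multiplicative
here. -/
lemma ofReal_mul_cpow {r : ℝ} (hr : 0 < r) {a : ℂ} (ha : a ≠ 0) (s : ℂ) :
    ((r : ℂ) * a) ^ s = (r : ℂ) ^ s * a ^ s := by
  have hr' : (r : ℂ) ≠ 0 := by exact_mod_cast hr.ne'
  rw [Complex.cpow_def_of_ne_zero (mul_ne_zero hr' ha), Complex.cpow_def_of_ne_zero hr',
    Complex.cpow_def_of_ne_zero ha, Complex.log_ofReal_mul hr ha, ← Complex.exp_add,
    Complex.ofReal_log hr.le]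
  congr 1; ring

lemma re_div_ofReal_pos {w : ℂ} (hw : 0 < w.re) {t : ℝ} (ht : 0 < t) : 0 < (w / (t:ℂ)).re := by
  rw [Complex.div_ofReal_re]; positivity

lemma heatK_prefactor {w : ℂ} (hw : 0 < w.re) {t : ℝ} (ht : 0 < t) (n : ℕ) :
    (w / Real.pi) ^ ((n:ℂ) / 2) * ((t ^ (-(n / 2) : ℝ) : ℝ) : ℂ) =
      (w / (Real.pi * t)) ^ ((n:ℂ) / 2) := by
  have hw0 : w ≠ 0 := fun h => by simp [h] at hw
  have hpi : (Real.pi : ℂ) ≠ 0 := by exact_mod_cast Real.pi_ne_zero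
  have ht' : (t:ℂ) ≠ 0 := by exact_mod_cast ht.ne'
  rw [show w / (Real.pi * t) = ((t⁻¹ : ℝ) : ℂ) * (w / Real.pi) by push_cast; field_simp,
    ofReal_mul_cpow (by positivity) (div_ne_zero hw0 hpi), mul_comm]
  congr 1
  rw [Real.rpow_neg ht.le, ← Real.inv_rpow ht.le, Complex.ofReal_cpow (by positivity)]
  push_cast; rfl

lemma integral_heatK {w : ℂ} (hw : 0 < w.re) {t : ℝ} (ht : 0 < t) :
    ∫ x : Rn n, heatK w t x = 1 := by
  have hw0 : w ≠ 0 := fun h => by simp [h] at hw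
  have hpi : (Real.pi : ℂ) ≠ 0 := by exact_mod_cast Real.pi_ne_zero
  have ht' : (t:ℂ) ≠ 0 := by exact_mod_cast ht.ne'
  have h := GaussianFourier.integral_cexp_neg_mul_sq_norm (V := Rn n) (re_div_ofReal_pos hw ht)
  unfold heatK
  rw [heatK_prefactor hw ht, integral_const_mul]
  push_cast
  rw [h, finrank_euclideanSpace_fin, show (Real.pi : ℂ) / (w / t) = (w / (Real.pi * t))⁻¹ by
    field_simp, Complex.inv_cpow, mul_inv_cancel₀]
  · rw [Ne, Complex.cpow_eq_zero_iff]
    push Not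
    intro h; exact absurd h (by positivity)
  · intro h
    have h2 := Complex.arg_eq_pi_iff.1 h
    have : 0 < (w / (Real.pi * t)).re := by
      rw [← Complex.ofReal_mul]; exact re_div_ofReal_pos hw (by positivity)
    linarith [h2.1]

/-- The multiplier is `exp(-b‖ξ‖²)` with `b = 4π²t(λ - i)` and `Re b > 0`, so the inverse transform
is again Gaussian, with exponent `π²/b = w/t` for `w = 1/(4(λ - i))`. -/
lemma kernelS_eq_heatK {lam : ℝ} (hlam : 0 < lam) {t : ℝ} (ht : 0 < t) (x : Rn n) :
    kernelS n lam t x = heatK (1 / (4 * (lam - Complex.I))) t x := by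
  have hz : ((lam : ℂ) - Complex.I) ≠ 0 := fun h => by
    have := congrArg Complex.re h; simp at this; exact hlam.ne' this
  have hpi : (Real.pi : ℂ) ≠ 0 := by exact_mod_cast Real.pi_ne_zero
  have ht' : (t:ℂ) ≠ 0 := by exact_mod_cast ht.ne'
  set b : ℂ := ((lam : ℂ) - Complex.I) * ((4 * Real.pi ^ 2 * t : ℝ) : ℂ) with hb
  have hbre : 0 < b.re := by
    rw [hb, Complex.re_mul_ofReal]; simp; positivity
  have hw : 0 < (1 / (4 * ((lam : ℂ) - Complex.I))).re := by
    rw [one_div, Complex.inv_re]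
    apply div_pos
    · simp; exact hlam
    · exact Complex.normSq_pos.2 (mul_ne_zero (by norm_num) hz)
  have h := fourier_gaussian_innerProductSpace (V := Rn n) hbre (-x)
  unfold kernelS
  rw [Real.fourierInv_eq_fourier_neg]
  have e : (fun ξ : Rn n => Complex.exp ((Complex.I - (lam : ℂ)) *
      (((2 * Real.pi * ‖ξ‖) ^ 2 * t : ℝ) : ℂ))) = fun v : Rn n => Complex.exp (-b * ‖v‖ ^ 2) := by
    funext v
    congr 1
    rw [hb]; push_cast; ring
  rw [e, h, heatK, heatK_prefactor hw ht, norm_neg, finrank_euclideanSpace_fin]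
  congr 2
  · rw [hb]; push_cast; field_simp
  · rw [hb]; push_cast; field_simp

/-! ### Convolution with heat kernels: derivatives and the initial limit. -/

/-- Convolution of complex functions on `ℝⁿ`. -/
noncomputable def cv (k f : Rn n → ℂ) (x : Rn n) : ℂ := ∫ y, k (x - y) * f y

/-- Integrability against all Gaussians. -/
def GI (V : Rn n → ℝ) : Prop :=
  ∀ a : ℝ, 0 < a → ∀ x, Integrable (fun y => Real.exp (-a * ‖x - y‖ ^ 2) * V y)

lemma integrable_exp_neg {a : ℝ} (ha : 0 < a) (x : Rn n) :
    Integrable (fun y : Rn n => Real.exp (-a * ‖x - y‖ ^ 2)) := by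
  have h := (integrable_gauss (n := n) ha one_pos).comp_sub_left x
  refine h.congr (Eventually.of_forall fun y => ?_)
  simp [gauss]

/-- This and `GI.of_memLp` cover all functions convolved below: nonlinear terms are bounded,
functions in `H^∞` are square integrable. -/
lemma GI.of_bounded {V : Rn n → ℝ} (hV : AEStronglyMeasurable V volume) {C : ℝ}
    (h : ∀ x, ‖V x‖ ≤ C) : GI V := fun _ ha x =>
  ((integrable_exp_neg ha x).mul_bdd hV (Eventually.of_forall h))

lemma GI.of_memLp {V : Rn n → ℝ} (hV : MemLp V 2 volume) : GI V := fun a ha x => by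
  have h2 : MemLp (fun y : Rn n => Real.exp (-a * ‖x - y‖ ^ 2)) 2 volume := by
    rw [memLp_two_iff_integrable_sq (by fun_prop)]
    refine (integrable_exp_neg (a := 2 * a) (by linarith) x).congr (Eventually.of_forall fun y => ?_)
    simp only
    rw [← Real.exp_nat_mul]; congr 1; push_cast; ring
  exact h2.integrable_mul hV

lemma GI.add {V W : Rn n → ℝ} (hV : GI V) (hW : GI W) : GI (fun x => V x + W x) := fun a ha x => by
  refine ((hV a ha x).add (hW a ha x)).congr (Eventually.of_forall fun y => ?_)
  simp [mul_add]

lemma GI.mono {V W : Rn n → ℝ} (hV : GI V) (hW : AEStronglyMeasurable W volume)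
    (h : ∀ x, ‖W x‖ ≤ V x) : GI W := fun a ha x => by
  refine (hV a ha x).mono ((by fun_prop : Continuous fun y : Rn n =>
    Real.exp (-a * ‖x - y‖ ^ 2)).aestronglyMeasurable.mul hW) (Eventually.of_forall fun y => ?_)
  rw [norm_mul, norm_mul]
  gcongr
  exact (h y).trans (le_abs_self _)

lemma gauss_eq (c t : ℝ) (x : Rn n) :
    gauss c t x = t ^ (-(n / 2) : ℝ) * Real.exp (-(c / t) * ‖x‖ ^ 2) := by
  unfold gauss; congr 2; ring

lemma integrable_cv {c t C : ℝ} (hc : 0 < c) (ht : 0 < t) {k f : Rn n → ℂ} (hk : Continuous k)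
    (hkb : ∀ v, ‖k v‖ ≤ C * gauss c t v) (hf : AEStronglyMeasurable f volume)
    (hfi : GI fun y => ‖f y‖) (x : Rn n) : Integrable (fun y => k (x - y) * f y) := by
  refine ((hfi (c / t) (by positivity) x).const_mul (C * t ^ (-(n / 2) : ℝ))).mono'
    ((hk.comp (by fun_prop)).aestronglyMeasurable.mul hf) (Eventually.of_forall fun y => ?_)
  rw [norm_mul]
  calc ‖k (x - y)‖ * ‖f y‖ ≤ C * gauss c t (x - y) * ‖f y‖ := by gcongr; exact hkb _
    _ = _ := by rw [gauss_eq]; ring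

/-- Integration by parts: a derivative may be moved from one factor of a convolution to the
other. -/
lemma cv_lineDeriv {c t C : ℝ} (hc : 0 < c) (ht : 0 < t) {k k' f f' : Rn n → ℂ} {i : Fin n}
    (hk : Continuous k) (hk' : Continuous k') (hkb : ∀ v, ‖k v‖ ≤ C * gauss c t v)
    (hkb' : ∀ v, ‖k' v‖ ≤ C * gauss c t v)
    (hd : ∀ v, HasLineDerivAt ℝ k (k' v) v (bv i))
    (hf : Continuous f) (hf' : Continuous f') (hfi : GI fun y => ‖f y‖)
    (hfi' : GI fun y => ‖f' y‖) (hfd : ∀ y, HasLineDerivAt ℝ f (f' y) y (bv i)) (x : Rn n) :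
    cv k' f x = cv k f' x := by
  have hline : ∀ y, HasLineDerivAt ℝ (fun y => k (x - y)) (-k' (x - y)) y (bv i) := by
    intro y
    have h1 : HasDerivAt (fun r : ℝ => k (x - y + r • bv i)) (k' (x - y)) (-0) := by
      rw [neg_zero]; exact hd (x - y)
    have h2 := h1.scomp (0:ℝ) (hasDerivAt_neg (0:ℝ))
    unfold HasLineDerivAt
    refine (h2.congr_deriv (by simp)).congr_of_eventuallyEq (Eventually.of_forall fun r => ?_)
    simp only [Function.comp_apply]
    congr 1
    rw [neg_smul]; abel
  have h := integral_bilinear_hasLineDerivAt_right_eq_neg_left_of_integrable (μ := volume)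
    (f := fun y => k (x - y)) (f' := fun y => -k' (x - y)) (g := f) (g' := f') (v := bv i)
    (B := ContinuousLinearMap.mul ℝ ℂ)
    (by
      have := (integrable_cv hc ht hk' hkb' hf.aestronglyMeasurable hfi x).neg
      refine this.congr (Eventually.of_forall fun y => ?_)
      simp)
    (by simpa using integrable_cv hc ht hk hkb hf'.aestronglyMeasurable hfi' x)
    (by simpa using integrable_cv hc ht hk hkb hf.aestronglyMeasurable hfi x)
    (fun y _ => hline y) (fun y _ => hfd y)
  simp only [ContinuousLinearMap.mul_apply'] at h
  unfold cv
  rw [h, ← integral_neg]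
  exact integral_congr_ae (Eventually.of_forall fun y => by simp)

lemma gauss_le_of_mem {c : ℝ} (hc : 0 ≤ c) {t₀ t : ℝ} (ht₀ : 0 < t₀)
    (ht : t ∈ Set.Icc (t₀ / 2) (2 * t₀)) (x : Rn n) :
    gauss c t x ≤ (t₀ / 2) ^ (-(n / 2) : ℝ) * Real.exp (-(c / (2 * t₀)) * ‖x‖ ^ 2) := by
  have h0 : 0 < t := by linarith [ht.1]
  rw [gauss_eq]
  have h1 : t ^ (-(n / 2) : ℝ) ≤ (t₀ / 2) ^ (-(n / 2) : ℝ) :=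
    Real.rpow_le_rpow_of_nonpos (by linarith) ht.1 (by have : (0:ℝ) ≤ n := by positivity
                                                       linarith)
  have h2 : -(c / t) ≤ -(c / (2 * t₀)) := by
    have : c / (2 * t₀) ≤ c / t := by gcongr; exact ht.2
    linarith
  gcongr

/-- Local uniform bound for a kernel of parabolic order `κ`. -/
lemma kernel_le_of_mem {c κ C : ℝ} (hc : 0 ≤ c) (hκ : 0 ≤ κ) (hC : 0 ≤ C) {t₀ t : ℝ} (ht₀ : 0 < t₀)
    (ht : t ∈ Set.Icc (t₀ / 2) (2 * t₀)) (x : Rn n) :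
    C * t ^ (-(κ / 2)) * gauss c t x ≤ C * (t₀ / 2) ^ (-(κ / 2)) * (t₀ / 2) ^ (-(n / 2) : ℝ) *
      Real.exp (-(c / (2 * t₀)) * ‖x‖ ^ 2) := by
  have h0 : 0 < t := by linarith [ht.1]
  have h1 : t ^ (-(κ / 2)) ≤ (t₀ / 2) ^ (-(κ / 2)) :=
    Real.rpow_le_rpow_of_nonpos (by linarith) ht.1 (by linarith)
  rw [mul_assoc _ ((t₀ / 2) ^ (-(n / 2) : ℝ))]
  have := gauss_nonneg c h0 x
  gcongr
  exact gauss_le_of_mem hc ht₀ ht x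

namespace IsHeatKernel

variable {z : ℂ} {c κ : ℝ} {K : ℝ → Rn n → ℂ} {D D2 : Fin n → ℝ → Rn n → ℂ}

lemma integrable (H : IsHeatKernel z c κ K D D2) (hc : 0 < c) {t : ℝ} (ht : 0 < t) {f : Rn n → ℂ}
    (hf : AEStronglyMeasurable f volume) (hfi : GI fun y => ‖f y‖) (x : Rn n) :
    Integrable (fun y => K t (x - y) * f y) := by
  obtain ⟨C, hC, h⟩ := H.bound
  exact integrable_cv hc ht (H.cont t ht) (h t ht) hf hfi x

lemma cv_D (H : IsHeatKernel z c κ K D D2) (hc : 0 < c) {t : ℝ} (ht : 0 < t) {f f' : Rn n → ℂ}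
    {i : Fin n} (hf : Continuous f) (hf' : Continuous f') (hfi : GI fun y => ‖f y‖)
    (hfi' : GI fun y => ‖f' y‖) (hfd : ∀ y, HasLineDerivAt ℝ f (f' y) y (bv i)) (x : Rn n) :
    cv (D i t) f x = cv (K t) f' x := by
  obtain ⟨C, hC, h⟩ := H.bound
  obtain ⟨C', hC', h'⟩ := H.boundD
  refine cv_lineDeriv (C := max (C * t ^ (-(κ / 2))) (C' * t ^ (-((κ + 1) / 2)))) hc ht
    (H.cont t ht) (H.contD t ht i) (fun v => (h t ht v).trans ?_) (fun v => (h' t ht i v).trans ?_)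
    (H.line t ht i) hf hf' hfi hfi' hfd x
  · have := gauss_nonneg c ht v
    gcongr; exact le_max_left _ _
  · have := gauss_nonneg c ht v
    gcongr; exact le_max_right _ _

lemma cv_D2 (H : IsHeatKernel z c κ K D D2) (hc : 0 < c) {t : ℝ} (ht : 0 < t) {f f' : Rn n → ℂ}
    {i : Fin n} (hf : Continuous f) (hf' : Continuous f') (hfi : GI fun y => ‖f y‖)
    (hfi' : GI fun y => ‖f' y‖) (hfd : ∀ y, HasLineDerivAt ℝ f (f' y) y (bv i)) (x : Rn n) :
    cv (D2 i t) f x = cv (D i t) f' x := by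
  obtain ⟨C, hC, h⟩ := H.boundD
  obtain ⟨C', hC', h'⟩ := H.boundD2
  refine cv_lineDeriv (C := max (C * t ^ (-((κ + 1) / 2))) (C' * t ^ (-((κ + 2) / 2)))) hc ht
    (H.contD t ht i) (H.contD2 t ht i) (fun v => (h t ht i v).trans ?_)
    (fun v => (h' t ht i v).trans ?_) (H.lineD t ht i) hf hf' hfi hfi' hfd x
  · have := gauss_nonneg c ht v
    gcongr; exact le_max_left _ _
  · have := gauss_nonneg c ht v
    gcongr; exact le_max_right _ _

lemma integrable_D2 (H : IsHeatKernel z c κ K D D2) (hc : 0 < c) {t : ℝ} (ht : 0 < t)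
    {f : Rn n → ℂ} (hf : AEStronglyMeasurable f volume) (hfi : GI fun y => ‖f y‖) (i : Fin n)
    (x : Rn n) : Integrable (fun y => D2 i t (x - y) * f y) := by
  obtain ⟨C, hC, h⟩ := H.boundD2
  exact integrable_cv hc ht (H.contD2 t ht i) (h t ht i) hf hfi x

/-- Differentiation in time of the convolution of a heat kernel with a time dependent function. -/
lemma hasDerivAt_cv (H : IsHeatKernel z c κ K D D2) (hc : 0 < c) (hκ : 0 ≤ κ) {α β s₀ : ℝ}
    (hpos : 0 < α + β * s₀) {v v' : ℝ → Rn n → ℂ} {U : Set ℝ} (hU : U ∈ 𝓝 s₀)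
    (hv : ∀ s ∈ U, Continuous (v s)) (hv' : Continuous (v' s₀)) {V : Rn n → ℝ} (hV : GI V)
    (hvV : ∀ s ∈ U, ∀ y, ‖v s y‖ ≤ V y) (hvV' : ∀ s ∈ U, ∀ y, ‖v' s y‖ ≤ V y)
    (hd : ∀ s ∈ U, ∀ y, HasDerivAt (fun s => v s y) (v' s y) s) (x : Rn n) :
    HasDerivAt (fun s => cv (K (α + β * s)) (v s) x)
      (β * (z * ∑ i, cv (D2 i (α + β * s₀)) (v s₀) x) + cv (K (α + β * s₀)) (v' s₀) x) s₀ := by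
  -- The affine kernel time `α + β s` serves three purposes: `β = 1` for the heat flow of a fixed
  -- function, `β = -1` for Duhamel's formula, and `β = 0` for differentiating only the function.
  set t₀ := α + β * s₀ with ht₀
  obtain ⟨C, hC, hb⟩ := H.bound
  obtain ⟨C', hC', hb'⟩ := H.boundD2
  have hs₀ : s₀ ∈ U := mem_of_mem_nhds hU
  have hcont : ContinuousAt (fun s => α + β * s) s₀ := by fun_prop
  have hnear : ∀ᶠ s in 𝓝 s₀, α + β * s ∈ Set.Icc (t₀ / 2) (2 * t₀) :=
    hcont.eventually (Icc_mem_nhds (by linarith) (by linarith))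
  -- While the kernel time stays in `[t₀/2, 2t₀]`, the kernels are dominated by one fixed Gaussian,
  -- and `GI V` provides the integrable majorant.
  have hW : {s | α + β * s ∈ Set.Icc (t₀ / 2) (2 * t₀)} ∩ U ∈ 𝓝 s₀ := inter_mem hnear hU
  set B : ℝ := C * (t₀ / 2) ^ (-(κ / 2)) * (t₀ / 2) ^ (-(n / 2) : ℝ) with hB
  set B' : ℝ := C' * (t₀ / 2) ^ (-((κ + 2) / 2)) * (t₀ / 2) ^ (-(n / 2) : ℝ) with hB'
  have hB0 : 0 ≤ B := by positivity
  have hB0' : 0 ≤ B' := by positivity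
  have hvi : GI fun y => ‖v s₀ y‖ := hV.mono (hv _ hs₀).norm.aestronglyMeasurable
    fun y => by simpa using hvV s₀ hs₀ y
  have hvi' : GI fun y => ‖v' s₀ y‖ := hV.mono hv'.norm.aestronglyMeasurable
    fun y => by simpa using hvV' s₀ hs₀ y
  have key := hasDerivAt_integral_of_dominated_loc_of_deriv_le (𝕜 := ℝ) (μ := volume)
    (F := fun s y => K (α + β * s) (x - y) * v s y) (x₀ := s₀)
    (F' := fun s y => (β * (z * ∑ i, D2 i (α + β * s) (x - y))) * v s y
      + K (α + β * s) (x - y) * v' s y)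
    (bound := fun y => (|β| * (‖z‖ * (n * B')) + B) *
      (Real.exp (-(c / (2 * t₀)) * ‖x - y‖ ^ 2) * V y)) hW
    (by
      filter_upwards [hW] with s hs
      have h0 : 0 < α + β * s := by linarith [hs.1.1]
      exact (((H.cont _ h0).comp (by fun_prop)).mul (hv s hs.2)).aestronglyMeasurable)
    (H.integrable hc hpos (hv _ hs₀).aestronglyMeasurable hvi x)
    (by
      refine Continuous.aestronglyMeasurable ?_
      refine Continuous.add (Continuous.mul ?_ (hv _ hs₀)) (((H.cont _ hpos).comp (by fun_prop)).mul hv')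
      exact continuous_const.mul (continuous_const.mul (continuous_finsetSum _ fun i _ =>
        (H.contD2 _ hpos i).comp (by fun_prop))))
    (by
      refine Eventually.of_forall fun y s hs => ?_
      have h0 : 0 < α + β * s := by linarith [hs.1.1]
      have hV0 : 0 ≤ V y := (norm_nonneg _).trans (hvV s hs.2 y)
      set E := Real.exp (-(c / (2 * t₀)) * ‖x - y‖ ^ 2) with hE
      have h1 : ‖K (α + β * s) (x - y)‖ ≤ B * E :=
        (hb _ h0 _).trans (kernel_le_of_mem hc.le hκ hC hpos hs.1 _)
      have h2 : ∀ i, ‖D2 i (α + β * s) (x - y)‖ ≤ B' * E := fun i =>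
        (hb' _ h0 i _).trans (kernel_le_of_mem hc.le (by linarith) hC' hpos hs.1 _)
      have h3 : ‖∑ i, D2 i (α + β * s) (x - y)‖ ≤ n * (B' * E) := by
        refine (norm_sum_le _ _).trans ((Finset.sum_le_sum fun i _ => h2 i).trans (le_of_eq ?_))
        simp
      calc _ ≤ ‖(β * (z * ∑ i, D2 i (α + β * s) (x - y))) * v s y‖ +
            ‖K (α + β * s) (x - y) * v' s y‖ := norm_add_le _ _
        _ ≤ |β| * (‖z‖ * (n * (B' * E))) * V y + B * E * V y := by
            rw [norm_mul, norm_mul, norm_mul, norm_mul, Complex.norm_real, Real.norm_eq_abs]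
            gcongr
            · exact hvV s hs.2 y
            · exact hvV' s hs.2 y
        _ = _ := by ring)
    ((hV _ (by positivity) x).const_mul _)
    (by
      refine Eventually.of_forall fun y s hs => ?_
      have h0 : 0 < α + β * s := by linarith [hs.1.1]
      have hlin : HasDerivAt (fun s => α + β * s) β s := by
        simpa using ((hasDerivAt_id s).const_mul β).const_add α
      have h1 := (H.time _ h0 (x - y)).scomp s hlin
      refine (h1.fun_mul (hd s hs.2 y)).congr_deriv ?_
      simp only [Complex.real_smul, Function.comp_apply])
  refine key.2.congr_deriv ?_
  have hDi := fun i => H.integrable_D2 hc hpos (hv _ hs₀).aestronglyMeasurable hvi i x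
  have e : ∀ y, (β * (z * ∑ i, D2 i t₀ (x - y))) * v s₀ y + K t₀ (x - y) * v' s₀ y
      = ((β:ℂ) * z) * (∑ i, D2 i t₀ (x - y) * v s₀ y) + K t₀ (x - y) * v' s₀ y := by
    intro y; rw [← Finset.sum_mul]; ring
  simp only [← ht₀]
  simp_rw [e]
  rw [integral_add ((integrable_finsetSum _ fun i _ => hDi i).const_mul _)
    (H.integrable hc hpos hv'.aestronglyMeasurable hvi' x), integral_const_mul,
    integral_finsetSum _ fun i _ => hDi i]
  unfold cv
  ring

end IsHeatKernel

/-- Half of the exponent is bounded using `‖x‖ ≥ r`, which gives a factor beating every power of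
`s`; the other half is bounded using `s ≤ 1`, which keeps a fixed Gaussian for integrability. -/
lemma gauss_far_le {c : ℝ} (hc : 0 ≤ c) {s r : ℝ} (hs : 0 < s) (hs1 : s ≤ 1) (hr : 0 ≤ r) {x : Rn n}
    (hx : r ≤ ‖x‖) : gauss c s x ≤ s ^ (-(n / 2) : ℝ) * Real.exp (-(c * r ^ 2 / 2) / s) *
      Real.exp (-(c / 2) * ‖x‖ ^ 2) := by
  rw [gauss_eq, mul_assoc, ← Real.exp_add]
  gcongr
  have h1 : r ^ 2 ≤ ‖x‖ ^ 2 := by gcongr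
  rw [div_add' _ _ _ hs.ne', neg_mul, div_mul_eq_mul_div, ← neg_div]
  gcongr
  nlinarith [mul_le_mul_of_nonneg_left h1 hc, mul_nonneg (mul_nonneg hc (sq_nonneg ‖x‖))
    (sub_nonneg.2 hs1)]

lemma tendsto_rpow_mul_exp_neg_div (a : ℝ) {b : ℝ} (hb : 0 < b) :
    Tendsto (fun s : ℝ => s ^ (-a) * Real.exp (-b / s)) (𝓝[>] 0) (𝓝 0) := by
  have h := (tendsto_rpow_mul_exp_neg_mul_atTop_nhds_zero a b hb).comp tendsto_inv_nhdsGT_zero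
  refine h.congr' ?_
  filter_upwards [self_mem_nhdsWithin] with s hs
  have hs' : (0:ℝ) < s := hs
  simp only [Function.comp_apply]
  rw [Real.inv_rpow hs'.le, Real.rpow_neg hs'.le]
  congr 2

/-- The heat kernel is an approximate identity. -/
lemma tendsto_cv_heatK {w : ℂ} (hw : 0 < w.re) {f : Rn n → ℂ} (hf : Continuous f)
    (hfi : GI fun y => ‖f y‖) (x : Rn n) :
    Tendsto (fun s => cv (heatK w s) f x) (𝓝[>] 0) (𝓝 (f x)) := by
  have H := isHeatKernel_heatK (n := n) hw
  have hc : 0 < w.re / 2 := by linarith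
  set c := w.re / 2 with hcdef
  obtain ⟨C, hC, hb⟩ := H.bound
  set M : ℝ := (Real.pi / c) ^ (n / 2 : ℝ) with hM
  have hM0 : 0 ≤ M := by positivity
  have hgi : GI fun y => ‖f y - f x‖ := by
    refine (hfi.add (GI.of_bounded (V := fun _ => ‖f x‖) aestronglyMeasurable_const
      (C := ‖f x‖) (by simp))).mono (by fun_prop) fun y => ?_
    simpa using norm_sub_le (f y) (f x)
  rw [Metric.tendsto_nhds]
  intro ε hε
  -- As the kernel has integral one, the error is the integral of `K(x - y)(f y - f x)`. For `‖x -
  -- y‖ < r` the oscillation `ε'` times the total mass is at most `ε/2`; outside this ball the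
  -- contribution tends to zero with `s`.
  set ε' : ℝ := ε / (2 * (C * M + 1)) with hε'
  have hε'0 : 0 < ε' := by positivity
  obtain ⟨r, hr, hrf⟩ := Metric.continuousAt_iff.1 hf.continuousAt ε' hε'0
  set J : ℝ := ∫ y, Real.exp (-(c / 2) * ‖x - y‖ ^ 2) * ‖f y - f x‖ with hJ
  have hJi := hgi (c / 2) (by linarith) x
  have hlim := (tendsto_rpow_mul_exp_neg_div (n / 2) (b := c * r ^ 2 / 2) (by positivity)).const_mul
    (C * J)
  rw [mul_zero] at hlim
  have hev := hlim.eventually (gt_mem_nhds (show (0:ℝ) < ε / 2 by linarith))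
  filter_upwards [hev, self_mem_nhdsWithin, mem_nhdsWithin_of_mem_nhds (Iic_mem_nhds one_pos)]
    with s hs1 hs0 hs2
  have hs : 0 < s := hs0
  have hcv : cv (heatK w s) f x - f x = ∫ y, heatK w s (x - y) * (f y - f x) := by
    have h1 := H.integrable hc hs hf.aestronglyMeasurable hfi x
    have h2 := H.integrable hc hs (f := fun _ => f x) aestronglyMeasurable_const
      (GI.of_bounded aestronglyMeasurable_const (C := ‖f x‖) (by simp)) x
    have h3 : ∫ y, heatK w s (x - y) * f x = f x := by
      rw [integral_mul_const, integral_sub_left_eq_self (fun y => heatK w s y), integral_heatK hw hs,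
        one_mul]
    unfold cv
    conv_lhs => rw [← h3]
    rw [← integral_sub h1 h2]
    congr 1; funext y; ring
  have hg1 : Integrable (fun y : Rn n => gauss c s (x - y)) := (integrable_gauss hc hs).comp_sub_left x
  rw [dist_eq_norm, hcv]
  calc ‖∫ y, heatK w s (x - y) * (f y - f x)‖
      ≤ ∫ y, (C * ε' * gauss c s (x - y) + C * (s ^ (-(n / 2) : ℝ) * Real.exp (-(c * r ^ 2 / 2) / s)) *
          (Real.exp (-(c / 2) * ‖x - y‖ ^ 2) * ‖f y - f x‖)) := by
        refine norm_integral_le_of_norm_le ((hg1.const_mul _).add (hJi.const_mul _))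
          (Eventually.of_forall fun y => ?_)
        have hk : ‖heatK w s (x - y)‖ ≤ C * gauss c s (x - y) := by simpa using hb s hs (x - y)
        have hg0 := gauss_nonneg c hs (x - y)
        rw [norm_mul]
        rcases lt_or_ge ‖x - y‖ r with h | h
        · have h4 : ‖f y - f x‖ ≤ ε' := by
            rw [← dist_eq_norm]
            exact (hrf (by rwa [dist_eq_norm, norm_sub_rev])).le
          have h5 : ‖heatK w s (x - y)‖ * ‖f y - f x‖ ≤ C * ε' * gauss c s (x - y) := by
            calc _ ≤ C * gauss c s (x - y) * ε' := by gcongr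
              _ = _ := by ring
          refine h5.trans (le_add_of_nonneg_right (by positivity))
        · have h4 := gauss_far_le hc.le hs hs2 hr.le h
          have h5 : ‖heatK w s (x - y)‖ * ‖f y - f x‖ ≤
              C * (s ^ (-(n / 2) : ℝ) * Real.exp (-(c * r ^ 2 / 2) / s)) *
              (Real.exp (-(c / 2) * ‖x - y‖ ^ 2) * ‖f y - f x‖) := by
            calc _ ≤ C * (s ^ (-(n / 2) : ℝ) * Real.exp (-(c * r ^ 2 / 2) / s) *
                Real.exp (-(c / 2) * ‖x - y‖ ^ 2)) * ‖f y - f x‖ := by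
                  gcongr; exact hk.trans (by gcongr)
              _ = _ := by ring
          refine h5.trans (le_add_of_nonneg_left (by positivity))
    _ = C * ε' * M + C * J * (s ^ (-(n / 2) : ℝ) * Real.exp (-(c * r ^ 2 / 2) / s)) := by
        rw [integral_add (hg1.const_mul _) (hJi.const_mul _), integral_const_mul, integral_const_mul,
          integral_sub_left_eq_self (fun y => gauss c s y), integral_gauss hc hs]
        ring
    _ < ε := by
        have h6 : C * ε' * M ≤ ε / 2 := by
          rw [hε', mul_div_assoc', div_mul_eq_mul_div, div_le_div_iff₀ (by positivity) (by positivity)]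
          nlinarith [mul_nonneg hC hM0]
        linarith

/-! ### The space `H^∞` and the Sobolev embedding. -/

section HInfty

variable {F G : Type*} [NormedAddCommGroup F] [NormedSpace ℝ F]
  [NormedAddCommGroup G] [NormedSpace ℝ G]

/-- The Sobolev norm `∑_{m ≤ M} ‖∇^m f‖_{L²}`. -/
noncomputable def sob (M : ℕ) (f : Rn n → F) : ℝ :=
  ∑ m ∈ Finset.range (M + 1), (eLpNorm (iteratedFDeriv ℝ m f) 2 volume).toReal

lemma sob_nonneg (M : ℕ) (f : Rn n → F) : 0 ≤ sob M f :=
  Finset.sum_nonneg fun _ _ => ENNReal.toReal_nonneg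

lemma iteratedFDeriv_pd_norm_le {f : Rn n → F} (hf : ContDiff ℝ ∞ f) (k : Fin n) (m : ℕ) (x : Rn n) :
    ‖iteratedFDeriv ℝ m (pd k f) x‖ ≤ ‖iteratedFDeriv ℝ (m + 1) f x‖ := by
  have h := norm_iteratedFDeriv_clm_apply_const (f := fderiv ℝ f) (c := bv k) (x := x) (n := m)
    (N := m) ((hf.fderiv_right (m := m) (by exact_mod_cast le_top)).contDiffAt) le_rfl
  rw [norm_iteratedFDeriv_fderiv, PiLp.norm_single, norm_one, one_mul] at h
  exact h

lemma contDiff_pd {f : Rn n → F} (hf : ContDiff ℝ ∞ f) (k : Fin n) : ContDiff ℝ ∞ (pd k f) :=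
  (hf.fderiv_right (m := ∞) (by simp)).clm_apply contDiff_const

lemma continuous_iteratedFDeriv {f : Rn n → F} (hf : ContDiff ℝ ∞ f) (m : ℕ) :
    Continuous (iteratedFDeriv ℝ m f) :=
  hf.continuous_iteratedFDeriv (by exact_mod_cast le_top)

lemma MemHInfty.pd {f : Rn n → F} (hf : MemHInfty f) (k : Fin n) : MemHInfty (pd k f) :=
  ⟨contDiff_pd hf.1 k, fun m => (hf.2 (m + 1)).mono
    (continuous_iteratedFDeriv (contDiff_pd hf.1 k) m).aestronglyMeasurable
    (Eventually.of_forall fun x => iteratedFDeriv_pd_norm_le hf.1 k m x)⟩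

lemma iteratedFDeriv_clm_norm_le (L : F →L[ℝ] G) {f : Rn n → F} (hf : ContDiff ℝ ∞ f) (m : ℕ)
    (x : Rn n) : ‖iteratedFDeriv ℝ m (fun y => L (f y)) x‖ ≤ ‖L‖ * ‖iteratedFDeriv ℝ m f x‖ :=
  L.norm_iteratedFDeriv_comp_left (n := m) hf.contDiffAt (by exact_mod_cast le_top)

lemma MemHInfty.clm (L : F →L[ℝ] G) {f : Rn n → F} (hf : MemHInfty f) :
    MemHInfty (fun x => L (f x)) := by
  have h1 : ContDiff ℝ ∞ (fun x => L (f x)) := L.contDiff.comp hf.1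
  exact ⟨h1, fun m => (hf.2 m).of_le_mul (continuous_iteratedFDeriv h1 m).aestronglyMeasurable
    (Eventually.of_forall fun x => iteratedFDeriv_clm_norm_le L hf.1 m x)⟩

lemma iteratedFDeriv_diff {f g : Rn n → F} (hf : ContDiff ℝ ∞ f) (hg : ContDiff ℝ ∞ g) (m : ℕ)
    (x : Rn n) : iteratedFDeriv ℝ m (fun y => f y - g y) x =
      iteratedFDeriv ℝ m f x - iteratedFDeriv ℝ m g x :=
  fun_iteratedFDeriv_sub_apply (hf.of_le (by exact_mod_cast le_top)).contDiffAt
    (hg.of_le (by exact_mod_cast le_top)).contDiffAt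

lemma MemHInfty.sub {f g : Rn n → F} (hf : MemHInfty f) (hg : MemHInfty g) :
    MemHInfty (fun x => f x - g x) := by
  refine ⟨hf.1.sub hg.1, fun m => ?_⟩
  have : iteratedFDeriv ℝ m (fun y => f y - g y) = iteratedFDeriv ℝ m f - iteratedFDeriv ℝ m g :=
    funext fun x => iteratedFDeriv_diff hf.1 hg.1 m x
  rw [this]
  exact (hf.2 m).sub (hg.2 m)

lemma pd_clm (L : F →L[ℝ] G) {f : Rn n → F} (hf : ContDiff ℝ ∞ f) (k : Fin n) (x : Rn n) :
    pd k (fun y => L (f y)) x = L (pd k f x) := by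
  have hd : DifferentiableAt ℝ f x := hf.differentiable (by simp) x
  unfold pd
  rw [show (fun y => L (f y)) = L ∘ f from rfl, fderiv_comp x L.differentiableAt hd, L.fderiv]
  rfl

lemma pd_sub {f g : Rn n → F} (hf : ContDiff ℝ ∞ f) (hg : ContDiff ℝ ∞ g) (k : Fin n) :
    pd k (fun y => f y - g y) = fun x => pd k f x - pd k g x := by
  funext x
  unfold pd
  rw [fderiv_fun_sub (hf.differentiable (by simp) x) (hg.differentiable (by simp) x)]
  rfl

lemma hasLineDerivAt_pd {f : Rn n → F} (hf : ContDiff ℝ ∞ f) (k : Fin n) (x : Rn n) :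
    HasLineDerivAt ℝ f (pd k f x) x (bv k) :=
  (hf.differentiable (by simp) x).hasFDerivAt.hasLineDerivAt _

lemma sob_pd_le {f : Rn n → F} (hf : MemHInfty f) (k : Fin n) (M : ℕ) :
    sob M (pd k f) ≤ sob (M + 1) f := by
  unfold sob
  rw [Finset.sum_range_succ' _ (M + 1)]
  refine le_add_of_le_of_nonneg (Finset.sum_le_sum fun m _ => ?_) ENNReal.toReal_nonneg
  exact ENNReal.toReal_mono (hf.2 (m + 1)).eLpNorm_ne_top
    (eLpNorm_mono fun x => iteratedFDeriv_pd_norm_le hf.1 k m x)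

lemma eLpNorm_iteratedFDeriv_zero (f : Rn n → F) :
    eLpNorm (iteratedFDeriv ℝ 0 f) 2 volume = eLpNorm f 2 volume :=
  eLpNorm_congr_norm_ae (Eventually.of_forall fun _ => norm_iteratedFDeriv_zero)

lemma MemHInfty.memLp {f : Rn n → F} (hf : MemHInfty f) : MemLp f 2 volume :=
  ⟨hf.1.continuous.aestronglyMeasurable, by
    rw [← eLpNorm_iteratedFDeriv_zero]; exact (hf.2 0).2⟩

lemma MemHInfty.gi {f : Rn n → F} (hf : MemHInfty f) : GI fun y => ‖f y‖ :=
  GI.of_memLp hf.memLp.norm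

lemma toReal_eLpNorm_le_sob {f : Rn n → F} (M : ℕ) :
    (eLpNorm f 2 volume).toReal ≤ sob M f := by
  rw [← eLpNorm_iteratedFDeriv_zero]
  exact Finset.single_le_sum (f := fun m => (eLpNorm (iteratedFDeriv ℝ m f) 2 volume).toReal)
    (fun _ _ => ENNReal.toReal_nonneg) (Finset.mem_range.2 (Nat.succ_pos M))

end HInfty

namespace IsHeatKernel

variable {z : ℂ} {c κ : ℝ} {K : ℝ → Rn n → ℂ} {D D2 : Fin n → ℝ → Rn n → ℂ}

lemma enorm_le (H : IsHeatKernel z c κ K D D2) :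
    ∃ C : ℝ≥0, ∀ t, 0 < t → ∀ x,
      ‖K t x‖ₑ ≤ C * pw t (-(κ / 2)) * ENNReal.ofReal (gauss c t x) := by
  obtain ⟨C, hC, h⟩ := H.bound
  refine ⟨Real.toNNReal C, fun t ht x => ?_⟩
  change _ ≤ ENNReal.ofReal C * _ * _
  rw [pw, ← ENNReal.ofReal_mul hC, ← ENNReal.ofReal_mul (by positivity), ← ofReal_norm]
  exact ENNReal.ofReal_le_ofReal (h t ht x)

lemma lintegral_enorm_le (H : IsHeatKernel z c κ K D D2) :
    ∃ C : ℝ≥0, ∀ t, 0 < t → ∀ (f : Rn n → ℝ≥0∞), Measurable f → ∀ x,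
      ∫⁻ y, ‖K t (x - y)‖ₑ * f y ≤ C * (pw t (-(κ / 2)) * gconv c t f x) := by
  obtain ⟨C, h⟩ := H.enorm_le
  refine ⟨C, fun t ht f hf x => ?_⟩
  unfold gconv
  rw [← mul_assoc, ← lintegral_const_mul _ (by fun_prop)]
  refine lintegral_mono fun y => ?_
  rw [← mul_assoc]
  gcongr
  exact h t ht _

lemma enorm_cv_le (H : IsHeatKernel z c κ K D D2) :
    ∃ C : ℝ≥0, ∀ t, 0 < t → ∀ f : Rn n → ℂ, Continuous f → ∀ x,
      ‖cv (K t) f x‖ₑ ≤ C * (pw t (-(κ / 2)) * gconv c t (fun y => ‖f y‖ₑ) x) := by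
  obtain ⟨C, h⟩ := H.lintegral_enorm_le
  refine ⟨C, fun t ht f hf x => ?_⟩
  refine (enorm_integral_le_lintegral_enorm _).trans ?_
  simp_rw [enorm_mul]
  exact h t ht _ (by fun_prop) x

lemma hasDerivAt_cv_static (H : IsHeatKernel z c κ K D D2) (hc : 0 < c) (hκ : 0 ≤ κ) {s : ℝ}
    (hs : 0 < s) {f : Rn n → ℂ} (hf : MemHInfty f) (x : Rn n) :
    HasDerivAt (fun s => cv (K s) f x) (z * ∑ i, cv (K s) (pd i (pd i f)) x) s := by
  have h := H.hasDerivAt_cv hc hκ (α := 0) (β := 1) (s₀ := s) (by simpa using hs)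
    (v := fun _ => f) (v' := fun _ _ => 0) (U := Set.univ) univ_mem
    (fun _ _ => hf.1.continuous) continuous_const hf.gi (fun _ _ _ => le_rfl)
    (fun _ _ y => by simp) (fun s _ y => hasDerivAt_const s _) x
  simp only [zero_add, one_mul, Complex.ofReal_one] at h
  refine h.congr_deriv ?_
  have e : cv (K s) (fun _ => 0) x = 0 := by simp [cv]
  rw [e, add_zero]
  congr 1
  refine Finset.sum_congr rfl fun i _ => ?_
  rw [H.cv_D2 hc hs hf.1.continuous (hf.pd i).1.continuous hf.gi (hf.pd i).gi
      (hasLineDerivAt_pd hf.1 i),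
    H.cv_D hc hs (hf.pd i).1.continuous ((hf.pd i).pd i).1.continuous (hf.pd i).gi
      ((hf.pd i).pd i).gi (hasLineDerivAt_pd (hf.pd i).1 i)]

end IsHeatKernel

lemma nr_half (hn : 0 < n) {F : Type*} [NormedAddCommGroup F] (f : Rn n → F) :
    nr (n / 2 : ℝ) (fun x => ‖f x‖ₑ) = eLpNorm f 2 volume := by
  have hn' : (n:ℝ) ≠ 0 := by exact_mod_cast hn.ne'
  rw [eLpNorm_eq_lintegral_rpow_enorm_toReal (by norm_num) (by norm_num), nr]
  congr 1
  · refine lintegral_congr fun x => ?_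
    congr 1; simp; field_simp
  · simp; field_simp

/-- The basic decay estimate `‖S(t)f‖_∞ ≤ C t^{-n/4} ‖f‖_{L²}`. -/
lemma norm_cv_heatK_le (hn : 0 < n) {w : ℂ} (hw : 0 < w.re) :
    ∃ C : ℝ, 0 ≤ C ∧ ∀ t, 0 < t → ∀ f : Rn n → ℂ, MemHInfty f → ∀ x,
      ‖cv (heatK w t) f x‖ ≤ C * t ^ (-(n / 4) : ℝ) * (eLpNorm f 2 volume).toReal := by
  have hn' : (0:ℝ) < n := by exact_mod_cast hn
  have H := isHeatKernel_heatK (n := n) hw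
  obtain ⟨C, h⟩ := H.enorm_cv_le
  obtain ⟨C', h'⟩ := gconv_le_nr (n := n) hn (b := n / 2) (by positivity) (by linarith)
    (c := w.re / 2) (by linarith)
  refine ⟨C * C', by positivity, fun t ht f hf x => ?_⟩
  have h1 := h t ht f hf.1.continuous x
  have hm : Measurable (fun y => ‖f y‖ₑ) := hf.1.continuous.measurable.enorm
  have h2 := h1.trans (mul_le_mul_right (mul_le_mul_right (h' t ht _ hm x) _) _)
  rw [nr_half hn, zero_div, neg_zero, pw_zero, one_mul, ← toReal_enorm] at *
  have hfin := hf.memLp.eLpNorm_ne_top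
  have h3 := ENNReal.toReal_mono (ENNReal.mul_ne_top (by simp)
    (ENNReal.mul_ne_top (ENNReal.mul_ne_top (by simp) (pw_ne_top _ _)) hfin)) h2
  rw [ENNReal.toReal_mul, ENNReal.toReal_mul, ENNReal.toReal_mul, pw,
    ENNReal.toReal_ofReal (by positivity)] at h3
  simp only [ENNReal.coe_toReal] at h3
  rw [show -((n:ℝ) / 2 / 2) = -(n / 4) by ring] at h3
  linarith

/-- Keeping `θ` at distance `1/2` from `1` avoids the logarithm and bounds the factor `1/(1 - θ)`
uniformly. -/
lemma integral_one_add_rpow_le {θ s : ℝ} (hθ : 1 / 2 ≤ |1 - θ|) (hs : 0 < s) (hs1 : s ≤ 1) :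
    IntervalIntegrable (fun τ : ℝ => 1 + τ ^ (-θ)) volume s 1 ∧
      ∫ τ in s..1, (1 + τ ^ (-θ)) ≤ 3 * (1 + s ^ (1 - θ)) := by
  have hne : (0:ℝ) ∉ Set.uIcc s 1 := by
    rw [Set.uIcc_of_le hs1]; exact fun h => absurd h.1 (by linarith)
  have hi : IntervalIntegrable (fun τ : ℝ => τ ^ (-θ)) volume s 1 :=
    intervalIntegral.intervalIntegrable_rpow (Or.inr hne)
  refine ⟨intervalIntegrable_const.add hi, ?_⟩
  have hθ1 : 1 - θ ≠ 0 := fun h => by rw [h] at hθ; norm_num at hθ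
  rw [intervalIntegral.integral_add intervalIntegrable_const hi, intervalIntegral.integral_const,
    integral_rpow (Or.inr ⟨fun h => hθ1 (by linarith), hne⟩), show -θ + 1 = 1 - θ by ring]
  have hp : 0 < s ^ (1 - θ) := by positivity
  have : (1 ^ (1 - θ) - s ^ (1 - θ)) / (1 - θ) ≤ 2 * (1 + s ^ (1 - θ)) := by
    refine (le_abs_self _).trans ?_
    rw [abs_div, Real.one_rpow, div_le_iff₀ (by linarith)]
    have h1 : |1 - s ^ (1 - θ)| ≤ 1 + s ^ (1 - θ) := by
      rw [abs_le]; constructor <;> linarith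
    nlinarith
  simp only [smul_eq_mul, mul_one]
  linarith

/-- Induction on `k` trades derivatives for powers of `s`. The time derivative of the heat flow of
`f` is the heat flow of `Δf`, to which the previous step applies; integrating it from `s` to `1`
improves the exponent by one and costs two derivatives. The exponents `n + 1/2 - k` are
half-integers, so the logarithmic case `θ = 1` never occurs. The parameter `w = 1/4` is the ordinary
heat flow, since `1/(4w) = 1`. -/
lemma sobolev_iterate (hn : 0 < n) (k : ℕ) :
    ∃ C : ℝ, 0 ≤ C ∧ ∀ f : Rn n → ℂ, MemHInfty f → ∀ s, 0 < s → s ≤ 1 → ∀ x,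
      ‖cv (heatK (1 / 4) s) f x‖ ≤ C * (1 + s ^ (-(n + 1 / 2 - k) : ℝ)) * sob (2 * k) f := by
  have hw : 0 < (1 / 4 : ℂ).re := by norm_num
  have H := isHeatKernel_heatK (n := n) hw
  obtain ⟨C₀, hC₀, h₀⟩ := norm_cv_heatK_le hn hw
  induction k with
  | zero =>
    refine ⟨C₀, hC₀, fun f hf s hs hs1 x => (h₀ s hs f hf x).trans ?_⟩
    have h1 : s ^ (-(n / 4) : ℝ) ≤ s ^ (-(n + 1 / 2 - (0:ℕ)) : ℝ) := by
      refine Real.rpow_le_rpow_of_exponent_ge hs hs1 ?_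
      have : (0:ℝ) ≤ n := by positivity
      push_cast; linarith
    gcongr
    · linarith
    · exact toReal_eLpNorm_le_sob _
  | succ k ih =>
    obtain ⟨C, hC, ih⟩ := ih
    refine ⟨C₀ + n * C * 3, by positivity, fun f hf s hs hs1 x => ?_⟩
    set θ : ℝ := n + 1 / 2 - k with hθ
    have hθ' : -(n + 1 / 2 - ((k + 1 : ℕ) : ℝ)) = 1 - θ := by rw [hθ]; push_cast; ring
    rw [hθ']
    have habs : 1 / 2 ≤ |1 - θ| := by
      rw [show 1 - θ = ((2 * (k + 1 : ℤ) - 2 * n - 1 : ℤ) : ℝ) / 2 by rw [hθ]; push_cast; ring, abs_div]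
      have h1 : (1:ℤ) ≤ |2 * (k + 1 : ℤ) - 2 * n - 1| := Int.one_le_abs (by omega)
      have h2 : (1:ℝ) ≤ |((2 * (k + 1 : ℤ) - 2 * n - 1 : ℤ) : ℝ)| := by exact_mod_cast h1
      rw [abs_of_pos (by norm_num : (0:ℝ) < 2)]
      linarith
    set Φ : ℝ → ℂ := fun τ => (1 / (4 * (1 / 4)) : ℂ) * ∑ i, cv (heatK (1 / 4) τ) (pd i (pd i f)) x
      with hΦ
    have hderiv : ∀ τ, 0 < τ → HasDerivAt (fun τ => cv (heatK (1 / 4) τ) f x) (Φ τ) τ := fun τ hτ =>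
      H.hasDerivAt_cv_static (by norm_num) le_rfl hτ hf x
    have hcont : ContinuousOn Φ (Set.uIcc s 1) := by
      rw [Set.uIcc_of_le hs1]
      refine continuousOn_const.mul (continuousOn_finsetSum _ fun i _ τ hτ => ?_)
      exact (H.hasDerivAt_cv_static (by norm_num) le_rfl (lt_of_lt_of_le hs hτ.1)
        ((hf.pd i).pd i) x).continuousAt.continuousWithinAt
    have hftc := intervalIntegral.integral_eq_sub_of_hasDerivAt
      (f := fun τ => cv (heatK (1 / 4) τ) f x) (f' := Φ) (a := s) (b := 1)
      (fun τ hτ => hderiv τ (by rw [Set.uIcc_of_le hs1] at hτ; exact lt_of_lt_of_le hs hτ.1))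
      hcont.intervalIntegrable
    obtain ⟨hint, hle⟩ := integral_one_add_rpow_le habs hs hs1
    set Q := sob (2 * (k + 1)) f with hQ
    have hQ0 : 0 ≤ Q := sob_nonneg _ _
    have hΦb : ∀ τ ∈ Set.Ioc s 1, ‖Φ τ‖ ≤ n * C * Q * (1 + τ ^ (-θ)) := by
      intro τ hτ
      have hτ0 : 0 < τ := hs.trans hτ.1
      rw [hΦ]
      simp only [norm_mul]
      have : ‖∑ i, cv (heatK (1 / 4) τ) (pd i (pd i f)) x‖ ≤ ∑ _i : Fin n, C * (1 + τ ^ (-θ)) * Q := by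
        refine (norm_sum_le _ _).trans (Finset.sum_le_sum fun i _ => ?_)
        refine (ih _ ((hf.pd i).pd i) τ hτ0 hτ.2 x).trans ?_
        gcongr
        exact (sob_pd_le (hf.pd i) i _).trans (sob_pd_le hf i _)
      rw [Finset.sum_const, Finset.card_univ, Fintype.card_fin, nsmul_eq_mul] at this
      calc _ = ‖∑ i, cv (heatK (1 / 4) τ) (pd i (pd i f)) x‖ := by norm_num
        _ ≤ _ := this
        _ = _ := by ring
    have hnorm : ‖∫ τ in s..1, Φ τ‖ ≤ n * C * Q * (3 * (1 + s ^ (1 - θ))) := by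
      refine (intervalIntegral.norm_integral_le_of_norm_le hs1
        (Eventually.of_forall hΦb) (hint.const_mul _)).trans ?_
      rw [intervalIntegral.integral_const_mul]
      gcongr
    have h1 := h₀ 1 one_pos f hf x
    rw [Real.one_rpow, mul_one] at h1
    have h2 : (eLpNorm f 2 volume).toReal ≤ Q := toReal_eLpNorm_le_sob _
    have h3 : 0 ≤ s ^ (1 - θ) := by positivity
    calc ‖cv (heatK (1 / 4) s) f x‖
        = ‖cv (heatK (1 / 4) 1) f x - ∫ τ in s..1, Φ τ‖ := by rw [hftc]; congr 1; ring
      _ ≤ ‖cv (heatK (1 / 4) 1) f x‖ + ‖∫ τ in s..1, Φ τ‖ := norm_sub_le _ _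
      _ ≤ C₀ * Q + n * C * Q * (3 * (1 + s ^ (1 - θ))) := by
          gcongr; exact h1.trans (by gcongr)
      _ ≤ C₀ * Q * (1 + s ^ (1 - θ)) + n * C * Q * (3 * (1 + s ^ (1 - θ))) := by
          have := mul_nonneg (mul_nonneg hC₀ hQ0) h3
          linarith
      _ = _ := by ring

/-- The Sobolev embedding `H^M ⊂ L^∞`. -/
lemma sobolev_embedding (hn : 0 < n) :
    ∃ (C : ℝ) (M : ℕ), 0 ≤ C ∧ ∀ f : Rn n → ℂ, MemHInfty f → ∀ x, ‖f x‖ ≤ C * sob M f := by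
  -- After `n + 1` steps the power of `s` is `s^(1/2)`, so the bound survives the limit `s → 0`.
  obtain ⟨C, hC, h⟩ := sobolev_iterate (n := n) hn (n + 1)
  refine ⟨C * 2, 2 * (n + 1), by positivity, fun f hf x => ?_⟩
  have hw : 0 < (1 / 4 : ℂ).re := by norm_num
  refine le_of_tendsto (tendsto_cv_heatK hw hf.1.continuous hf.gi x).norm ?_
  filter_upwards [self_mem_nhdsWithin, mem_nhdsWithin_of_mem_nhds (Iic_mem_nhds one_pos)]
    with s hs hs1
  have hs0 : (0:ℝ) < s := hs
  refine (h f hf s hs0 hs1 x).trans ?_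
  have := sob_nonneg (2 * (n + 1)) f
  have hp : s ^ (-(n + 1 / 2 - ((n + 1 : ℕ) : ℝ))) ≤ 1 :=
    Real.rpow_le_one hs0.le hs1 (by push_cast; linarith)
  gcongr
  linarith

/-! ### Families continuous in time with values in `H^∞`. -/

section ContHInfty

variable {F G : Type*} [NormedAddCommGroup F] [NormedSpace ℝ F]
  [NormedAddCommGroup G] [NormedSpace ℝ G] {T : ℝ}

lemma ContHInfty.pd {f : ℝ → Rn n → F} (hf : ContHInfty T f) (k : Fin n) :
    ContHInfty T (fun t => pd k (f t)) := by
  refine ⟨fun t ht => (hf.1 t ht).pd k, fun m s hs => ?_⟩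
  refine tendsto_of_tendsto_of_tendsto_of_le_of_le' tendsto_const_nhds (hf.2 (m + 1) s hs)
    (Eventually.of_forall fun _ => zero_le) ?_
  filter_upwards [self_mem_nhdsWithin] with t ht
  refine eLpNorm_mono fun x => ?_
  rw [← iteratedFDeriv_diff ((hf.1 t ht).pd k).1 ((hf.1 s hs).pd k).1,
    ← iteratedFDeriv_diff (hf.1 t ht).1 (hf.1 s hs).1, ← pd_sub (hf.1 t ht).1 (hf.1 s hs).1]
  exact iteratedFDeriv_pd_norm_le ((hf.1 t ht).1.sub (hf.1 s hs).1) k m x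

lemma ContHInfty.clm (L : F →L[ℝ] G) {f : ℝ → Rn n → F} (hf : ContHInfty T f) :
    ContHInfty T (fun t x => L (f t x)) := by
  refine ⟨fun t ht => (hf.1 t ht).clm L, fun m s hs => ?_⟩
  have h0 := ENNReal.Tendsto.const_mul (a := ‖L‖ₑ) (hf.2 m s hs) (Or.inr (by simp))
  rw [mul_zero] at h0
  refine tendsto_of_tendsto_of_tendsto_of_le_of_le' tendsto_const_nhds h0
    (Eventually.of_forall fun _ => zero_le) ?_
  filter_upwards [self_mem_nhdsWithin] with t ht
  rw [← ofReal_norm]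
  refine eLpNorm_le_mul_eLpNorm_of_ae_le_mul (Eventually.of_forall fun x => ?_) 2
  rw [← iteratedFDeriv_diff ((hf.1 t ht).clm L).1 ((hf.1 s hs).clm L).1,
    ← iteratedFDeriv_diff (hf.1 t ht).1 (hf.1 s hs).1]
  simp_rw [← map_sub]
  exact iteratedFDeriv_clm_norm_le L ((hf.1 t ht).1.sub (hf.1 s hs).1) m x

lemma ContHInfty.tendsto_toReal {f : ℝ → Rn n → F} (hf : ContHInfty T f) (m : ℕ) {s : ℝ}
    (hs : s ∈ Set.Icc 0 T) :
    Tendsto (fun t => (eLpNorm (iteratedFDeriv ℝ m fun x => f t x - f s x) 2 volume).toReal)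
      (𝓝[Set.Icc 0 T] s) (𝓝 0) := by
  have h := (ENNReal.tendsto_toReal ENNReal.zero_ne_top).comp (hf.2 m s hs)
  rw [ENNReal.toReal_zero] at h
  refine h.congr' ?_
  filter_upwards [self_mem_nhdsWithin] with t ht
  simp only [Function.comp_apply]
  congr 2
  funext x
  exact (iteratedFDeriv_diff (hf.1 t ht).1 (hf.1 s hs).1 m x).symm

lemma ContHInfty.tendsto_sob {f : ℝ → Rn n → F} (hf : ContHInfty T f) (M : ℕ) {s : ℝ}
    (hs : s ∈ Set.Icc 0 T) :
    Tendsto (fun t => sob M (fun x => f t x - f s x)) (𝓝[Set.Icc 0 T] s) (𝓝 0) := by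
  have key : Tendsto (fun t => sob M (fun x => f t x - f s x)) (𝓝[Set.Icc 0 T] s)
      (𝓝 (∑ _m ∈ Finset.range (M + 1), 0)) := by
    unfold sob
    refine tendsto_finsetSum _ fun m _ => ?_
    exact hf.tendsto_toReal m hs
  simpa using key

/-- Time continuity in the supremum norm. -/
lemma ContHInfty.sup_continuous (hn : 0 < n) {f : ℝ → Rn n → ℂ} (hf : ContHInfty T f) {s : ℝ}
    (hs : s ∈ Set.Icc 0 T) : ∃ osc : ℝ → ℝ, Tendsto osc (𝓝[Set.Icc 0 T] s) (𝓝 0) ∧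
      ∀ t ∈ Set.Icc 0 T, ∀ x, ‖f t x - f s x‖ ≤ osc t := by
  obtain ⟨C, M, hC, h⟩ := sobolev_embedding hn
  refine ⟨fun t => C * sob M (fun x => f t x - f s x), ?_, fun t ht x =>
    h _ ((hf.1 t ht).sub (hf.1 s hs)) x⟩
  simpa using (hf.tendsto_sob M hs).const_mul C

/-- Continuity in the supremum norm bounds the family near each time, and compactness of `[0,T]`
joins finitely many of these bounds. -/
lemma ContHInfty.bounded (hn : 0 < n) {f : ℝ → Rn n → ℂ} (hf : ContHInfty T f) :
    ∃ B : ℝ, 0 ≤ B ∧ ∀ t ∈ Set.Icc 0 T, ∀ x, ‖f t x‖ ≤ B := by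
  obtain ⟨C, M, hC, h⟩ := sobolev_embedding hn
  suffices hloc : ∀ s ∈ Set.Icc 0 T, ∃ U ∈ 𝓝[Set.Icc 0 T] s, ∃ B : ℝ, 0 ≤ B ∧
      ∀ t ∈ U ∩ Set.Icc 0 T, ∀ x, ‖f t x‖ ≤ B by
    have := isCompact_Icc.induction_on
      (p := fun S : Set ℝ => ∃ B : ℝ, 0 ≤ B ∧ ∀ t ∈ S ∩ Set.Icc 0 T, ∀ x, ‖f t x‖ ≤ B)
      ⟨0, le_rfl, by simp⟩
      (fun S S' hSS ⟨B, hB, h⟩ => ⟨B, hB, fun t ht => h t ⟨hSS ht.1, ht.2⟩⟩)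
      (fun S S' ⟨B, hB, h⟩ ⟨B', hB', h'⟩ => ⟨B + B', by positivity, fun t ht x => by
        rcases ht.1 with h1 | h1
        · linarith [h t ⟨h1, ht.2⟩ x]
        · linarith [h' t ⟨h1, ht.2⟩ x]⟩)
      (s := Set.Icc 0 T) (fun s hs => by
        obtain ⟨U, hU, hB⟩ := hloc s hs
        exact ⟨U, hU, hB⟩)
    simpa using this
  intro s hs
  obtain ⟨osc, hosc, hb⟩ := hf.sup_continuous hn hs
  refine ⟨{t | osc t < 1}, hosc.eventually (gt_mem_nhds one_pos), C * sob M (f s) + 1,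
    by have := sob_nonneg M (f s); positivity, fun t ht x => ?_⟩
  have h1 : osc t < 1 := ht.1
  have h2 := hb t ht.2 x
  have h3 := h _ (hf.1 s hs) x
  have h4 := norm_le_norm_add_norm_sub' (f t x) (f s x)
  linarith

end ContHInfty

/-! ### Duhamel's formula as an inequality. -/

/-- The increment of a differentiable function is bounded by the integral of the norm of its
derivative. -/
lemma enorm_sub_le_lintegral_deriv {F F' : ℝ → ℂ} {a b : ℝ} (hab : a < b) {fa fb : ℂ}
    (hd : ∀ s ∈ Set.Ioo a b, HasDerivAt F (F' s) s) (ha : Tendsto F (𝓝[>] a) (𝓝 fa))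
    (hb : Tendsto F (𝓝[<] b) (𝓝 fb)) : ‖fb - fa‖ₑ ≤ ∫⁻ s in Set.Ioo a b, ‖F' s‖ₑ := by
  rcases eq_or_ne (∫⁻ s in Set.Ioo a b, ‖F' s‖ₑ) ⊤ with htop | htop
  · rw [htop]; exact le_top
  -- No regularity of `F'` is assumed: it is measurable because it is a derivative, and integrable
  -- because the right-hand side is now finite.
  have hm : AEStronglyMeasurable F' (volume.restrict (Set.Ioo a b)) := by
    refine (stronglyMeasurable_deriv F).aestronglyMeasurable.congr ?_
    filter_upwards [ae_restrict_mem measurableSet_Ioo] with s hs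
    exact (hd s hs).deriv
  have hint : IntervalIntegrable F' volume a b := by
    rw [intervalIntegrable_iff_integrableOn_Ioo_of_le hab.le]
    exact ⟨hm, lt_top_iff_ne_top.2 htop⟩
  rw [← intervalIntegral.integral_eq_sub_of_hasDerivAt_of_tendsto hab hd hint ha hb,
    intervalIntegral.integral_of_le hab.le, integral_Ioc_eq_integral_Ioo]
  exact enorm_integral_le_lintegral_enorm _

namespace IsHeatKernel

variable {z : ℂ} {c κ : ℝ} {K : ℝ → Rn n → ℂ} {D D2 : Fin n → ℝ → Rn n → ℂ}

lemma norm_cv_le_sup (H : IsHeatKernel z c κ K D D2) (hc : 0 < c) :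
    ∃ C : ℝ, 0 ≤ C ∧ ∀ t, 0 < t → ∀ (f : Rn n → ℂ) (b : ℝ), (∀ y, ‖f y‖ ≤ b) → ∀ x,
      ‖cv (K t) f x‖ ≤ C * t ^ (-(κ / 2)) * b := by
  obtain ⟨C, hC, h⟩ := H.bound
  refine ⟨C * (Real.pi / c) ^ (n / 2 : ℝ), by positivity, fun t ht f b hb x => ?_⟩
  have hg : Integrable (fun y : Rn n => gauss c t (x - y)) :=
    (integrable_gauss hc ht).comp_sub_left x
  calc ‖cv (K t) f x‖ ≤ ∫ y, C * t ^ (-(κ / 2)) * b * gauss c t (x - y) := by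
        refine norm_integral_le_of_norm_le (hg.const_mul _) (Eventually.of_forall fun y => ?_)
        have := gauss_nonneg c ht (x - y)
        rw [norm_mul]
        calc _ ≤ C * t ^ (-(κ / 2)) * gauss c t (x - y) * b := by
              gcongr
              · exact h t ht _
              · exact hb y
          _ = _ := by ring
    _ = _ := by
        rw [integral_const_mul, integral_sub_left_eq_self (fun y => gauss c t y),
          integral_gauss hc ht]
        ring

lemma cv_sub (H : IsHeatKernel z c κ K D D2) (hc : 0 < c) {t : ℝ} (ht : 0 < t) {f g : Rn n → ℂ}
    (hf : MemHInfty f) (hg : MemHInfty g) (x : Rn n) :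
    cv (K t) (fun y => f y - g y) x = cv (K t) f x - cv (K t) g x := by
  unfold cv
  rw [← integral_sub (H.integrable hc ht hf.1.continuous.aestronglyMeasurable hf.gi x)
    (H.integrable hc ht hg.1.continuous.aestronglyMeasurable hg.gi x)]
  congr 1; funext y; ring

lemma cv_pd_pd (H : IsHeatKernel z c κ K D D2) (hc : 0 < c) {t : ℝ} (ht : 0 < t) {f : Rn n → ℂ}
    (hf : MemHInfty f) (i : Fin n) (x : Rn n) :
    cv (D2 i t) f x = cv (K t) (pd i (pd i f)) x := by
  rw [H.cv_D2 hc ht hf.1.continuous (hf.pd i).1.continuous hf.gi (hf.pd i).gi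
      (hasLineDerivAt_pd hf.1 i),
    H.cv_D hc ht (hf.pd i).1.continuous ((hf.pd i).pd i).1.continuous (hf.pd i).gi
      ((hf.pd i).pd i).gi (hasLineDerivAt_pd (hf.pd i).1 i)]

lemma cv_pd (H : IsHeatKernel z c κ K D D2) (hc : 0 < c) {t : ℝ} (ht : 0 < t) {f : Rn n → ℂ}
    (hf : MemHInfty f) (i : Fin n) (x : Rn n) :
    cv (D i t) f x = cv (K t) (pd i f) x :=
  H.cv_D hc ht hf.1.continuous (hf.pd i).1.continuous hf.gi (hf.pd i).gi
      (hasLineDerivAt_pd hf.1 i) x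

lemma tendsto_cv_left (H : IsHeatKernel z c κ K D D2) (hc : 0 < c) (hκ : 0 ≤ κ) (hn : 0 < n)
    {T t : ℝ} (ht : t ∈ Set.Ioc 0 T) {v : ℝ → Rn n → ℂ} (hv : ContHInfty T v) (x : Rn n) :
    Tendsto (fun s => cv (K (t - s)) (v s) x) (𝓝[>] 0) (𝓝 (cv (K t) (v 0) x)) := by
  obtain ⟨C, hC, hb⟩ := H.norm_cv_le_sup hc
  have h0 : (0:ℝ) ∈ Set.Icc 0 T := ⟨le_rfl, ht.1.le.trans ht.2⟩
  obtain ⟨osc, hosc, hov⟩ := hv.sup_continuous hn h0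
  have hle : 𝓝[>] (0:ℝ) ≤ 𝓝[Set.Icc 0 T] 0 := by
    refine (nhdsWithin_le_iff).2 ?_
    filter_upwards [Ioc_mem_nhdsGT (lt_of_lt_of_le ht.1 ht.2)] with s hs
    exact ⟨hs.1.le, hs.2⟩
  have h1 : Tendsto (fun s => cv (K (t - s)) (v 0) x) (𝓝[>] 0) (𝓝 (cv (K t) (v 0) x)) := by
    have hd := (H.hasDerivAt_cv_static hc hκ ht.1 (hv.1 0 h0) x).continuousAt
    have hsub : Tendsto (fun s : ℝ => t - s) (𝓝[>] 0) (𝓝 t) := by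
      have : ContinuousAt (fun s : ℝ => t - s) 0 := by fun_prop
      simpa [ContinuousAt] using this.tendsto.mono_left nhdsWithin_le_nhds
    exact hd.tendsto.comp hsub
  have h2 : Tendsto (fun s => cv (K (t - s)) (fun y => v s y - v 0 y) x) (𝓝[>] 0) (𝓝 0) := by
    have hlim : Tendsto (fun s => C * (t - s) ^ (-(κ / 2)) * osc s) (𝓝[>] 0) (𝓝 0) := by
      have hp : Tendsto (fun s : ℝ => C * (t - s) ^ (-(κ / 2))) (𝓝[>] 0)
          (𝓝 (C * (t - 0) ^ (-(κ / 2)))) := by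
        refine (ContinuousAt.tendsto ?_).mono_left nhdsWithin_le_nhds
        refine continuousAt_const.mul (ContinuousAt.rpow_const (by fun_prop) (Or.inl ?_))
        simpa using ht.1.ne'
      simpa using hp.mul (hosc.mono_left hle)
    refine squeeze_zero_norm' ?_ hlim
    filter_upwards [Ioo_mem_nhdsGT ht.1] with s hs
    exact hb _ (by linarith [hs.2]) _ _ (hov s ⟨hs.1.le, hs.2.le.trans ht.2⟩) x
  have h3 := h2.add h1
  rw [zero_add] at h3
  refine h3.congr' ?_
  filter_upwards [Ioo_mem_nhdsGT ht.1] with s hs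
  rw [H.cv_sub hc (by linarith [hs.2]) (hv.1 s ⟨hs.1.le, hs.2.le.trans ht.2⟩) (hv.1 0 h0)]
  ring

/-- Duhamel's inequality: if `∂_t v = z Δ v + N`, the difference between the end value and the free
evolution is controlled by the evolution of `N`. -/
lemma duhamel (H : IsHeatKernel z c κ K D D2) (hc : 0 < c) (hκ : 0 ≤ κ) (hn : 0 < n)
    {T t : ℝ} (ht : t ∈ Set.Ioc 0 T) {v N : ℝ → Rn n → ℂ} (hv : ContHInfty T v)
    (hNc : ∀ s ∈ Set.Ioo 0 T, Continuous (N s)) {B : ℝ} (hNB : ∀ s ∈ Set.Ioo 0 T, ∀ x, ‖N s x‖ ≤ B)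
    (hd : ∀ s ∈ Set.Ioo 0 T, ∀ x,
      HasDerivAt (fun s => v s x) (z * ∑ i, pd i (pd i (v s)) x + N s x) s)
    (x : Rn n) {L : ℂ} (hL : Tendsto (fun s => cv (K (t - s)) (v s) x) (𝓝[<] t) (𝓝 L)) :
    ‖L - cv (K t) (v 0) x‖ₑ ≤ ∫⁻ s in Set.Ioo 0 t, ‖cv (K (t - s)) (N s) x‖ₑ := by
  -- The path is `s ↦ K(t - s) * v(s)`. Moving two derivatives from the kernel to `v` makes the two
  -- copies of `z Δ` cancel, so its derivative is `K(t - s) * N(s)`. The limit `L` at `s = t` is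
  -- left open because it depends on the kernel: it is `v t` for the heat kernel and `∂_j v t` for
  -- its `j`-th derivative.
  refine enorm_sub_le_lintegral_deriv ht.1 (fun s hs => ?_) (H.tendsto_cv_left hc hκ hn ht hv x) hL
  have hsT : s ∈ Set.Ioo 0 T := ⟨hs.1, lt_of_lt_of_le hs.2 ht.2⟩
  have hIcc : ∀ r ∈ Set.Ioo 0 T, r ∈ Set.Icc 0 T := fun r hr => ⟨hr.1.le, hr.2.le⟩
  obtain ⟨B₀, hB₀, hvB⟩ := hv.bounded hn
  have hpdB : ∀ i, ∃ B : ℝ, 0 ≤ B ∧ ∀ t ∈ Set.Icc 0 T, ∀ x, ‖pd i (pd i (v t)) x‖ ≤ B :=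
    fun i => ((hv.pd i).pd i).bounded hn
  choose Bi hBi hpdB using hpdB
  have hB : 0 ≤ B := (norm_nonneg _).trans (hNB s hsT 0)
  set V : ℝ := B₀ + (‖z‖ * ∑ i, Bi i + B) with hV
  have hsum0 : 0 ≤ ∑ i, Bi i := Finset.sum_nonneg fun i _ => hBi i
  have hts : 0 < t + (-1) * s := by linarith [hs.2]
  have hvs := hv.1 s (hIcc s hsT)
  have hlapc : ∀ r ∈ Set.Ioo 0 T, Continuous (fun x => ∑ i, pd i (pd i (v r)) x) := fun r hr =>
    continuous_finsetSum _ fun i _ => (((hv.1 r (hIcc r hr)).pd i).pd i).1.continuous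
  have key := H.hasDerivAt_cv hc hκ (α := t) (β := -1) (s₀ := s) hts (v := v)
    (v' := fun s x => z * ∑ i, pd i (pd i (v s)) x + N s x) (U := Set.Ioo 0 T)
    (Ioo_mem_nhds hsT.1 hsT.2) (fun r hr => (hv.1 r (hIcc r hr)).1.continuous)
    ((continuous_const.mul (hlapc s hsT)).add (hNc s hsT)) (V := fun _ => V)
    (GI.of_bounded aestronglyMeasurable_const (C := ‖V‖) (fun _ => le_rfl))
    (fun r hr y => by
      have := hvB r (hIcc r hr) y
      have : 0 ≤ ‖z‖ * ∑ i, Bi i := by positivity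
      rw [hV]; linarith)
    (fun r hr y => by
      have h1 : ‖∑ i, pd i (pd i (v r)) y‖ ≤ ∑ i, Bi i :=
        (norm_sum_le _ _).trans (Finset.sum_le_sum fun i _ => hpdB i r (hIcc r hr) y)
      have h2 : ‖z * ∑ i, pd i (pd i (v r)) y + N r y‖ ≤ ‖z‖ * ∑ i, Bi i + B := by
        refine (norm_add_le _ _).trans (add_le_add ?_ (hNB r hr y))
        rw [norm_mul]; gcongr
      rw [hV]; linarith)
    (fun r hr y => hd r hr y) x
  simp only [neg_one_mul, ← sub_eq_add_neg] at key hts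
  refine key.congr_deriv ?_
  have hNi : GI fun y => ‖N s y‖ := GI.of_bounded (hNc s hsT).norm.aestronglyMeasurable
    (C := B) (fun y => by simpa using hNB s hsT y)
  have e1 : cv (K (t - s)) (fun x => z * ∑ i, pd i (pd i (v s)) x + N s x) x =
      z * ∑ i, cv (K (t - s)) (pd i (pd i (v s))) x + cv (K (t - s)) (N s) x := by
    have hi : ∀ i, Integrable fun y => K (t - s) (x - y) * pd i (pd i (v s)) y := fun i =>
      H.integrable hc hts ((hvs.pd i).pd i).1.continuous.aestronglyMeasurable ((hvs.pd i).pd i).gi x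
    unfold cv
    rw [← integral_finsetSum _ fun i _ => hi i, ← integral_const_mul,
      ← integral_add ((integrable_finsetSum _ fun i _ => hi i).const_mul _)
        (H.integrable hc hts (hNc s hsT).aestronglyMeasurable hNi x)]
    congr 1; funext y
    rw [mul_add, ← Finset.mul_sum]; ring
  rw [e1]
  simp_rw [H.cv_pd_pd hc hts hvs]
  push_cast; ring

lemma norm_fderiv_le {f : Rn n → ℂ} {B : Fin n → ℝ} {x : Rn n} (h : ∀ i, ‖pd i f x‖ ≤ B i) :
    ‖fderiv ℝ f x‖ ≤ ∑ i, B i := by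
  have hB : ∀ i, 0 ≤ B i := fun i => (norm_nonneg _).trans (h i)
  refine ContinuousLinearMap.opNorm_le_bound _ (Finset.sum_nonneg fun i _ => hB i) fun y => ?_
  have hy : y = ∑ i, y i • bv i := by
    ext j
    simp [Pi.single_apply]
  conv_lhs => rw [hy]
  rw [map_sum, Finset.sum_mul]
  refine (norm_sum_le _ _).trans (Finset.sum_le_sum fun i _ => ?_)
  rw [map_smul, norm_smul, mul_comm]
  exact mul_le_mul (h i) (PiLp.norm_apply_le y i) (norm_nonneg _) (hB i)

/-- The gradient of the evolution. -/
lemma pd_cv (H : IsHeatKernel z c κ K D D2) (hc : 0 < c) {t : ℝ} (ht : 0 < t) {f : Rn n → ℂ}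
    (hf : MemHInfty f) {B : ℝ} (hfB : ∀ y, ‖f y‖ ≤ B) {B' : Fin n → ℝ}
    (hfB' : ∀ i y, ‖pd i f y‖ ≤ B' i) (j : Fin n) (x : Rn n) :
    pd j (cv (K t) f) x = cv (D j t) f x := by
  have hB : 0 ≤ B := (norm_nonneg _).trans (hfB 0)
  have hKi : Integrable (K t) := by
    obtain ⟨C, hC, h⟩ := H.bound
    exact ((integrable_gauss hc ht).const_mul _).mono' (H.cont t ht).aestronglyMeasurable
      (Eventually.of_forall (h t ht))
  -- Shifting `f` instead of the kernel puts the derivative on `f`, whose gradient is bounded; the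
  -- integrable kernel is then the majorant.
  have hswap : ∀ g : Rn n → ℂ, cv (K t) g = fun x => ∫ y, K t y • g (x - y) := by
    intro g; funext x
    unfold cv
    rw [← integral_sub_left_eq_self _ volume x]
    simp
  have hfd : Continuous (fderiv ℝ f) := hf.1.continuous_fderiv (by simp)
  have key := hasFDerivAt_integral_of_dominated_of_fderiv_le (𝕜 := ℝ) (μ := volume)
    (F := fun x y => K t y • f (x - y)) (F' := fun x y => K t y • fderiv ℝ f (x - y)) (x₀ := x)
    (bound := fun y => ‖K t y‖ * ∑ i, B' i) (s := Set.univ) univ_mem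
    (Eventually.of_forall fun x => ((H.cont t ht).smul
      (hf.1.continuous.comp (by fun_prop))).aestronglyMeasurable)
    (by
      refine (hKi.norm.mul_const B).mono' ((H.cont t ht).smul
        (hf.1.continuous.comp (by fun_prop))).aestronglyMeasurable (Eventually.of_forall fun y => ?_)
      rw [norm_smul]; gcongr; exact hfB _)
    (((H.cont t ht).smul (hfd.comp (by fun_prop))).aestronglyMeasurable)
    (Eventually.of_forall fun y x _ => by
      rw [norm_smul]; gcongr; exact norm_fderiv_le fun i => hfB' i _)
    (hKi.norm.mul_const _)
    (Eventually.of_forall fun y x _ => by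
      have h1 := (hf.1.differentiable (by simp) (x - y)).hasFDerivAt
      have h2 : HasFDerivAt (fun x => f (x - y)) (fderiv ℝ f (x - y)) x :=
        (h1.comp x ((hasFDerivAt_id x).sub_const y)).congr_fderiv (by ext; simp)
      exact h2.const_smul (K t y))
  rw [H.cv_pd hc ht hf, hswap f, hswap (pd j f)]
  unfold pd
  rw [key.fderiv, ContinuousLinearMap.integral_apply]
  · rfl
  · refine (hKi.norm.mul_const (∑ i, B' i)).mono' ((H.cont t ht).smul
      (hfd.comp (by fun_prop))).aestronglyMeasurable (Eventually.of_forall fun y => ?_)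
    rw [norm_smul]; gcongr; exact norm_fderiv_le fun i => hfB' i _

end IsHeatKernel

lemma tendsto_cv_heatK_right {w : ℂ} (hw : 0 < w.re) (hn : 0 < n) {T t : ℝ} (ht : t ∈ Set.Ioc 0 T)
    {v : ℝ → Rn n → ℂ} (hv : ContHInfty T v) (x : Rn n) :
    Tendsto (fun s => cv (heatK w (t - s)) (v s) x) (𝓝[<] t) (𝓝 (v t x)) := by
  have H := isHeatKernel_heatK (n := n) hw
  have hc : 0 < w.re / 2 := by linarith
  obtain ⟨C, hC, hb⟩ := H.norm_cv_le_sup hc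
  have ht0 : t ∈ Set.Icc 0 T := ⟨ht.1.le, ht.2⟩
  obtain ⟨osc, hosc, hov⟩ := hv.sup_continuous hn ht0
  have hle : 𝓝[<] t ≤ 𝓝[Set.Icc 0 T] t := by
    refine (nhdsWithin_le_iff).2 ?_
    filter_upwards [Ioo_mem_nhdsLT ht.1] with s hs
    exact ⟨hs.1.le, hs.2.le.trans ht.2⟩
  have hsub : Tendsto (fun s : ℝ => t - s) (𝓝[<] t) (𝓝[>] 0) := by
    refine tendsto_nhdsWithin_iff.2 ⟨?_, ?_⟩
    · have : ContinuousAt (fun s : ℝ => t - s) t := by fun_prop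
      simpa [ContinuousAt] using this.tendsto.mono_left nhdsWithin_le_nhds
    · filter_upwards [self_mem_nhdsWithin] with s hs
      exact Set.mem_Ioi.2 (sub_pos.2 (Set.mem_Iio.1 hs))
  have h1 := (tendsto_cv_heatK hw (hv.1 t ht0).1.continuous (hv.1 t ht0).gi x).comp hsub
  have h2 : Tendsto (fun s => cv (heatK w (t - s)) (fun y => v s y - v t y) x) (𝓝[<] t) (𝓝 0) := by
    have hlim : Tendsto (fun s => C * osc s) (𝓝[<] t) (𝓝 0) := by
      simpa using (hosc.mono_left hle).const_mul C
    refine squeeze_zero_norm' ?_ hlim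
    filter_upwards [Ioo_mem_nhdsLT ht.1] with s hs
    simpa using hb (t - s) (by linarith [hs.2]) _ _ (hov s ⟨hs.1.le, hs.2.le.trans ht.2⟩) x
  have h3 := h2.add h1
  rw [zero_add] at h3
  refine h3.congr' ?_
  filter_upwards [Ioo_mem_nhdsLT ht.1] with s hs
  rw [H.cv_sub hc (by linarith [hs.2]) (hv.1 s ⟨hs.1.le, hs.2.le.trans ht.2⟩) (hv.1 t ht0)]
  simp

/-- Duhamel's inequality for the solution. -/
lemma duhamel_heatK {w : ℂ} (hw : 0 < w.re) (hn : 0 < n) :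
    ∃ C : ℝ≥0, ∀ (T t : ℝ), t ∈ Set.Ioc 0 T → ∀ v N : ℝ → Rn n → ℂ, ContHInfty T v →
      (∀ s ∈ Set.Ioo 0 T, Continuous (N s)) → (∃ B : ℝ, ∀ s ∈ Set.Ioo 0 T, ∀ x, ‖N s x‖ ≤ B) →
      (∀ s ∈ Set.Ioo 0 T, ∀ x,
        HasDerivAt (fun s => v s x) (1 / (4 * w) * ∑ i, pd i (pd i (v s)) x + N s x) s) → ∀ x,
      ‖v t x - cv (heatK w t) (v 0) x‖ₑ ≤
        C * ∫⁻ s in Set.Ioo 0 t, gconv (w.re / 2) (t - s) (fun y => ‖N s y‖ₑ) x := by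
  have H := isHeatKernel_heatK (n := n) hw
  have hc : 0 < w.re / 2 := by linarith
  obtain ⟨C, h⟩ := H.enorm_cv_le
  refine ⟨C, fun T t ht v N hv hNc ⟨B, hNB⟩ hd x => ?_⟩
  refine (H.duhamel hc le_rfl hn ht hv hNc hNB hd x (tendsto_cv_heatK_right hw hn ht hv x)).trans ?_
  rw [← lintegral_const_mul' _ _ (by simp)]
  refine setLIntegral_mono' measurableSet_Ioo fun s hs => ?_
  have := h (t - s) (by linarith [hs.2]) (N s) (hNc s ⟨hs.1, lt_of_lt_of_le hs.2 ht.2⟩) x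
  simpa [pw_zero] using this

/-- Duhamel's inequality for the gradient of the solution. -/
lemma duhamel_heatD {w : ℂ} (hw : 0 < w.re) (hn : 0 < n) (j : Fin n) :
    ∃ C : ℝ≥0, ∀ (T t : ℝ), t ∈ Set.Ioc 0 T → ∀ v N : ℝ → Rn n → ℂ, ContHInfty T v →
      (∀ s ∈ Set.Ioo 0 T, Continuous (N s)) → (∃ B : ℝ, ∀ s ∈ Set.Ioo 0 T, ∀ x, ‖N s x‖ ≤ B) →
      (∀ s ∈ Set.Ioo 0 T, ∀ x,
        HasDerivAt (fun s => v s x) (1 / (4 * w) * ∑ i, pd i (pd i (v s)) x + N s x) s) → ∀ x,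
      ‖pd j (v t) x - pd j (cv (heatK w t) (v 0)) x‖ₑ ≤
        C * ∫⁻ s in Set.Ioo 0 t, pw (t - s) (-(1 / 2)) *
          gconv (w.re / 2) (t - s) (fun y => ‖N s y‖ₑ) x := by
  have H₀ := isHeatKernel_heatK (n := n) hw
  have H := isHeatKernel_heatD (n := n) hw j
  have hc : 0 < w.re / 2 := by linarith
  obtain ⟨C, h⟩ := H.enorm_cv_le
  refine ⟨C, fun T t ht v N hv hNc ⟨B, hNB⟩ hd x => ?_⟩
  have h0 : (0:ℝ) ∈ Set.Icc 0 T := ⟨le_rfl, ht.1.le.trans ht.2⟩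
  -- For `s < t` the derivative may be moved from the kernel to `v s`, which reduces the limit to
  -- the approximate identity applied to `∂_j v`.
  have hlim : Tendsto (fun s => cv (heatD w j (t - s)) (v s) x) (𝓝[<] t) (𝓝 (pd j (v t) x)) := by
    refine (tendsto_cv_heatK_right hw hn ht (hv.pd j) x).congr' ?_
    filter_upwards [Ioo_mem_nhdsLT ht.1] with s hs
    exact (H₀.cv_pd hc (by linarith [hs.2]) (hv.1 s ⟨hs.1.le, hs.2.le.trans ht.2⟩) j x).symm
  obtain ⟨B₀, -, hB₀⟩ := hv.bounded hn
  choose B₁ hB₁ hB₁' using fun i => (hv.pd i).bounded hn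
  rw [H₀.pd_cv hc ht.1 (hv.1 0 h0) (hB₀ 0 h0) (fun i => hB₁' i 0 h0)]
  refine (H.duhamel hc zero_le_one hn ht hv hNc hNB hd x hlim).trans ?_
  rw [← lintegral_const_mul' _ _ (by simp)]
  refine setLIntegral_mono' measurableSet_Ioo fun s hs => ?_
  exact h (t - s) (by linarith [hs.2]) (N s) (hNc s ⟨hs.1, lt_of_lt_of_le hs.2 ht.2⟩) x

/-! ### Elliptic control by the order-one potential. -/

/-- A function whose Laplacian is a divergence is controlled by a potential of order one. -/
lemma enorm_le_riesz (hn : 0 < n) :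
    ∃ C : ℝ≥0, ∀ f : Rn n → ℂ, MemHInfty f → ∀ q : Fin n → Rn n → ℂ, (∀ k, Continuous (q k)) →
      ∀ x, (∀ s, 0 < s → ∑ k, cv (heatD (1 / 4) k s) (pd k f) x =
        ∑ k, cv (heatD (1 / 4) k s) (q k) x) →
      ‖f x‖ₑ ≤ C * ∑ k, riesz (1 / 8) (fun y => ‖q k y‖ₑ) x := by
  have hw : 0 < (1 / 4 : ℂ).re := by norm_num
  have hc : 0 < (1 / 4 : ℂ).re / 2 := by norm_num
  have H := isHeatKernel_heatK (n := n) hw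
  choose C hC using fun k : Fin n => (isHeatKernel_heatD (n := n) hw k).enorm_cv_le
  obtain ⟨C₀, hC₀, h₀⟩ := norm_cv_heatK_le hn hw
  refine ⟨∑ k, C k, fun f hf q hq x hx => ?_⟩
  set R : ℝ≥0∞ := (∑ k, C k : ℝ≥0) * ∑ k, riesz (1 / 8) (fun y => ‖q k y‖ₑ) x with hR
  -- The function `f` is minus the integral over `s > 0` of `∂_s(e^{sΔ} f)`, because `e^{SΔ} f → 0`
  -- as `S → ∞` by the `L²` decay. The integrand is `∑ ∂_k K_s * ∂_k f`, which equals `∑ ∂_k K_s *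
  -- q_k` by the hypothesis, a form of `Δf = div q` tested on heat kernels; the bound `s^(-1/2)`
  -- times a Gaussian for `∂_k K_s` then produces the potential.
  set φ' : ℝ → ℂ := fun s => ∑ k, cv (heatD (1 / 4) k s) (q k) x with hφ'
  have hd : ∀ s, 0 < s → HasDerivAt (fun s => cv (heatK (1 / 4) s) f x) (φ' s) s := by
    intro s hs
    refine (H.hasDerivAt_cv_static hc le_rfl hs hf x).congr_deriv ?_
    change _ = ∑ k, cv (heatD (1 / 4) k s) (q k) x
    rw [← hx s hs]
    simp_rw [← H.cv_pd hc hs (hf.pd _)]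
    norm_num
  have hφ : ∀ s, 0 < s → ‖φ' s‖ₑ ≤ (∑ k, C k : ℝ≥0) *
      ∑ k, pw s (-(1 / 2)) * gconv (1 / 8) s (fun y => ‖q k y‖ₑ) x := by
    intro s hs
    refine (enorm_sum_le _ _).trans ?_
    rw [Finset.mul_sum]
    refine Finset.sum_le_sum fun k _ => ?_
    refine (hC k s hs (q k) (hq k) x).trans ?_
    have e : (1 / 4 : ℂ).re / 2 = 1 / 8 := by norm_num
    rw [e]
    gcongr
    exact Finset.single_le_sum (f := C) (fun _ _ => zero_le) (Finset.mem_univ k)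
  have hint : ∫⁻ s in Set.Ioi (0:ℝ), ‖φ' s‖ₑ ≤ R := by
    refine (setLIntegral_mono' measurableSet_Ioi hφ).trans ?_
    have hm : ∀ k, Measurable (fun s => pw s (-(1 / 2)) * gconv (1 / 8) s (fun y => ‖q k y‖ₑ) x) :=
      fun k => (measurable_pw _).mul ((measurable_gconv _
        (hq k).measurable.enorm).comp measurable_prodMk_right)
    rw [lintegral_const_mul _ (Finset.measurable_fun_sum _ fun k _ => hm k),
      lintegral_finsetSum _ fun k _ => hm k]
    rfl
  have hbound : ∀ S, 0 < S → ‖cv (heatK (1 / 4) S) f x - f x‖ₑ ≤ R := by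
    intro S hS
    refine (enorm_sub_le_lintegral_deriv hS (fun s hs => hd s hs.1)
      (tendsto_cv_heatK hw hf.1.continuous hf.gi x)
      ((hd S hS).continuousAt.tendsto.mono_left nhdsWithin_le_nhds)).trans ?_
    exact (lintegral_mono_set fun s hs => hs.1).trans hint
  have hzero : Tendsto (fun S => cv (heatK (1 / 4) S) f x) atTop (𝓝 0) := by
    have hlim : Tendsto (fun S : ℝ => C₀ * S ^ (-(n / 4) : ℝ) * (eLpNorm f 2 volume).toReal) atTop
        (𝓝 0) := by
      have hn' : (0:ℝ) < n := by exact_mod_cast hn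
      simpa using ((tendsto_rpow_neg_atTop (y := (n:ℝ) / 4) (by positivity)).const_mul C₀).mul_const
        (eLpNorm f 2 volume).toReal
    refine squeeze_zero_norm' ?_ hlim
    filter_upwards [eventually_gt_atTop 0] with S hS
    exact h₀ S hS f hf x
  have h1 : Tendsto (fun S => ‖cv (heatK (1 / 4) S) f x - f x‖ₑ) atTop (𝓝 ‖(0:ℂ) - f x‖ₑ) :=
    (hzero.sub_const (f x)).enorm
  have h2 := le_of_tendsto h1 ((eventually_gt_atTop 0).mono hbound)
  simpa using h2

/-! ### Pointwise bounds for the connection and the nonlinearity in the Coulomb gauge. -/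

/-- Families of continuous functions on `ℝⁿ` that are bounded uniformly for `t ∈ [0,T]`. -/
def BddCont (T : ℝ) (f : ℝ → Rn n → ℂ) : Prop :=
  (∀ t ∈ Set.Icc 0 T, Continuous (f t)) ∧ ∃ B : ℝ, ∀ t ∈ Set.Icc 0 T, ∀ x, ‖f t x‖ ≤ B

namespace BddCont

variable {T : ℝ} {f g : ℝ → Rn n → ℂ}

lemma of_contHInfty (hn : 0 < n) (hf : ContHInfty T f) : BddCont T f :=
  ⟨fun t ht => (hf.1 t ht).1.continuous, (hf.bounded hn).imp fun _ h => h.2⟩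

lemma const (c : ℂ) : BddCont T (fun _ (_ : Rn n) => c) :=
  ⟨fun _ _ => continuous_const, ‖c‖, fun _ _ _ => le_rfl⟩

lemma add (hf : BddCont T f) (hg : BddCont T g) : BddCont T (fun t x => f t x + g t x) := by
  obtain ⟨hf, B, hB⟩ := hf
  obtain ⟨hg, B', hB'⟩ := hg
  exact ⟨fun t ht => (hf t ht).add (hg t ht), B + B', fun t ht x =>
    (norm_add_le _ _).trans (add_le_add (hB t ht x) (hB' t ht x))⟩

lemma mul (hf : BddCont T f) (hg : BddCont T g) : BddCont T (fun t x => f t x * g t x) := by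
  obtain ⟨hf, B, hB⟩ := hf
  obtain ⟨hg, B', hB'⟩ := hg
  refine ⟨fun t ht => (hf t ht).mul (hg t ht), B * B', fun t ht x => ?_⟩
  rw [norm_mul]
  exact mul_le_mul (hB t ht x) (hB' t ht x) (norm_nonneg _) ((norm_nonneg _).trans (hB t ht x))

lemma neg (hf : BddCont T f) : BddCont T (fun t x => -f t x) := by
  simpa using (const (n := n) (T := T) (-1)).mul hf

lemma sub (hf : BddCont T f) (hg : BddCont T g) : BddCont T (fun t x => f t x - g t x) := by
  simpa [sub_eq_add_neg] using hf.add hg.neg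

lemma sum {ι : Type*} (s : Finset ι) {f : ι → ℝ → Rn n → ℂ} (hf : ∀ i, BddCont T (f i)) :
    BddCont T (fun t x => ∑ i ∈ s, f i t x) := by
  classical
  induction s using Finset.induction with
  | empty => simpa using const (n := n) (T := T) 0
  | insert i s hi ih => simpa [Finset.sum_insert hi] using (hf i).add ih

lemma im_mul_conj (hf : BddCont T f) (hg : BddCont T g) :
    BddCont T (fun t x => (((f t x * conj (g t x)).im : ℝ) : ℂ)) := by
  obtain ⟨hf, B, hB⟩ := hf
  obtain ⟨hg, B', hB'⟩ := hg
  refine ⟨fun t ht => Complex.continuous_ofReal.comp (Complex.continuous_im.comp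
    ((hf t ht).mul (Complex.continuous_conj.comp (hg t ht)))), B * B', fun t ht x => ?_⟩
  rw [Complex.norm_real]
  refine (Complex.abs_im_le_norm _).trans ?_
  rw [norm_mul, RCLike.norm_conj]
  exact mul_le_mul (hB t ht x) (hB' t ht x) (norm_nonneg _) ((norm_nonneg _).trans (hB t ht x))

lemma gi (hf : BddCont T f) {t : ℝ} (ht : t ∈ Set.Icc 0 T) : GI fun y => ‖f t y‖ := by
  obtain ⟨hf, B, hB⟩ := hf
  exact GI.of_bounded (hf t ht).norm.aestronglyMeasurable (C := B) (fun y => by simpa using hB t ht y)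

end BddCont

lemma pd_ofReal {g : Rn n → ℝ} (hg : ContDiff ℝ ∞ g) (k : Fin n) (x : Rn n) :
    pd k (fun y => ((g y : ℝ) : ℂ)) x = ((pd k g x : ℝ) : ℂ) :=
  pd_clm Complex.ofRealCLM hg k x

lemma contHInfty_coord {T : ℝ} {u : ℝ → Rn n → Cn n} (hu : ContHInfty T u) (l : Fin n) :
    ContHInfty T (fun t x => u t x l) :=
  hu.clm (PiLp.proj (𝕜 := ℝ) 2 (fun _ : Fin n => ℂ) l)

lemma contHInfty_real_coord {T : ℝ} {a : ℝ → Rn n → Rn n} (ha : ContHInfty T a) (l : Fin n) :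
    ContHInfty T (fun t x => a t x l) :=
  ha.clm (PiLp.proj (𝕜 := ℝ) 2 (fun _ : Fin n => ℝ) l)

lemma contHInfty_ofReal {T : ℝ} {g : ℝ → Rn n → ℝ} (hg : ContHInfty T g) :
    ContHInfty T (fun t x => ((g t x : ℝ) : ℂ)) :=
  hg.clm Complex.ofRealCLM

lemma pd_mul {f g : Rn n → ℂ} (hf : ContDiff ℝ ∞ f) (hg : ContDiff ℝ ∞ g) (k : Fin n) (x : Rn n) :
    pd k (fun y => f y * g y) x = pd k f x * g x + f x * pd k g x := by
  unfold pd
  rw [fderiv_fun_mul (hf.differentiable (by simp) x) (hg.differentiable (by simp) x)]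
  simp; ring

lemma pd_add {f g : Rn n → ℂ} (hf : ContDiff ℝ ∞ f) (hg : ContDiff ℝ ∞ g) (k : Fin n) (x : Rn n) :
    pd k (fun y => f y + g y) x = pd k f x + pd k g x := by
  unfold pd
  rw [fderiv_fun_add (hf.differentiable (by simp) x) (hg.differentiable (by simp) x)]
  rfl

/-- The covariant Laplacian in terms of the Laplacian. -/
lemma covD_covD {b : Rn n → Rn n} {f : Rn n → ℂ} (k : Fin n)
    (hb : ContDiff ℝ ∞ (fun x => b x k)) (hf : ContDiff ℝ ∞ f) (x : Rn n) :
    covD b k (covD b k f) x = pd k (pd k f) x + 2 * (Complex.I * (b x k : ℂ) * pd k f x)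
      - (b x k : ℂ) ^ 2 * f x + Complex.I * ((pd k (fun y => b y k) x : ℝ) : ℂ) * f x := by
  have hbc : ContDiff ℝ ∞ (fun y => ((b y k : ℝ) : ℂ)) := Complex.ofRealCLM.contDiff.comp hb
  have h1 : ContDiff ℝ ∞ (fun y => Complex.I * ((b y k : ℝ) : ℂ)) := contDiff_const.mul hbc
  unfold covD
  rw [pd_add (contDiff_pd hf k) (h1.mul hf), pd_mul h1 hf, pd_mul contDiff_const hbc, pd_ofReal hb]
  have h0 : pd k (fun _ : Rn n => Complex.I) x = 0 := by simp [pd]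
  rw [h0]
  linear_combination ((b x k : ℂ)) ^ 2 * f x * Complex.I_mul_I

/-- The quantity controlling the connection field. -/
noncomputable def potA (v : Rn n → Cn n) : Rn n → ℝ≥0∞ := riesz (1 / 8) fun y => ‖v y‖ₑ ^ 2

/-- The quantity controlling the time component of the connection. -/
noncomputable def potB (v : Rn n → Cn n) : Rn n → ℝ≥0∞ :=
  riesz (1 / 8) fun y => (‖grad v y‖ₑ + potA v y * ‖v y‖ₑ) * ‖v y‖ₑ

/-- The quantity controlling the nonlinearity. -/
noncomputable def nlin (v : Rn n → Cn n) (y : Rn n) : ℝ≥0∞ :=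
  potA v y * ‖grad v y‖ₑ + potA v y ^ 2 * ‖v y‖ₑ + ‖v y‖ₑ ^ 3 + potB v y * ‖v y‖ₑ

lemma enorm_coord_le (v : Rn n → Cn n) (y : Rn n) (l : Fin n) : ‖v y l‖ₑ ≤ ‖v y‖ₑ := by
  rw [← ofReal_norm, ← ofReal_norm]
  exact ENNReal.ofReal_le_ofReal (PiLp.norm_apply_le (v y) l)

lemma enorm_pd_le_grad (v : Rn n → Cn n) (y : Rn n) (k l : Fin n) :
    ‖pd k (fun x => v x l) y‖ₑ ≤ ‖grad v y‖ₑ := by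
  rw [← ofReal_norm, ← ofReal_norm]
  exact ENNReal.ofReal_le_ofReal (PiLp.norm_apply_le (grad v y) (k, l))

lemma continuous_grad {v : Rn n → Cn n} (hv : ∀ l, ContDiff ℝ ∞ (fun x => v x l)) :
    Continuous (grad v) := by
  unfold grad
  refine (PiLp.continuous_toLp 2 _).comp (continuous_pi fun p => ?_)
  exact (contDiff_pd (hv p.2) p.1).continuous

lemma measurable_potA {v : Rn n → Cn n} (hv : Continuous v) : Measurable (potA v) :=
  measurable_riesz _ (hv.measurable.enorm.pow_const 2)

lemma enorm_im_mul_conj_le (x y : ℂ) : ‖(((x * conj y).im : ℝ) : ℂ)‖ₑ ≤ ‖x‖ₑ * ‖y‖ₑ := by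
  rw [← ofReal_norm, ← ofReal_norm, ← ofReal_norm, ← ENNReal.ofReal_mul (norm_nonneg _)]
  refine ENNReal.ofReal_le_ofReal ?_
  rw [Complex.norm_real]
  refine (Complex.abs_im_le_norm _).trans ?_
  rw [norm_mul, RCLike.norm_conj]

lemma heatD2_symm (w : ℂ) (k l : Fin n) : heatD2 (n := n) w k l = heatD2 w l k := by
  funext t x
  unfold heatD2
  simp only [eq_comm (a := k) (b := l)]
  ring

namespace IsCoulombSolution

variable {lam T : ℝ} {u : ℝ → Rn n → Cn n} {a₀ : ℝ → Rn n → ℝ} {a : ℝ → Rn n → Rn n}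

lemma hu (hS : IsCoulombSolution n lam T u a₀ a) (l : Fin n) : ContHInfty T (fun t x => u t x l) :=
  contHInfty_coord hS.u_mem l

lemma ha (hS : IsCoulombSolution n lam T u a₀ a) (l : Fin n) :
    ContHInfty T (fun t x => ((a t x l : ℝ) : ℂ)) :=
  contHInfty_ofReal (contHInfty_real_coord hS.a_mem l)

lemma ha₀ (hS : IsCoulombSolution n lam T u a₀ a) : ContHInfty T (fun t x => ((a₀ t x : ℝ) : ℂ)) :=
  contHInfty_ofReal hS.a₀_mem

lemma pd_a (hS : IsCoulombSolution n lam T u a₀ a) {t : ℝ} (ht : t ∈ Set.Icc 0 T) (k l : Fin n)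
    (x : Rn n) : pd k (fun y => ((a t y l : ℝ) : ℂ)) x = ((pd k (fun y => a t y l) x : ℝ) : ℂ) :=
  pd_ofReal ((contHInfty_real_coord hS.a_mem l).1 t ht).1 k x

lemma sum_pd_a (hS : IsCoulombSolution n lam T u a₀ a) {t : ℝ} (ht : t ∈ Set.Icc 0 T) (x : Rn n) :
    ∑ k, pd k (fun y => ((a t y k : ℝ) : ℂ)) x = 0 := by
  simp_rw [hS.pd_a ht]
  rw [← Complex.ofReal_sum, hS.coulomb t ht x, Complex.ofReal_zero]

lemma sum_cv_pd_a (hS : IsCoulombSolution n lam T u a₀ a) {z : ℂ} {c κ : ℝ} {K : ℝ → Rn n → ℂ}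
    {D D2 : Fin n → ℝ → Rn n → ℂ} (H : IsHeatKernel z c κ K D D2) (hc : 0 < c) {s : ℝ} (hs : 0 < s)
    {t : ℝ} (ht : t ∈ Set.Icc 0 T) (x : Rn n) :
    ∑ k, cv (K s) (pd k fun y => ((a t y k : ℝ) : ℂ)) x = 0 := by
  unfold cv
  rw [← integral_finsetSum]
  · simp_rw [← Finset.mul_sum, hS.sum_pd_a ht]; simp
  · intro k _
    have h := ((hS.ha k).1 t ht).pd k
    exact H.integrable hc hs h.1.continuous.aestronglyMeasurable h.gi x

/-- Since `div a = 0`, the Laplacian of `a_l` is the divergence over `k` of the curvatures `∂_k a_l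
- ∂_l a_k = Im(u_k ū_l)`, which are bounded by `|u|²`. -/
lemma enorm_a_le (hn : 0 < n) : ∃ C : ℝ≥0, ∀ {lam T : ℝ} {u : ℝ → Rn n → Cn n}
    {a₀ : ℝ → Rn n → ℝ} {a : ℝ → Rn n → Rn n}, IsCoulombSolution n lam T u a₀ a →
    ∀ t ∈ Set.Icc 0 T, ∀ x l, ‖((a t x l : ℝ) : ℂ)‖ₑ ≤ C * potA (u t) x := by
  obtain ⟨C, h⟩ := enorm_le_riesz (n := n) hn
  have hw : 0 < (1 / 4 : ℂ).re := by norm_num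
  have hc : 0 < (1 / 4 : ℂ).re / 2 := by norm_num
  refine ⟨C * n, fun {lam T u a₀ a} hS t ht x l => ?_⟩
  have hH := fun k => (hS.ha k).1 t ht
  set q : Fin n → Rn n → ℂ := fun k y => pd k (fun y => ((a t y l : ℝ) : ℂ)) y
    - pd l (fun y => ((a t y k : ℝ) : ℂ)) y with hq
  have hqe : ∀ k y, q k y = (((u t y k * conj (u t y l)).im : ℝ) : ℂ) := by
    intro k y
    simp only [hq, hS.pd_a ht]
    rw [← Complex.ofReal_sub, hS.curvature_space t ht y k l]
  have key := h _ (hH l) q (fun k => (((hH l).pd k).sub ((hH k).pd l)).1.continuous) x ?_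
  · refine key.trans ?_
    push_cast
    rw [mul_assoc]
    gcongr
    refine (Finset.sum_le_sum (g := fun _ => potA (u t) x) fun k _ => ?_).trans (by simp)
    refine riesz_mono _ (fun y => ?_) x
    rw [hqe, sq]
    refine (enorm_im_mul_conj_le _ _).trans ?_
    gcongr <;> exact enorm_coord_le _ _ _
  · intro s hs
    have Hk := fun k => isHeatKernel_heatD (n := n) hw k
    -- By symmetry of the second derivatives of the kernel, `∂_k K * ∂_l a_k = ∂_l K * ∂_k a_k`, and
    -- the sum over `k` contains `div a = 0`.
    have e1 : ∑ k, cv (heatD (1 / 4) k s) (pd l fun y => ((a t y k : ℝ) : ℂ)) x = 0 := by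
      rw [← hS.sum_cv_pd_a (Hk l) hc hs ht x]
      refine Finset.sum_congr rfl fun k _ => ?_
      rw [← (Hk k).cv_pd hc hs (hH k), ← (Hk l).cv_pd hc hs (hH k), heatD2_symm]
    have e2 : ∀ k, cv (heatD (1 / 4) k s) (q k) x =
        cv (heatD (1 / 4) k s) (pd k fun y => ((a t y l : ℝ) : ℂ)) x -
        cv (heatD (1 / 4) k s) (pd l fun y => ((a t y k : ℝ) : ℂ)) x := fun k =>
      (Hk k).cv_sub hc hs ((hH l).pd k) ((hH k).pd l) x
    simp_rw [e2]
    rw [Finset.sum_sub_distrib, e1, sub_zero]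

lemma bddCont_timeComp (hn : 0 < n) (hS : IsCoulombSolution n lam T u a₀ a) :
    BddCont T (fun t x => timeComp lam (a t) (u t) x) := by
  unfold timeComp covD
  refine (BddCont.const _).mul (BddCont.sum _ fun k => ?_)
  exact (BddCont.of_contHInfty hn ((hS.hu k).pd k)).add
    (((BddCont.const _).mul (BddCont.of_contHInfty hn (hS.ha k))).mul
      (BddCont.of_contHInfty hn (hS.hu k)))

lemma enorm_timeComp_le (hn : 0 < n) (lam : ℝ) : ∃ C : ℝ≥0, ∀ {T : ℝ} {u : ℝ → Rn n → Cn n}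
    {a₀ : ℝ → Rn n → ℝ} {a : ℝ → Rn n → Rn n}, IsCoulombSolution n lam T u a₀ a →
    ∀ t ∈ Set.Icc 0 T, ∀ x, ‖timeComp lam (a t) (u t) x‖ₑ ≤
      C * (‖grad (u t) x‖ₑ + potA (u t) x * ‖u t x‖ₑ) := by
  obtain ⟨C, hC⟩ := enorm_a_le (n := n) hn
  refine ⟨‖(lam : ℂ) - Complex.I‖₊ * (n * (C + 1)), fun {T u a₀ a} hS t ht x => ?_⟩
  unfold timeComp
  rw [enorm_mul]
  push_cast
  rw [mul_assoc, enorm_eq_nnnorm]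
  gcongr
  refine (enorm_sum_le _ _).trans ?_
  refine (Finset.sum_le_sum (g := fun _ => ((C:ℝ≥0∞) + 1) * (‖grad (u t) x‖ₑ +
    potA (u t) x * ‖u t x‖ₑ)) fun k _ => ?_).trans (by simp [mul_assoc])
  unfold covD
  refine (enorm_add_le _ _).trans ?_
  rw [enorm_mul, enorm_mul]
  have hI : ‖Complex.I‖ₑ = 1 := by rw [← ofReal_norm]; simp
  rw [hI, one_mul]
  calc ‖pd k (fun y => u t y k) x‖ₑ + ‖((a t x k : ℝ) : ℂ)‖ₑ * ‖u t x k‖ₑ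
      ≤ ‖grad (u t) x‖ₑ + C * potA (u t) x * ‖u t x‖ₑ := by
        gcongr
        · exact enorm_pd_le_grad _ _ _ _
        · exact hC hS t ht x k
        · exact enorm_coord_le _ _ _
    _ ≤ (C + 1) * ‖grad (u t) x‖ₑ + (C + 1) * (potA (u t) x * ‖u t x‖ₑ) := by
        rw [mul_assoc]
        gcongr
        · exact le_mul_of_one_le_left zero_le (by simp)
        · simp
    _ = _ := by rw [mul_add]

lemma continuous_u (hS : IsCoulombSolution n lam T u a₀ a) {t : ℝ} (ht : t ∈ Set.Icc 0 T) :
    Continuous (u t) := (hS.u_mem.1 t ht).1.continuous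

lemma continuous_grad_u (hS : IsCoulombSolution n lam T u a₀ a) {t : ℝ} (ht : t ∈ Set.Icc 0 T) :
    Continuous (grad (u t)) := continuous_grad fun l => ((hS.hu l).1 t ht).1

/-- The gauge condition, tested as `∑ ∂_k K_s * a_k = 0` at every time, is differentiated in time
with the kernel time `s` fixed, and `∂_t a_k` is replaced by means of the curvature identity.
Testing on the kernel avoids exchanging time and space derivatives of `a`. -/
lemma sum_cv_dt_a (hn : 0 < n) (hS : IsCoulombSolution n lam T u a₀ a) {t : ℝ}
    (ht : t ∈ Set.Ioo 0 T) {s : ℝ} (hs : 0 < s) (x : Rn n) :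
    ∑ k, cv (heatD (1 / 4) k s) (fun y => pd k (fun y => ((a₀ t y : ℝ) : ℂ)) y +
      (((timeComp lam (a t) (u t) y * conj (u t y k)).im : ℝ) : ℂ)) x = 0 := by
  have hw : 0 < (1 / 4 : ℂ).re := by norm_num
  have hc : 0 < (1 / 4 : ℂ).re / 2 := by norm_num
  have H := isHeatKernel_heatK (n := n) hw
  have Hk := fun k => isHeatKernel_heatD (n := n) hw k
  have hIcc : ∀ r ∈ Set.Ioo 0 T, r ∈ Set.Icc 0 T := fun r hr => ⟨hr.1.le, hr.2.le⟩
  set d : Fin n → ℝ → Rn n → ℂ := fun k t y => pd k (fun y => ((a₀ t y : ℝ) : ℂ)) y +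
      (((timeComp lam (a t) (u t) y * conj (u t y k)).im : ℝ) : ℂ) with hd
  have hdB : ∀ k, BddCont T (d k) := fun k =>
    (BddCont.of_contHInfty hn (hS.ha₀.pd k)).add
      ((hS.bddCont_timeComp hn).im_mul_conj (BddCont.of_contHInfty hn (hS.hu k)))
  have hder : ∀ k, HasDerivAt (fun r => cv (heatD (1 / 4) k s) (fun y => ((a r y k : ℝ) : ℂ)) x)
      (cv (heatD (1 / 4) k s) (d k t) x) t := by
    intro k
    obtain ⟨hdc, B, hB⟩ := hdB k
    obtain ⟨B', hB'0, hB'⟩ := (hS.ha k).bounded hn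
    have h := (Hk k).hasDerivAt_cv hc zero_le_one (α := s) (β := 0) (s₀ := t) (by simpa using hs)
      (v := fun r y => ((a r y k : ℝ) : ℂ)) (v' := d k) (U := Set.Ioo 0 T)
      (Ioo_mem_nhds ht.1 ht.2) (fun r hr => ((hS.ha k).1 r (hIcc r hr)).1.continuous)
      (hdc t (hIcc t ht)) (V := fun _ => |B| + B')
      (GI.of_bounded aestronglyMeasurable_const (C := ‖|B| + B'‖) (fun _ => le_rfl))
      (fun r hr y => (hB' r (hIcc r hr) y).trans (by linarith [abs_nonneg B]))
      (fun r hr y => (hB r (hIcc r hr) y).trans (by linarith [le_abs_self B]))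
      (fun r hr y => by
        have h1 := (hS.curvature_time r hr y k).ofReal_comp
        refine h1.congr_deriv ?_
        simp only [hd]
        rw [pd_ofReal (hS.a₀_mem.1 r (hIcc r hr)).1]
        push_cast; rfl) x
    simpa using h
  have hsum := HasDerivAt.fun_sum (u := Finset.univ) fun k _ => hder k
  have hzero : (fun r => ∑ k, cv (heatD (1 / 4) k s) (fun y => ((a r y k : ℝ) : ℂ)) x) =ᶠ[𝓝 t]
      fun _ => 0 := by
    filter_upwards [Ioo_mem_nhds ht.1 ht.2] with r hr
    rw [← hS.sum_cv_pd_a H hc hs (hIcc r hr) x]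
    refine Finset.sum_congr rfl fun k _ => ?_
    rw [H.cv_pd hc hs ((hS.ha k).1 r (hIcc r hr))]
  exact (hsum.congr_of_eventuallyEq hzero.symm).unique (hasDerivAt_const t 0)

/-- The differentiated gauge condition says that `Δa₀ = -∑ ∂_k Im(u₀ ū_k)`, and `u₀` is bounded by
`|∇u| + I₁(|u|²)|u|`. Only interior times are possible, where the curvature identity in time holds.
-/
lemma enorm_a₀_le (hn : 0 < n) (lam : ℝ) : ∃ C : ℝ≥0, ∀ {T : ℝ} {u : ℝ → Rn n → Cn n}
    {a₀ : ℝ → Rn n → ℝ} {a : ℝ → Rn n → Rn n}, IsCoulombSolution n lam T u a₀ a →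
    ∀ t ∈ Set.Ioo 0 T, ∀ x, ‖((a₀ t x : ℝ) : ℂ)‖ₑ ≤ C * potB (u t) x := by
  obtain ⟨C, h⟩ := enorm_le_riesz (n := n) hn
  obtain ⟨C', h'⟩ := enorm_timeComp_le (n := n) hn lam
  have hw : 0 < (1 / 4 : ℂ).re := by norm_num
  have hc : 0 < (1 / 4 : ℂ).re / 2 := by norm_num
  refine ⟨C * (n * C'), fun {T u a₀ a} hS t ht x => ?_⟩
  have ht' : t ∈ Set.Icc 0 T := ⟨ht.1.le, ht.2.le⟩
  set m : Fin n → ℝ → Rn n → ℂ := fun k t y =>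
    (((timeComp lam (a t) (u t) y * conj (u t y k)).im : ℝ) : ℂ) with hm
  have hmB : ∀ k, BddCont T (m k) := fun k =>
    (hS.bddCont_timeComp hn).im_mul_conj (BddCont.of_contHInfty hn (hS.hu k))
  have hmeas : Measurable fun y => (‖grad (u t) y‖ₑ + potA (u t) y * ‖u t y‖ₑ) * ‖u t y‖ₑ := by
    have h1 := measurable_potA (hS.continuous_u ht')
    have h2 := (hS.continuous_u ht').measurable.enorm
    have h3 := (hS.continuous_grad_u ht').measurable.enorm
    fun_prop
  have key := h _ (hS.ha₀.1 t ht') (fun k y => -m k t y) (fun k => ((hmB k).1 t ht').neg) x ?_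
  · refine key.trans ?_
    push_cast
    rw [mul_assoc, mul_assoc]
    gcongr
    refine (Finset.sum_le_sum (g := fun _ => C' * potB (u t) x) fun k _ => ?_).trans (by simp)
    rw [potB, ← riesz_const_mul _ hmeas]
    refine riesz_mono _ (fun y => ?_) x
    rw [enorm_neg, ← mul_assoc]
    refine (enorm_im_mul_conj_le _ _).trans ?_
    gcongr
    · exact h' hS t ht' y
    · exact enorm_coord_le _ _ _
  · intro s hs
    have Hk := fun k => isHeatKernel_heatD (n := n) hw k
    have e0 := hS.sum_cv_dt_a hn ht hs x
    have hi1 : ∀ k, Integrable fun y => heatD (1 / 4) k s (x - y) *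
        pd k (fun y => ((a₀ t y : ℝ) : ℂ)) y := fun k =>
      (Hk k).integrable hc hs ((hS.ha₀.1 t ht').pd k).1.continuous.aestronglyMeasurable
        ((hS.ha₀.1 t ht').pd k).gi x
    have hi2 : ∀ k, Integrable fun y => heatD (1 / 4) k s (x - y) * m k t y := fun k =>
      (Hk k).integrable hc hs ((hmB k).1 t ht').aestronglyMeasurable ((hmB k).gi ht') x
    have e1 : ∀ k, cv (heatD (1 / 4) k s) (fun y => pd k (fun y => ((a₀ t y : ℝ) : ℂ)) y + m k t y) x
        = cv (heatD (1 / 4) k s) (pd k fun y => ((a₀ t y : ℝ) : ℂ)) x -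
          cv (heatD (1 / 4) k s) (fun y => -m k t y) x := by
      intro k
      unfold cv
      simp_rw [mul_add, mul_neg]
      rw [integral_add (hi1 k) (hi2 k), integral_neg]
      ring
    have e2 : ∑ k, cv (heatD (1 / 4) k s)
        (fun y => pd k (fun y => ((a₀ t y : ℝ) : ℂ)) y + m k t y) x = 0 := e0
    simp_rw [e1] at e2
    rw [Finset.sum_sub_distrib] at e2
    exact sub_eq_zero.1 e2

/-- The nonlinear part of the equation for `u_l`. -/
noncomputable def nonlin (lam : ℝ) (u : ℝ → Rn n → Cn n) (a₀ : ℝ → Rn n → ℝ) (a : ℝ → Rn n → Rn n)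
    (l : Fin n) (t : ℝ) (x : Rn n) : ℂ :=
  -(Complex.I * (a₀ t x : ℂ) * u t x l) + ((lam : ℂ) - Complex.I) *
    ∑ k, (2 * (Complex.I * (a t x k : ℂ) * pd k (fun y => u t y l) x)
      - (a t x k : ℂ) * (a t x k : ℂ) * u t x l
      + Complex.I * (((u t x l * conj (u t x k)).im : ℝ) : ℂ) * u t x k)

lemma bddCont_nonlin (hn : 0 < n) (hS : IsCoulombSolution n lam T u a₀ a) (l : Fin n) :
    BddCont T (nonlin lam u a₀ a l) := by
  have hu := fun l => BddCont.of_contHInfty hn (hS.hu l)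
  have ha := fun l => BddCont.of_contHInfty hn (hS.ha l)
  have ha₀ := BddCont.of_contHInfty hn hS.ha₀
  unfold nonlin
  refine (((BddCont.const _).mul ha₀).mul (hu l)).neg.add ((BddCont.const _).mul
    (BddCont.sum _ fun k => ?_))
  refine (((BddCont.const _).mul (((BddCont.const _).mul (ha k)).mul
    (BddCont.of_contHInfty hn ((hS.hu l).pd k)))).sub (((ha k).mul (ha k)).mul (hu l))).add ?_
  exact ((BddCont.const _).mul ((hu l).im_mul_conj (hu k))).mul (hu k)

/-- In `∑ D_k D_k u_l` the terms `i (∂_k a_k) u_l` add up to zero by the gauge condition, and the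
curvature identity turns `R_{lk} u_k` into a cubic term without derivatives. -/
lemma hasDerivAt_u (hS : IsCoulombSolution n lam T u a₀ a) (l : Fin n) {t : ℝ}
    (ht : t ∈ Set.Ioo 0 T) (x : Rn n) :
    HasDerivAt (fun s => u s x l) (((lam : ℂ) - Complex.I) * ∑ k, pd k (pd k fun y => u t y l) x +
      nonlin lam u a₀ a l t x) t := by
  have ht' : t ∈ Set.Icc 0 T := ⟨ht.1.le, ht.2.le⟩
  refine (hS.ginzburg_landau t ht x l).congr_deriv ?_
  have e1 : ∀ k, covD (a t) k (covD (a t) k (fun y => u t y l)) x + curv (a t) l k x * u t x k =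
      pd k (pd k fun y => u t y l) x + ((2 * (Complex.I * (a t x k : ℂ) * pd k (fun y => u t y l) x)
      - (a t x k : ℂ) * (a t x k : ℂ) * u t x l
      + Complex.I * (((u t x l * conj (u t x k)).im : ℝ) : ℂ) * u t x k)
      + ((pd k (fun y => a t y k) x : ℝ) : ℂ) * (Complex.I * u t x l)) := by
    intro k
    rw [covD_covD k ((contHInfty_real_coord hS.a_mem k).1 t ht').1 ((hS.hu l).1 t ht').1, curv,
      hS.curvature_space t ht' x l k]
    ring
  simp_rw [e1]
  rw [Finset.sum_add_distrib, Finset.sum_add_distrib, ← Finset.sum_mul, ← Complex.ofReal_sum,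
    hS.coulomb t ht' x, nonlin]
  push_cast
  ring

lemma enorm_nonlin_le (hn : 0 < n) (lam : ℝ) : ∃ C : ℝ≥0, ∀ {T : ℝ} {u : ℝ → Rn n → Cn n}
    {a₀ : ℝ → Rn n → ℝ} {a : ℝ → Rn n → Rn n}, IsCoulombSolution n lam T u a₀ a →
    ∀ t ∈ Set.Ioo 0 T, ∀ x l, ‖nonlin lam u a₀ a l t x‖ₑ ≤ C * nlin (u t) x := by
  obtain ⟨C, hC⟩ := enorm_a_le (n := n) hn
  obtain ⟨C', hC'⟩ := enorm_a₀_le (n := n) hn lam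
  set z : ℝ≥0 := ‖(lam : ℂ) - Complex.I‖₊ with hz
  refine ⟨C' + z * (n * (2 * C + C * C + 1)), fun {T u a₀ a} hS t ht x l => ?_⟩
  have ht' : t ∈ Set.Icc 0 T := ⟨ht.1.le, ht.2.le⟩
  have hI : ‖Complex.I‖ₑ = 1 := by rw [← ofReal_norm]; simp
  have h2 : ‖(2:ℂ)‖ₑ = 2 := by rw [← ofReal_norm]; simp
  set A := potA (u t) x with hA
  set V := ‖grad (u t) x‖ₑ with hV
  set U := ‖u t x‖ₑ with hU
  set B := potB (u t) x with hB
  have hterm : ∀ k, ‖2 * (Complex.I * (a t x k : ℂ) * pd k (fun y => u t y l) x)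
      - (a t x k : ℂ) * (a t x k : ℂ) * u t x l
      + Complex.I * (((u t x l * conj (u t x k)).im : ℝ) : ℂ) * u t x k‖ₑ ≤
      (2 * C + C * C + 1) * nlin (u t) x := by
    intro k
    have p1 : ‖2 * (Complex.I * (a t x k : ℂ) * pd k (fun y => u t y l) x)‖ₑ ≤ 2 * C * (A * V) := by
      rw [enorm_mul, enorm_mul, enorm_mul, hI, h2, one_mul, mul_assoc, ← mul_assoc (C : ℝ≥0∞)]
      gcongr
      · exact hC hS t ht' x k
      · exact enorm_pd_le_grad _ _ _ _
    have p2 : ‖(a t x k : ℂ) * (a t x k : ℂ) * u t x l‖ₑ ≤ C * C * (A ^ 2 * U) := by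
      rw [enorm_mul, enorm_mul]
      calc _ ≤ (C * A) * (C * A) * U := by
            gcongr
            · exact hC hS t ht' x k
            · exact hC hS t ht' x k
            · exact enorm_coord_le _ _ _
        _ = _ := by ring
    have p3 : ‖Complex.I * (((u t x l * conj (u t x k)).im : ℝ) : ℂ) * u t x k‖ₑ ≤ 1 * U ^ 3 := by
      rw [enorm_mul, enorm_mul, hI, one_mul]
      calc _ ≤ (U * U) * U := by
            gcongr
            · refine (enorm_im_mul_conj_le _ _).trans ?_
              gcongr <;> exact enorm_coord_le _ _ _
            · exact enorm_coord_le _ _ _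
        _ = _ := by ring
    refine (enorm_add_le _ _).trans ((add_le_add (enorm_sub_le.trans (add_le_add p1 p2)) p3).trans ?_)
    rw [add_mul, add_mul]
    unfold nlin
    gcongr
    · exact (le_add_right (le_add_right le_self_add))
    · exact (le_add_right (le_add_right le_add_self))
    · exact (le_add_right le_add_self)
  unfold nonlin
  refine (enorm_add_le _ _).trans ?_
  push_cast
  rw [add_mul, enorm_neg, enorm_mul, enorm_mul, enorm_mul, hI, one_mul]
  gcongr ?_ + ?_
  · calc _ ≤ (C' * B) * U := by
          gcongr
          · exact hC' hS t ht x
          · exact enorm_coord_le _ _ _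
      _ = C' * (B * U) := by ring
      _ ≤ _ := by unfold nlin; gcongr; exact le_add_self
  · rw [mul_assoc, enorm_eq_nnnorm]
    gcongr
    refine (enorm_sum_le _ _).trans ((Finset.sum_le_sum fun k _ => hterm k).trans ?_)
    simp [mul_assoc]

end IsCoulombSolution

/-! ### Multilinear estimates in the scale `L^{n/b}`. -/

lemma riesz_congr_ae (c : ℝ) {f g : Rn n → ℝ≥0∞} (h : f =ᵐ[volume] g) : riesz c f = riesz c g := by
  funext x
  unfold riesz gconv
  refine lintegral_congr fun s => ?_
  rw [lintegral_congr_ae (h.mono fun y hy => by rw [hy])]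

/-- The Hardy-Littlewood-Sobolev inequality for the potential of order one. -/
lemma nr_riesz_le (hn : 0 < n) {b : ℝ} (hb1 : 1 < b) (hbn : b < n) {c : ℝ} (hc : 0 < c) :
    ∃ C : ℝ≥0, ∀ f : Rn n → ℝ≥0∞, Measurable f → nr (b - 1) (riesz c f) ≤ C * nr b f := by
  obtain ⟨C, hC⟩ := nr_riesz_le_of_ne_top hn hb1 hbn hc
  have hn' : (0:ℝ) < n := by exact_mod_cast hn
  have hb : 0 < b := by linarith
  refine ⟨C + 1, fun f hf => ?_⟩
  by_cases hft : nr b f = ⊤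
  · rw [hft, ENNReal.mul_top (by simp)]; exact le_top
  have hfin : ∀ᵐ x, f x ≠ ⊤ := by
    have h1 : ∫⁻ x, f x ^ ((n:ℝ) / b) ≠ ⊤ := by
      rw [← nr_rpow hn hb]
      exact ENNReal.rpow_ne_top_of_nonneg (by positivity) hft
    filter_upwards [ae_lt_top (by fun_prop) h1] with x hx hx'
    rw [hx', ENNReal.top_rpow_of_pos (by positivity)] at hx
    exact lt_irrefl _ hx
  set g : Rn n → ℝ≥0∞ := fun x => ((f x).toNNReal : ℝ≥0∞) with hg
  have hfg : f =ᵐ[volume] g := hfin.mono fun x hx => (ENNReal.coe_toNNReal hx).symm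
  rw [riesz_congr_ae c hfg, nr_congr_ae hfg]
  refine (hC g (by fun_prop) (fun x => by simp [hg])).trans ?_
  gcongr
  simp

/-- The part of `nlin` of order three involving one derivative. -/
noncomputable def nlinGrad (v : Rn n → Cn n) (y : Rn n) : ℝ≥0∞ :=
  potA v y * ‖grad v y‖ₑ + riesz (1 / 8) (fun y => ‖grad v y‖ₑ * ‖v y‖ₑ) y * ‖v y‖ₑ

/-- The part of `nlin` of order five. -/
noncomputable def nlinQuintic (v : Rn n → Cn n) (y : Rn n) : ℝ≥0∞ :=
  potA v y * potA v y * ‖v y‖ₑ +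
    riesz (1 / 8) (fun y => potA v y * ‖v y‖ₑ * ‖v y‖ₑ) y * ‖v y‖ₑ

/-- The term `potB` mixes two homogeneities; separating them is necessary because the three pieces
lie in different Lebesgue spaces and carry different time weights. -/
lemma nlin_eq {v : Rn n → Cn n} (hv : Measurable fun y => ‖v y‖ₑ)
    (hg : Measurable fun y => ‖grad v y‖ₑ) (y : Rn n) :
    nlin v y = nlinGrad v y + ‖v y‖ₑ ^ 3 + nlinQuintic v y := by
  unfold nlin nlinGrad nlinQuintic potB
  simp_rw [add_mul]
  rw [riesz_add _ (f := fun y => ‖grad v y‖ₑ * ‖v y‖ₑ) (hg.mul hv)]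
  ring

/-- The square `|v|²` has index `2δ`, which exceeds `1` and is below `n`, so the potential lowers it
to `2δ - 1`. -/
lemma nr_potA_le (hn : 3 ≤ n) {δ : ℝ} (hδ : δ ∈ Set.Ioo (3 / 5 : ℝ) (2 / 3)) :
    ∃ C : ℝ≥0, ∀ v : Rn n → Cn n, (Measurable fun y => ‖v y‖ₑ) →
      nr (2 * δ - 1) (potA v) ≤ C * nr δ (fun y => ‖v y‖ₑ) ^ 2 := by
  obtain ⟨h1, h2⟩ := hδ
  have hn0 : 0 < n := by omega
  have hn' : (3:ℝ) ≤ n := by exact_mod_cast hn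
  obtain ⟨C, hC⟩ := nr_riesz_le (n := n) hn0 (b := 2 * δ) (by linarith) (by linarith)
    (c := 1 / 8) (by norm_num)
  refine ⟨C, fun v hv => (hC _ (hv.pow_const 2)).trans ?_⟩
  gcongr
  have := nr_mul hn0 (a := δ) (b := δ) (by linarith) (by linarith) hv hv
  simpa [two_mul, sq] using this

/-- Both terms have index `2δ`: the first as `(2δ - 1) + 1`, the second because the potential lowers
`1 + δ` to `δ` before the last factor adds `δ`. -/
lemma nr_nlinGrad_le (hn : 3 ≤ n) {δ : ℝ} (hδ : δ ∈ Set.Ioo (3 / 5 : ℝ) (2 / 3)) :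
    ∃ C : ℝ≥0, ∀ v : Rn n → Cn n, (Measurable fun y => ‖v y‖ₑ) →
      (Measurable fun y => ‖grad v y‖ₑ) →
      nr (2 * δ) (nlinGrad v) ≤
        C * (nr δ (fun y => ‖v y‖ₑ) ^ 2 * nr 1 (fun y => ‖grad v y‖ₑ)) := by
  obtain ⟨C, hC⟩ := nr_potA_le hn hδ
  obtain ⟨h1, h2⟩ := hδ
  have hn0 : 0 < n := by omega
  have hn' : (3:ℝ) ≤ n := by exact_mod_cast hn
  obtain ⟨C', hC'⟩ := nr_riesz_le (n := n) hn0 (b := 1 + δ) (by linarith) (by linarith)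
    (c := 1 / 8) (by norm_num)
  refine ⟨C + C', fun v hv hg => ?_⟩
  set U := fun y => ‖v y‖ₑ
  set V := fun y => ‖grad v y‖ₑ
  have hA : Measurable (potA v) := measurable_riesz _ (hv.pow_const 2)
  have hR : Measurable (riesz (1 / 8) (fun y => V y * U y)) := measurable_riesz _ (hg.mul hv)
  have e1 : nr (2 * δ) (fun y => potA v y * V y) ≤ C * (nr δ U ^ 2 * nr 1 V) := by
    have := nr_mul hn0 (a := 2 * δ - 1) (b := 1) (by linarith) (by linarith) hA hg
    rw [sub_add_cancel] at this
    refine this.trans ?_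
    rw [← mul_assoc]
    gcongr
    exact hC v hv
  have e2 : nr (2 * δ) (fun y => riesz (1 / 8) (fun y => V y * U y) y * U y) ≤
      C' * (nr δ U ^ 2 * nr 1 V) := by
    have := nr_mul hn0 (a := δ) (b := δ) (by linarith) (by linarith) hR hv
    rw [← two_mul] at this
    refine this.trans ?_
    calc nr δ (riesz (1 / 8) fun y => V y * U y) * nr δ U
        ≤ (C' * (nr 1 V * nr δ U)) * nr δ U := by
          gcongr
          have h := hC' _ (hg.mul hv)
          rw [add_sub_cancel_left] at h
          refine h.trans ?_
          gcongr
          exact nr_mul hn0 (by linarith) (by linarith) hg hv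
      _ = _ := by ring
  refine (nr_add (by linarith) (by linarith) (hA.mul hg) (hR.mul hv)).trans ?_
  push_cast
  rw [add_mul]
  exact add_le_add e1 e2

lemma nr_cube_le (hn : 3 ≤ n) {δ : ℝ} (hδ : δ ∈ Set.Ioo (3 / 5 : ℝ) (2 / 3)) {v : Rn n → Cn n}
    (hv : Measurable fun y => ‖v y‖ₑ) :
    nr (3 * δ) (fun y => ‖v y‖ₑ ^ 3) ≤ nr δ (fun y => ‖v y‖ₑ) ^ 3 := by
  obtain ⟨h1, h2⟩ := hδ
  have hn0 : 0 < n := by omega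
  have e1 := nr_mul hn0 (a := δ) (b := δ) (by linarith) (by linarith) hv hv
  have e2 := nr_mul hn0 (a := δ + δ) (b := δ) (by linarith) (by linarith) (hv.mul hv) hv
  have e3 : 3 * δ = δ + δ + δ := by ring
  simp_rw [e3, pow_succ, pow_zero, one_mul]
  refine e2.trans ?_
  gcongr
  exact e1

/-- The first term has index `(2δ - 1) + (2δ - 1) + δ`. In the second, the density has index `(2δ -
1) + δ + δ = 4δ - 1`, which the potential lowers to `4δ - 2` before the last factor adds `δ`. Both
give `5δ - 2`. -/
lemma nr_nlinQuintic_le (hn : 3 ≤ n) {δ : ℝ} (hδ : δ ∈ Set.Ioo (3 / 5 : ℝ) (2 / 3)) :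
    ∃ C : ℝ≥0, ∀ v : Rn n → Cn n, (Measurable fun y => ‖v y‖ₑ) →
      nr (5 * δ - 2) (nlinQuintic v) ≤ C * nr δ (fun y => ‖v y‖ₑ) ^ 5 := by
  obtain ⟨C, hC⟩ := nr_potA_le hn hδ
  obtain ⟨h1, h2⟩ := hδ
  have hn0 : 0 < n := by omega
  have hn' : (3:ℝ) ≤ n := by exact_mod_cast hn
  obtain ⟨C', hC'⟩ := nr_riesz_le (n := n) hn0 (b := 4 * δ - 1) (by linarith) (by linarith)
    (c := 1 / 8) (by norm_num)
  refine ⟨C * C + C' * C, fun v hv => ?_⟩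
  set U := fun y => ‖v y‖ₑ
  have hA : Measurable (potA v) := measurable_riesz _ (hv.pow_const 2)
  have hR : Measurable (riesz (1 / 8) (fun y => potA v y * U y * U y)) :=
    measurable_riesz _ ((hA.mul hv).mul hv)
  have e1 : nr (5 * δ - 2) (fun y => potA v y * potA v y * U y) ≤ C * C * nr δ U ^ 5 := by
    have g1 := nr_mul hn0 (a := 2 * δ - 1) (b := 2 * δ - 1) (by linarith) (by linarith) hA hA
    have g2 := nr_mul hn0 (a := 2 * δ - 1 + (2 * δ - 1)) (b := δ) (by linarith) (by linarith)
      (hA.mul hA) hv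
    rw [show 2 * δ - 1 + (2 * δ - 1) + δ = 5 * δ - 2 by ring] at g2
    refine g2.trans ?_
    calc _ ≤ (C * nr δ U ^ 2) * (C * nr δ U ^ 2) * nr δ U := by
          gcongr
          refine g1.trans ?_
          gcongr <;> exact hC v hv
      _ = _ := by ring
  have e2 : nr (5 * δ - 2) (fun y => riesz (1 / 8) (fun y => potA v y * U y * U y) y * U y) ≤
      C' * C * nr δ U ^ 5 := by
    have g1 := nr_mul hn0 (a := 2 * δ - 1) (b := δ) (by linarith) (by linarith) hA hv
    have g2 := nr_mul hn0 (a := 2 * δ - 1 + δ) (b := δ) (by linarith) (by linarith) (hA.mul hv) hv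
    rw [show 2 * δ - 1 + δ + δ = 4 * δ - 1 by ring] at g2
    have g3 := hC' _ ((hA.mul hv).mul hv)
    have g4 := nr_mul hn0 (a := 4 * δ - 1 - 1) (b := δ) (by linarith) (by linarith) hR hv
    rw [show 4 * δ - 1 - 1 + δ = 5 * δ - 2 by ring] at g4
    refine g4.trans ?_
    calc _ ≤ (C' * ((C * nr δ U ^ 2) * nr δ U * nr δ U)) * nr δ U := by
          gcongr
          refine g3.trans ?_
          gcongr
          refine g2.trans ?_
          gcongr
          refine g1.trans ?_
          gcongr
          exact hC v hv
      _ = _ := by ring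
  refine (nr_add (by linarith) (by linarith) ((hA.mul hA).mul hv) (hR.mul hv)).trans ?_
  push_cast
  rw [add_mul]
  exact add_le_add e1 e2

/-! ### Duhamel integrals in weighted norms. -/

/-- The Duhamel integral with a kernel of parabolic order `κ`. -/
noncomputable def duh (c κ t : ℝ) (F : ℝ → Rn n → ℝ≥0∞) (x : Rn n) : ℝ≥0∞ :=
  ∫⁻ s in Set.Ioo 0 t, pw (t - s) (-(κ / 2)) * gconv c (t - s) (F s) x

lemma measurable_duh_integrand (c κ t : ℝ) {F : ℝ → Rn n → ℝ≥0∞}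
    (hF : Measurable (Function.uncurry F)) :
    Measurable fun p : ℝ × Rn n => pw (t - p.1) (-(κ / 2)) * gconv c (t - p.1) (F p.1) p.2 :=
  ((measurable_pw _).comp (measurable_const.sub measurable_fst)).mul
    (measurable_gconv_uncurry c hF (T := fun s => t - s) (by fun_prop))

lemma measurable_duh (c κ t : ℝ) {F : ℝ → Rn n → ℝ≥0∞} (hF : Measurable (Function.uncurry F)) :
    Measurable (duh c κ t F) :=
  ((measurable_duh_integrand c κ t hF).comp measurable_swap).lintegral_prod_right'

lemma duh_add (c κ t : ℝ) {F G : ℝ → Rn n → ℝ≥0∞} (hF : Measurable (Function.uncurry F)) (x : Rn n) :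
    duh c κ t (fun s y => F s y + G s y) x = duh c κ t F x + duh c κ t G x := by
  unfold duh
  have h : Measurable fun s => pw (t - s) (-(κ / 2)) * gconv c (t - s) (F s) x :=
    (measurable_duh_integrand c κ t hF).comp measurable_prodMk_right
  rw [← lintegral_add_left h]
  refine lintegral_congr fun s => ?_
  have hFs : Measurable (F s) := hF.comp measurable_prodMk_left
  rw [← mul_add, ← gconv_add _ _ hFs]

/-- Minkowski and smoothing reduce the norm to a Beta integral, convergent at `s = 0` because `b >
1` and at `s = t` by `hlt`. The index `b` cancels in the resulting power of `t`, so pieces of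
different index obey the same final bound. -/
lemma nr_duh_le_of_ne_zero (hn : 0 < n) {b β κ : ℝ} (hβ : 0 < β) (hβb : β ≤ b) (hβn : b ≤ n)
    (hκ : 0 ≤ κ) (hb1 : 1 < b) (hb3 : b ≤ 3) (hlt : κ / 2 + (b - β) / 2 < 1) {c : ℝ} (hc : 0 < c) :
    ∃ C : ℝ≥0, ∀ t : ℝ, 0 < t → ∀ F : ℝ → Rn n → ℝ≥0∞, Measurable (Function.uncurry F) →
      ∀ M : ℝ≥0∞, M ≠ 0 → M ≠ ⊤ → (∀ s ∈ Set.Ioo 0 t, nr b (F s) ≤ M * pw s (-((3 - b) / 2))) →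
      nr β (duh c κ t F) ≤ C * M * pw t (-((1 + κ - β) / 2)) := by
  obtain ⟨C, hC⟩ := nr_gconv_le hn hβ hβb hβn hc
  obtain ⟨C', hC'⟩ := lintegral_beta_le (p := κ / 2 + (b - β) / 2) (q := (3 - b) / 2)
    (by linarith) hlt (by linarith) (by linarith)
  refine ⟨(C + 1) * C', fun t ht F hF M h0 hM h => ?_⟩
  have key := nr_lintegral_le hn hβ (hβb.trans hβn) (S := Set.Ioo 0 t) measurableSet_Ioo
    (F := fun s x => pw (t - s) (-(κ / 2)) * gconv c (t - s) (F s) x)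
    (measurable_duh_integrand c κ t hF)
    (m := fun s => ((C + 1 : ℝ≥0) * M) *
      (pw (t - s) (-(κ / 2 + (b - β) / 2)) * pw s (-((3 - b) / 2)))) (by fun_prop) ?_ ?_ ?_
  · refine key.trans ?_
    rw [lintegral_const_mul _ (by fun_prop)]
    refine (mul_le_mul_right (hC' t ht) _).trans (le_of_eq ?_)
    rw [show 1 - (κ / 2 + (b - β) / 2) - (3 - b) / 2 = -((1 + κ - β) / 2) by ring]
    push_cast; ring
  · intro s hs
    have h1 := pw_ne_zero (sub_pos.2 hs.2) (-(κ / 2 + (b - β) / 2))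
    have h2 := pw_ne_zero hs.1 (-((3 - b) / 2))
    exact mul_ne_zero (mul_ne_zero (by simp) h0) (mul_ne_zero h1 h2)
  · intro s hs
    exact ENNReal.mul_ne_top (ENNReal.mul_ne_top (by simp) hM)
      (ENNReal.mul_ne_top (pw_ne_top _ _) (pw_ne_top _ _))
  · intro s hs
    have hts := sub_pos.2 hs.2
    have hFs : Measurable (F s) := hF.comp measurable_prodMk_left
    rw [nr_const_mul hn hβ _ (measurable_gconv_right _ _ hFs), neg_add, pw_add hts]
    calc _ ≤ pw (t - s) (-(κ / 2)) * ((C + 1 : ℝ≥0) * pw (t - s) (-((b - β) / 2)) *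
          (M * pw s (-((3 - b) / 2)))) := by
          gcongr
          refine (hC _ hts _ hFs).trans ?_
          gcongr
          · simp
          · exact h s hs
      _ = _ := by ring

lemma nr_duh_le (hn : 0 < n) {b β κ : ℝ} (hβ : 0 < β) (hβb : β ≤ b) (hβn : b ≤ n)
    (hκ : 0 ≤ κ) (hb1 : 1 < b) (hb3 : b ≤ 3) (hlt : κ / 2 + (b - β) / 2 < 1) {c : ℝ} (hc : 0 < c) :
    ∃ C : ℝ≥0, ∀ t : ℝ, 0 < t → ∀ F : ℝ → Rn n → ℝ≥0∞, Measurable (Function.uncurry F) →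
      ∀ M : ℝ≥0∞, M ≠ ⊤ → (∀ s ∈ Set.Ioo 0 t, nr b (F s) ≤ M * pw s (-((3 - b) / 2))) →
      nr β (duh c κ t F) ≤ C * M * pw t (-((1 + κ - β) / 2)) := by
  obtain ⟨C, hC⟩ := nr_duh_le_of_ne_zero hn hβ hβb hβn hκ hb1 hb3 hlt hc
  refine ⟨C, fun t ht F hF M hM h => ?_⟩
  -- Minkowski's inequality requires a nonzero majorant, so the case `M = 0` is the limit of
  -- positive `ε`.
  by_cases h0 : M = 0
  · subst h0
    have hlim : Tendsto (fun ε : ℝ≥0 => (C * pw t (-((1 + κ - β) / 2))) * (ε : ℝ≥0∞))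
        (𝓝[>] 0) (𝓝 ((C * pw t (-((1 + κ - β) / 2))) * ((0 : ℝ≥0) : ℝ≥0∞))) := by
      refine (ENNReal.Tendsto.const_mul (ENNReal.continuous_coe.tendsto 0) (Or.inr
        (ENNReal.mul_ne_top (by simp) (pw_ne_top _ _)))).mono_left nhdsWithin_le_nhds
    refine (ge_of_tendsto hlim ?_).trans (by simp)
    filter_upwards [self_mem_nhdsWithin] with ε hε
    refine (hC t ht F hF ε (by simpa using hε.ne') (by simp)
      (fun s hs => (h s hs).trans (by simp))).trans (le_of_eq (by ring))
  · exact hC t ht F hF M h0 hM h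

lemma measurable_potA_uncurry {v : ℝ → Rn n → Cn n}
    (hv : Measurable fun p : ℝ × Rn n => ‖v p.1 p.2‖ₑ) :
    Measurable fun p : ℝ × Rn n => potA (v p.1) p.2 :=
  measurable_riesz_uncurry _ (f := fun s y => ‖v s y‖ₑ ^ 2) (hv.pow_const 2)

lemma measurable_nlinGrad_uncurry {v : ℝ → Rn n → Cn n}
    (hv : Measurable fun p : ℝ × Rn n => ‖v p.1 p.2‖ₑ)
    (hg : Measurable fun p : ℝ × Rn n => ‖grad (v p.1) p.2‖ₑ) :
    Measurable (Function.uncurry fun s => nlinGrad (v s)) := by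
  have h1 := measurable_potA_uncurry hv
  have h2 := measurable_riesz_uncurry (1 / 8) (f := fun s y => ‖grad (v s) y‖ₑ * ‖v s y‖ₑ)
    (hg.mul hv)
  exact (h1.mul hg).add (h2.mul hv)

lemma measurable_nlinQuintic_uncurry {v : ℝ → Rn n → Cn n}
    (hv : Measurable fun p : ℝ × Rn n => ‖v p.1 p.2‖ₑ) :
    Measurable (Function.uncurry fun s => nlinQuintic (v s)) := by
  have h1 := measurable_potA_uncurry hv
  have h2 := measurable_riesz_uncurry (1 / 8) (f := fun s y => potA (v s) y * ‖v s y‖ₑ * ‖v s y‖ₑ)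
    ((h1.mul hv).mul hv)
  exact ((h1.mul h1).mul hv).add (h2.mul hv)

lemma pw_pow {s : ℝ} (hs : 0 < s) (θ : ℝ) (k : ℕ) : pw s θ ^ k = pw s (k * θ) := by
  rw [← ENNReal.rpow_natCast, pw_rpow hs, mul_comm]

lemma measurable_section {f : ℝ × Rn n → ℝ≥0∞} (hf : Measurable f) (s : ℝ) :
    Measurable fun y => f (s, y) := hf.comp measurable_prodMk_left

lemma duh_add₃ (c κ t : ℝ) {F G H : ℝ → Rn n → ℝ≥0∞} (hF : Measurable (Function.uncurry F))
    (hG : Measurable (Function.uncurry G)) :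
    duh c κ t (fun s y => F s y + G s y + H s y) = fun x =>
      duh c κ t F x + duh c κ t G x + duh c κ t H x := by
  funext x
  rw [← duh_add c κ t hF, ← duh_add c κ t (F := fun s y => F s y + G s y) (hF.add hG)]

lemma nr_add₃ {b : ℝ} (hb : 0 < b) (hbn : b ≤ n) {f g h : Rn n → ℝ≥0∞}
    (hf : Measurable f) (hg : Measurable g) (hh : Measurable h) :
    nr b (fun x => f x + g x + h x) ≤ nr b f + nr b g + nr b h :=
  (nr_add hb hbn (hf.add hg) hh).trans (add_le_add_left (nr_add hb hbn hf hg) _)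

/-- The Fujita-Kato estimate of the Duhamel integral of the nonlinearity. -/
lemma nr_duh_nlin_le (hn : 3 ≤ n) {δ : ℝ} (hδ : δ ∈ Set.Ioo (3 / 5 : ℝ) (2 / 3)) {β κ : ℝ}
    (hβ : 0 < β) (hβ1 : β ≤ 1) (hκ : 0 ≤ κ) (hlt : κ - β ≤ 0) {c : ℝ} (hc : 0 < c) :
    ∃ C : ℝ≥0, ∀ t : ℝ, 0 < t → ∀ v : ℝ → Rn n → Cn n,
      (Measurable fun p : ℝ × Rn n => ‖v p.1 p.2‖ₑ) →
      (Measurable fun p : ℝ × Rn n => ‖grad (v p.1) p.2‖ₑ) → ∀ R : ℝ≥0∞, R ≠ ⊤ →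
      (∀ s ∈ Set.Ioo 0 t, nr δ (fun y => ‖v s y‖ₑ) ≤ R * pw s (-((1 - δ) / 2))) →
      (∀ s ∈ Set.Ioo 0 t, nr 1 (fun y => ‖grad (v s) y‖ₑ) ≤ R * pw s (-(1 / 2))) →
      nr β (duh c κ t fun s => nlin (v s)) ≤ C * (R ^ 3 + R ^ 5) * pw t (-((1 + κ - β) / 2)) := by
  obtain ⟨C1, hC1⟩ := nr_nlinGrad_le hn hδ
  obtain ⟨C3, hC3⟩ := nr_nlinQuintic_le hn hδ
  have hδ' := hδ
  obtain ⟨h1, h2⟩ := hδ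
  have hn0 : 0 < n := by omega
  have hn' : (3:ℝ) ≤ n := by exact_mod_cast hn
  -- The range of `δ` is used here: each of the indices `2δ`, `3δ`, `5δ - 2` must lie strictly
  -- between `1` and `2`, the binding conditions being `5δ - 2 > 1` and `3δ < 2`.
  obtain ⟨D1, hD1⟩ := nr_duh_le hn0 (b := 2 * δ) (β := β) (κ := κ) hβ (by linarith) (by linarith)
    hκ (by linarith) (by linarith) (by linarith) hc
  obtain ⟨D2, hD2⟩ := nr_duh_le hn0 (b := 3 * δ) (β := β) (κ := κ) hβ (by linarith) (by linarith)
    hκ (by linarith) (by linarith) (by linarith) hc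
  obtain ⟨D3, hD3⟩ := nr_duh_le hn0 (b := 5 * δ - 2) (β := β) (κ := κ) hβ (by linarith)
    (by linarith) hκ (by linarith) (by linarith) (by linarith) hc
  refine ⟨D1 * C1 + D2 + D3 * C3, fun t ht v hv hg R hR hu hgu => ?_⟩
  have hvs : ∀ s, Measurable fun y => ‖v s y‖ₑ := fun s => measurable_section hv s
  have hgs : ∀ s, Measurable fun y => ‖grad (v s) y‖ₑ := fun s => measurable_section hg s
  have m1 := measurable_nlinGrad_uncurry hv hg
  have m2 : Measurable (Function.uncurry fun s y => ‖v s y‖ₑ ^ 3) := hv.pow_const 3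
  have m3 := measurable_nlinQuintic_uncurry hv
  have a1 := hD1 t ht _ m1 (C1 * R ^ 3)
    (ENNReal.mul_ne_top ENNReal.coe_ne_top (ENNReal.pow_ne_top hR)) fun s hs => by
      refine (hC1 _ (hvs s) (hgs s)).trans ?_
      calc _ ≤ C1 * ((R * pw s (-((1 - δ) / 2))) ^ 2 * (R * pw s (-(1 / 2)))) := by
            gcongr
            · exact hu s hs
            · exact hgu s hs
        _ = C1 * R ^ 3 * (pw s (-((1 - δ) / 2)) ^ 2 * pw s (-(1 / 2))) := by ring
        _ = _ := by
            rw [pw_pow hs.1, ← pw_add hs.1]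
            congr 2; push_cast; ring
  have a2 := hD2 t ht _ m2 (R ^ 3) (ENNReal.pow_ne_top hR) fun s hs => by
      refine (nr_cube_le hn hδ' (hvs s)).trans ?_
      calc _ ≤ (R * pw s (-((1 - δ) / 2))) ^ 3 := by
            gcongr
            exact hu s hs
        _ = R ^ 3 * (pw s (-((1 - δ) / 2)) ^ 3) := by ring
        _ = _ := by
            rw [pw_pow hs.1]
            congr 2; push_cast; ring
  have a3 := hD3 t ht _ m3 (C3 * R ^ 5)
    (ENNReal.mul_ne_top ENNReal.coe_ne_top (ENNReal.pow_ne_top hR)) fun s hs => by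
      refine (hC3 _ (hvs s)).trans ?_
      calc _ ≤ C3 * (R * pw s (-((1 - δ) / 2))) ^ 5 := by
            gcongr
            exact hu s hs
        _ = C3 * R ^ 5 * (pw s (-((1 - δ) / 2)) ^ 5) := by ring
        _ = _ := by
            rw [pw_pow hs.1]
            congr 2; push_cast; ring
  have e : (fun s => nlin (v s)) = fun s y =>
      nlinGrad (v s) y + ‖v s y‖ₑ ^ 3 + nlinQuintic (v s) y := by
    funext s y
    exact nlin_eq (hvs s) (hgs s) y
  rw [e, duh_add₃ c κ t m1 m2]
  refine (nr_add₃ hβ (by linarith) (measurable_duh c κ t m1) (measurable_duh c κ t m2)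
    (measurable_duh c κ t m3)).trans ((add_le_add (add_le_add a1 a2) a3).trans ?_)
  push_cast
  set P := pw t (-((1 + κ - β) / 2))
  calc _ = (D1 * C1 + D2) * R ^ 3 * P + D3 * C3 * R ^ 5 * P := by ring
    _ ≤ (D1 * C1 + D2 + D3 * C3) * R ^ 3 * P + (D1 * C1 + D2 + D3 * C3) * R ^ 5 * P := by
        exact add_le_add (mul_le_mul' (mul_le_mul' le_self_add le_rfl) le_rfl)
          (mul_le_mul' (mul_le_mul' le_add_self le_rfl) le_rfl)
    _ = _ := by ring

/-! ### The semigroup generated by `(λ - i) Δ` and the Duhamel bound for the solution. -/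

/-- The width parameter of the kernel of the semigroup generated by `(λ - i) Δ`. -/
noncomputable def wS (lam : ℝ) : ℂ := 1 / (4 * (lam - Complex.I))

lemma lam_sub_I_ne_zero (lam : ℝ) : (lam : ℂ) - Complex.I ≠ 0 := fun h => by
  have := congrArg Complex.im h; simp at this

lemma wS_re_pos {lam : ℝ} (hlam : 0 < lam) : 0 < (wS lam).re := by
  have h : wS lam = ((lam : ℂ) - Complex.I)⁻¹ * ((1 / 4 : ℝ) : ℂ) := by
    have := lam_sub_I_ne_zero lam
    rw [wS]; push_cast; field_simp
  rw [h, Complex.re_mul_ofReal, Complex.inv_re]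
  have h1 : 0 < Complex.normSq ((lam : ℂ) - Complex.I) :=
    Complex.normSq_pos.2 (lam_sub_I_ne_zero lam)
  have h2 : ((lam : ℂ) - Complex.I).re = lam := by simp
  rw [h2]
  positivity

lemma one_div_four_mul_wS (lam : ℝ) : 1 / (4 * wS lam) = lam - Complex.I := by
  have := lam_sub_I_ne_zero lam
  rw [wS]; field_simp

lemma semigroupS_apply {lam : ℝ} (hlam : 0 < lam) {t : ℝ} (ht : 0 < t) {f : Rn n → Cn n}
    (hf : ∀ l, MemHInfty fun y => f y l) (x : Rn n) (l : Fin n) :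
    semigroupS lam t f x l = cv (heatK (wS lam) t) (fun y => f y l) x := by
  have hw := wS_re_pos hlam
  have H := isHeatKernel_heatK (n := n) hw
  unfold semigroupS
  simp_rw [kernelS_eq_heatK hlam ht]
  rw [eval_integral_piLp (f := fun y => heatK (1 / (4 * ((lam:ℂ) - Complex.I))) t (x - y) • f y)
    fun l => ?_]
  · rfl
  · exact H.integrable (by linarith) ht (hf l).1.continuous.aestronglyMeasurable (hf l).gi x

lemma grad_semigroupS_apply {lam : ℝ} (hlam : 0 < lam) {t : ℝ} (ht : 0 < t) {f : Rn n → Cn n}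
    (hf : ∀ l, MemHInfty fun y => f y l) (x : Rn n) (k l : Fin n) :
    grad (semigroupS lam t f) x (k, l) = pd k (cv (heatK (wS lam) t) fun y => f y l) x := by
  have : (fun y => semigroupS lam t f y l) = cv (heatK (wS lam) t) fun y => f y l :=
    funext fun y => semigroupS_apply hlam ht hf y l
  simp only [grad, this]

lemma measurable_cv {k f : Rn n → ℂ} (hk : Continuous k) (hf : Continuous f) :
    Measurable (cv k f) := by
  have h : StronglyMeasurable fun p : Rn n × Rn n => k (p.1 - p.2) * f p.2 :=
    (by fun_prop : Continuous fun p : Rn n × Rn n => k (p.1 - p.2) * f p.2).stronglyMeasurable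
  exact h.integral_prod_right'.measurable

lemma enorm_le_sum {ι : Type*} [Fintype ι] (x : EuclideanSpace ℂ ι) : ‖x‖ₑ ≤ ∑ i, ‖x i‖ₑ := by
  classical
  have h : x = ∑ i, EuclideanSpace.single i (x i) := by
    ext j
    simp [Finset.sum_apply]
  conv_lhs => rw [h]
  refine (enorm_sum_le _ _).trans (Finset.sum_le_sum fun i _ => le_of_eq ?_)
  rw [← ofReal_norm, ← ofReal_norm, PiLp.norm_single]

/-- The projection of the real line to `[0,T]`. -/
noncomputable def clamp (T s : ℝ) : ℝ := max 0 (min T s)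

lemma clamp_mem {T : ℝ} (hT : 0 ≤ T) (s : ℝ) : clamp T s ∈ Set.Icc 0 T :=
  ⟨le_max_left _ _, max_le hT (min_le_left _ _)⟩

lemma clamp_eq {T s : ℝ} (hs : s ∈ Set.Icc 0 T) : clamp T s = s := by
  rw [clamp, min_eq_right hs.2, max_eq_right hs.1]

lemma continuous_clamp (T : ℝ) : Continuous (clamp T) := by
  unfold clamp; fun_prop

/-- Nothing is known about the family outside `[0,T]`. Freezing it at the end times makes it jointly
continuous on the whole line, which supplies the joint measurability needed for Minkowski's
inequality. -/
lemma ContHInfty.continuous_uncurry_clamp (hn : 0 < n) {T : ℝ} (hT : 0 ≤ T) {f : ℝ → Rn n → ℂ}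
    (hf : ContHInfty T f) : Continuous fun p : ℝ × Rn n => f (clamp T p.1) p.2 := by
  rw [continuous_iff_continuousAt]
  rintro ⟨s, y⟩
  have hs := clamp_mem hT s
  obtain ⟨osc, hosc, h⟩ := hf.sup_continuous hn hs
  have h1 : Tendsto (fun p : ℝ × Rn n => osc (clamp T p.1)) (𝓝 (s, y)) (𝓝 0) := by
    refine hosc.comp (tendsto_nhdsWithin_iff.2 ⟨?_, Eventually.of_forall fun p => clamp_mem hT _⟩)
    exact ((continuous_clamp T).comp continuous_fst).tendsto (s, y)
  have h2 : Tendsto (fun p : ℝ × Rn n => ‖f (clamp T s) p.2 - f (clamp T s) y‖) (𝓝 (s, y)) (𝓝 0) := by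
    have hc : Continuous fun p : ℝ × Rn n => ‖f (clamp T s) p.2 - f (clamp T s) y‖ := by
      have := (hf.1 _ hs).1.continuous
      fun_prop
    simpa using hc.tendsto (s, y)
  rw [ContinuousAt, tendsto_iff_norm_sub_tendsto_zero]
  refine squeeze_zero (fun p => norm_nonneg _) (fun p => ?_) (by simpa using h1.add h2)
  exact (norm_sub_le_norm_sub_add_norm_sub _ (f (clamp T s) p.2) _).trans
    (add_le_add (h _ (clamp_mem hT _) _) le_rfl)

lemma duh_mono_const {c κ t : ℝ} {F G : ℝ → Rn n → ℝ≥0∞} {C : ℝ≥0}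
    (h : ∀ s ∈ Set.Ioo 0 t, ∀ y, F s y ≤ C * G s y) (x : Rn n) :
    duh c κ t F x ≤ C * duh c κ t G x := by
  unfold duh
  rw [← lintegral_const_mul' _ _ ENNReal.coe_ne_top]
  refine setLIntegral_mono_ae' measurableSet_Ioo (Eventually.of_forall fun s hs => ?_)
  have h1 : gconv c (t - s) (F s) x ≤ C * gconv c (t - s) (G s) x := by
    unfold gconv
    rw [← lintegral_const_mul' _ _ ENNReal.coe_ne_top]
    refine lintegral_mono fun y => ?_
    calc _ ≤ ENNReal.ofReal (gauss c (t - s) (x - y)) * (C * G s y) := by gcongr; exact h s hs y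
      _ = _ := by ring
  calc _ ≤ pw (t - s) (-(κ / 2)) * (C * gconv c (t - s) (G s) x) := by gcongr
    _ = _ := by ring

namespace IsCoulombSolution

variable {lam T : ℝ} {u : ℝ → Rn n → Cn n} {a₀ : ℝ → Rn n → ℝ} {a : ℝ → Rn n → Rn n}

lemma measurable_u (hn : 0 < n) (hT : 0 ≤ T) (hS : IsCoulombSolution n lam T u a₀ a) :
    Measurable fun p : ℝ × Rn n => ‖u (clamp T p.1) p.2‖ₑ := by
  have h : Continuous fun p : ℝ × Rn n => u (clamp T p.1) p.2 :=
    (PiLp.continuous_toLp 2 _).comp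
      (continuous_pi fun l => (hS.hu l).continuous_uncurry_clamp hn hT)
  exact h.measurable.enorm

lemma measurable_grad_u (hn : 0 < n) (hT : 0 ≤ T) (hS : IsCoulombSolution n lam T u a₀ a) :
    Measurable fun p : ℝ × Rn n => ‖grad (u (clamp T p.1)) p.2‖ₑ := by
  have h : Continuous fun p : ℝ × Rn n => grad (u (clamp T p.1)) p.2 :=
    (PiLp.continuous_toLp 2 _).comp
      (continuous_pi fun q => ((hS.hu q.2).pd q.1).continuous_uncurry_clamp hn hT)
  exact h.measurable.enorm

/-- The difference from the free evolution is controlled by the Duhamel integral of the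
nonlinearity. -/
lemma enorm_sub_semigroupS_le (hn : 0 < n) (hlam : 0 < lam) : ∃ C : ℝ≥0, ∀ {T : ℝ}
    {u : ℝ → Rn n → Cn n} {a₀ : ℝ → Rn n → ℝ} {a : ℝ → Rn n → Rn n},
    IsCoulombSolution n lam T u a₀ a → ∀ t ∈ Set.Ioc 0 T, ∀ x,
      ‖u t x - semigroupS lam t (u 0) x‖ₑ ≤
        C * duh ((wS lam).re / 2) 0 t (fun s => nlin (u (clamp T s))) x := by
  obtain ⟨C, hC⟩ := duhamel_heatK (n := n) (wS_re_pos hlam) hn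
  obtain ⟨C', hC'⟩ := enorm_nonlin_le (n := n) hn lam
  refine ⟨n * (C * C'), fun {T u a₀ a} hS t ht x => ?_⟩
  have h0 : (0:ℝ) ∈ Set.Icc 0 T := ⟨le_rfl, ht.1.le.trans ht.2⟩
  refine (enorm_le_sum _).trans ((Finset.sum_le_sum (g := fun _ =>
    (C * C' : ℝ≥0∞) * duh ((wS lam).re / 2) 0 t (fun s => nlin (u (clamp T s))) x)
    fun l _ => ?_).trans (by simp [mul_assoc]))
  have hB := hS.bddCont_nonlin hn l
  obtain ⟨hNc, B, hNB⟩ := hB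
  have key := hC T t ht (fun t x => u t x l) (nonlin lam u a₀ a l) (hS.hu l)
    (fun s hs => hNc s ⟨hs.1.le, hs.2.le⟩) ⟨B, fun s hs => hNB s ⟨hs.1.le, hs.2.le⟩⟩
    (fun s hs x => by rw [one_div_four_mul_wS]; exact hS.hasDerivAt_u l hs x) x
  rw [PiLp.sub_apply, semigroupS_apply hlam ht.1 fun l => (hS.hu l).1 0 h0]
  refine key.trans ?_
  rw [mul_assoc]
  gcongr
  refine le_trans (le_of_eq ?_) (duh_mono_const (c := (wS lam).re / 2) (κ := 0) (t := t)
    (F := fun s y => ‖nonlin lam u a₀ a l s y‖ₑ) (C := C') (fun s hs y => ?_) x)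
  · simp [duh, pw_zero]
  · have hs' : s ∈ Set.Ioo 0 T := ⟨hs.1, hs.2.trans_le ht.2⟩
    rw [clamp_eq ⟨hs'.1.le, hs'.2.le⟩]
    exact hC' hS s hs' y l

lemma enorm_grad_sub_semigroupS_le (hn : 0 < n) (hlam : 0 < lam) : ∃ C : ℝ≥0, ∀ {T : ℝ}
    {u : ℝ → Rn n → Cn n} {a₀ : ℝ → Rn n → ℝ} {a : ℝ → Rn n → Rn n},
    IsCoulombSolution n lam T u a₀ a → ∀ t ∈ Set.Ioc 0 T, ∀ x,
      ‖grad (u t) x - grad (semigroupS lam t (u 0)) x‖ₑ ≤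
        C * duh ((wS lam).re / 2) 1 t (fun s => nlin (u (clamp T s))) x := by
  choose C hC using fun j => duhamel_heatD (n := n) (wS_re_pos hlam) hn j
  obtain ⟨C', hC'⟩ := enorm_nonlin_le (n := n) hn lam
  refine ⟨∑ q : Fin n × Fin n, C q.1 * C', fun {T u a₀ a} hS t ht x => ?_⟩
  have h0 : (0:ℝ) ∈ Set.Icc 0 T := ⟨le_rfl, ht.1.le.trans ht.2⟩
  push_cast
  rw [Finset.sum_mul]
  refine (enorm_le_sum _).trans (Finset.sum_le_sum fun q _ => ?_)
  obtain ⟨k, l⟩ := q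
  have hB := hS.bddCont_nonlin hn l
  obtain ⟨hNc, B, hNB⟩ := hB
  have key := hC k T t ht (fun t x => u t x l) (nonlin lam u a₀ a l) (hS.hu l)
    (fun s hs => hNc s ⟨hs.1.le, hs.2.le⟩) ⟨B, fun s hs => hNB s ⟨hs.1.le, hs.2.le⟩⟩
    (fun s hs x => by rw [one_div_four_mul_wS]; exact hS.hasDerivAt_u l hs x) x
  rw [PiLp.sub_apply, grad_semigroupS_apply hlam ht.1 fun l => (hS.hu l).1 0 h0]
  refine key.trans ?_
  rw [mul_assoc]
  gcongr
  refine duh_mono_const (c := (wS lam).re / 2) (κ := 1) (t := t)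
    (F := fun s y => ‖nonlin lam u a₀ a l s y‖ₑ) (C := C') (fun s hs y => ?_) x
  have hs' : s ∈ Set.Ioo 0 T := ⟨hs.1, hs.2.trans_le ht.2⟩
  rw [clamp_eq ⟨hs'.1.le, hs'.2.le⟩]
  exact hC' hS s hs' y l

end IsCoulombSolution

/-! ### Finiteness and time continuity of the weighted norms. -/

lemma eLpNorm_eq_nr (hn : 0 < n) {b : ℝ} (hb : 0 < b) {F : Type*} [NormedAddCommGroup F]
    (f : Rn n → F) :
    eLpNorm f (ENNReal.ofReal (n / b)) volume = nr b (fun x => ‖f x‖ₑ) := by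
  have hn' : (0:ℝ) < n := by exact_mod_cast hn
  have hp : (0:ℝ) < n / b := by positivity
  rw [eLpNorm_eq_lintegral_rpow_enorm_toReal (by simpa using hp) ENNReal.ofReal_ne_top,
    ENNReal.toReal_ofReal hp.le, one_div_div, nr]

lemma eLpNorm_natCast_eq_nr (hn : 0 < n) {F : Type*} [NormedAddCommGroup F] (f : Rn n → F) :
    eLpNorm f (n : ℝ≥0∞) volume = nr 1 (fun x => ‖f x‖ₑ) := by
  rw [← eLpNorm_eq_nr hn one_pos, div_one, ENNReal.ofReal_natCast]

/-- The weighted norm in the definition of the Fujita-Kato quantity. -/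
noncomputable def wgt (δ : ℝ) (v : ℝ → Rn n → Cn n) (t : ℝ) : ℝ≥0∞ :=
  max (pw t ((1 - δ) / 2) * nr δ (fun x => ‖v t x‖ₑ)) (pw t (1 / 2) * nr 1 (fun x => ‖grad (v t) x‖ₑ))

lemma weightR_eq (hn : 0 < n) {δ : ℝ} (hδ : 0 < δ) (v : ℝ → Rn n → Cn n) (t : ℝ) :
    weightR δ v t = ⨆ τ ∈ Set.Ioo 0 t, wgt δ v τ := by
  unfold weightR weightK weightK' wgt
  simp_rw [eLpNorm_eq_nr hn hδ, eLpNorm_natCast_eq_nr hn, iSup_sup_eq]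
  rfl

/-- The exponent `n/b` is at least `2`, so all powers beyond the second are absorbed by the
supremum. This carries continuity from `L²` to `L^{n/b}`. -/
lemma nr_le_interp (hn : 0 < n) {b : ℝ} (hb : 0 < b) (hbn : b ≤ n / 2) {F : Type*}
    [NormedAddCommGroup F] {f : Rn n → F} {M : ℝ≥0∞} (hM : ∀ x, ‖f x‖ₑ ≤ M) (hM' : M ≠ ⊤) :
    nr b (fun x => ‖f x‖ₑ) ≤ (M ^ ((n:ℝ) / b - 2) * eLpNorm f 2 volume ^ (2:ℝ)) ^ (b / n) := by
  have hn' : (0:ℝ) < n := by exact_mod_cast hn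
  have hp : 0 ≤ (n:ℝ) / b - 2 := by rw [sub_nonneg, le_div_iff₀ hb]; linarith
  have e : eLpNorm f 2 volume ^ (2:ℝ) = ∫⁻ x, ‖f x‖ₑ ^ (2:ℝ) := by
    have := nr_rpow hn (b := (n:ℝ) / 2) (by positivity) (fun x => ‖f x‖ₑ)
    rwa [nr_half hn, div_div_cancel₀ hn'.ne'] at this
  unfold nr
  gcongr ?_ ^ _
  rw [e, ← lintegral_const_mul' _ _ (ENNReal.rpow_ne_top_of_nonneg hp hM')]
  refine lintegral_mono fun x => ?_
  calc ‖f x‖ₑ ^ ((n:ℝ) / b) = ‖f x‖ₑ ^ ((n:ℝ) / b - 2) * ‖f x‖ₑ ^ (2:ℝ) := by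
        rw [← ENNReal.rpow_add_of_nonneg _ _ hp (by norm_num), sub_add_cancel]
    _ ≤ _ := by gcongr; exact hM x

section Continuity

variable {T : ℝ} {b : ℝ}

lemma ContHInfty.tendsto_eLpNorm_sub {f : ℝ → Rn n → ℂ} (hf : ContHInfty T f) {s : ℝ}
    (hs : s ∈ Set.Icc 0 T) : Tendsto (fun t => eLpNorm (fun x => f t x - f s x) 2 volume)
      (𝓝[Set.Icc 0 T] s) (𝓝 0) := by
  have h1 := ENNReal.tendsto_ofReal (hf.tendsto_sob 0 hs)
  rw [ENNReal.ofReal_zero] at h1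
  refine tendsto_of_tendsto_of_tendsto_of_le_of_le' tendsto_const_nhds h1
    (Eventually.of_forall fun _ => zero_le) ?_
  filter_upwards [self_mem_nhdsWithin] with t ht
  have h2 := ((hf.1 t ht).sub (hf.1 s hs)).memLp
  rw [← ENNReal.ofReal_toReal h2.eLpNorm_ne_top]
  exact ENNReal.ofReal_le_ofReal (toReal_eLpNorm_le_sob 0)

lemma ContHInfty.tendsto_nr_sub (hn : 0 < n) (hb : 0 < b) (hbn : b ≤ n / 2) {f : ℝ → Rn n → ℂ}
    (hf : ContHInfty T f) {s : ℝ} (hs : s ∈ Set.Icc 0 T) :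
    Tendsto (fun t => nr b (fun x => ‖f t x - f s x‖ₑ)) (𝓝[Set.Icc 0 T] s) (𝓝 0) := by
  have hn' : (0:ℝ) < n := by exact_mod_cast hn
  have hp : 0 ≤ (n:ℝ) / b - 2 := by rw [sub_nonneg, le_div_iff₀ hb]; linarith
  obtain ⟨B, hB, h⟩ := hf.bounded hn
  set M : ℝ≥0∞ := ENNReal.ofReal (B + B)
  have hMt : M ^ ((n:ℝ) / b - 2) ≠ ⊤ := ENNReal.rpow_ne_top_of_nonneg hp ENNReal.ofReal_ne_top
  have h1 : Tendsto (fun t => (M ^ ((n:ℝ) / b - 2) *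
      eLpNorm (fun x => f t x - f s x) 2 volume ^ (2:ℝ)) ^ (b / n)) (𝓝[Set.Icc 0 T] s) (𝓝 0) := by
    have h2 := ((hf.tendsto_eLpNorm_sub hs).ennrpow_const 2)
    have h3 := (ENNReal.Tendsto.const_mul (a := M ^ ((n:ℝ) / b - 2)) h2 (Or.inr hMt)).ennrpow_const
      (b / n)
    simpa [ENNReal.zero_rpow_of_pos (show (0:ℝ) < b / n by positivity)] using h3
  refine tendsto_of_tendsto_of_tendsto_of_le_of_le' tendsto_const_nhds h1
    (Eventually.of_forall fun _ => zero_le) ?_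
  filter_upwards [self_mem_nhdsWithin] with t ht
  refine nr_le_interp hn hb hbn (fun x => ?_) ENNReal.ofReal_ne_top
  rw [← ofReal_norm]
  exact ENNReal.ofReal_le_ofReal ((norm_sub_le _ _).trans (add_le_add (h t ht x) (h s hs x)))

lemma ContHInfty.nr_ne_top (hn : 0 < n) (hb : 0 < b) (hbn : b ≤ n / 2) {f : ℝ → Rn n → ℂ}
    (hf : ContHInfty T f) {s : ℝ} (hs : s ∈ Set.Icc 0 T) : nr b (fun x => ‖f s x‖ₑ) ≠ ⊤ := by
  have hn' : (0:ℝ) < n := by exact_mod_cast hn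
  have hp : 0 ≤ (n:ℝ) / b - 2 := by rw [sub_nonneg, le_div_iff₀ hb]; linarith
  obtain ⟨B, hB, h⟩ := hf.bounded hn
  refine ne_top_of_le_ne_top ?_ (nr_le_interp hn hb hbn (f := f s) (M := ENNReal.ofReal B)
    (fun x => ?_) ENNReal.ofReal_ne_top)
  · exact ENNReal.rpow_ne_top_of_nonneg (by positivity) (ENNReal.mul_ne_top
      (ENNReal.rpow_ne_top_of_nonneg hp ENNReal.ofReal_ne_top)
      (ENNReal.rpow_ne_top_of_nonneg (by norm_num) (hf.1 s hs).memLp.eLpNorm_ne_top))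
  · rw [← ofReal_norm]
    exact ENNReal.ofReal_le_ofReal (h s hs x)

variable {ι : Type*} [Fintype ι] {g : ℝ → Rn n → EuclideanSpace ℂ ι}

lemma nr_le_sum (hn : 0 < n) (hb : 0 < b) (hbn : b ≤ n) {f : Rn n → EuclideanSpace ℂ ι}
    (hf : ∀ i, Continuous fun x => f x i) :
    nr b (fun x => ‖f x‖ₑ) ≤ ∑ i, nr b (fun x => ‖f x i‖ₑ) :=
  (nr_mono hb.le fun x => enorm_le_sum (f x)).trans
    (nr_sum hn hb hbn _ fun i => (hf i).measurable.enorm)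

lemma nr_vec_ne_top (hn : 0 < n) (hb : 0 < b) (hbn : b ≤ n / 2)
    (hg : ∀ i, ContHInfty T fun t x => g t x i) {s : ℝ} (hs : s ∈ Set.Icc 0 T) :
    nr b (fun x => ‖g s x‖ₑ) ≠ ⊤ :=
  ne_top_of_le_ne_top (ENNReal.sum_ne_top.2 fun i _ => (hg i).nr_ne_top hn hb hbn hs)
    (nr_le_sum hn hb (hbn.trans (half_le_self (Nat.cast_nonneg n)))
      fun i => ((hg i).1 s hs).1.continuous)

lemma continuousOn_nr (hn : 0 < n) (hb : 0 < b) (hbn : b ≤ n / 2)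
    (hg : ∀ i, ContHInfty T fun t x => g t x i) :
    ContinuousOn (fun t => nr b (fun x => ‖g t x‖ₑ)) (Set.Icc 0 T) := by
  intro s hs
  have hbn' : b ≤ n := hbn.trans (half_le_self (Nat.cast_nonneg n))
  have hgc : ∀ t ∈ Set.Icc 0 T, Continuous (g t) := fun t ht =>
    (PiLp.continuous_toLp 2 _).comp (continuous_pi fun i => ((hg i).1 t ht).1.continuous)
  set ε : ℝ → ℝ≥0∞ := fun t => ∑ i, nr b (fun x => ‖g t x i - g s x i‖ₑ)
  have hε : Tendsto ε (𝓝[Set.Icc 0 T] s) (𝓝 0) := by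
    simpa using tendsto_finsetSum _ fun i _ => (hg i).tendsto_nr_sub hn hb hbn hs
  have hd : ∀ t ∈ Set.Icc 0 T, nr b (fun x => ‖g t x - g s x‖ₑ) ≤ ε t := fun t ht =>
    nr_le_sum (f := fun x => g t x - g s x) hn hb hbn' fun i =>
      ((hg i).1 t ht).1.continuous.sub ((hg i).1 s hs).1.continuous
  have hfin := nr_vec_ne_top hn hb hbn hg hs
  have h1 : Tendsto (fun t => nr b (fun x => ‖g s x‖ₑ) - ε t) (𝓝[Set.Icc 0 T] s)
      (𝓝 (nr b (fun x => ‖g s x‖ₑ))) := by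
    simpa using ENNReal.Tendsto.sub tendsto_const_nhds hε (Or.inl hfin)
  have h2 : Tendsto (fun t => nr b (fun x => ‖g s x‖ₑ) + ε t) (𝓝[Set.Icc 0 T] s)
      (𝓝 (nr b (fun x => ‖g s x‖ₑ))) := by
    simpa using tendsto_const_nhds.add hε
  refine tendsto_of_tendsto_of_tendsto_of_le_of_le' h1 h2 ?_ ?_
  · filter_upwards [self_mem_nhdsWithin] with t ht
    rw [tsub_le_iff_right]
    refine (nr_mono hb.le fun x => ?_).trans ((nr_add hb hbn' (hgc t ht).measurable.enorm
      ((hgc t ht).sub (hgc s hs)).measurable.enorm).trans (add_le_add_right (hd t ht) _))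
    have := enorm_sub_le (a := g t x) (b := g t x - g s x)
    simpa using this
  · filter_upwards [self_mem_nhdsWithin] with t ht
    refine (nr_mono hb.le fun x => ?_).trans ((nr_add hb hbn' (hgc s hs).measurable.enorm
      ((hgc t ht).sub (hgc s hs)).measurable.enorm).trans (add_le_add_right (hd t ht) _))
    have := enorm_add_le (g s x) (g t x - g s x)
    simpa using this

end Continuity

lemma continuous_pw {θ : ℝ} (hθ : 0 ≤ θ) : Continuous fun t => pw t θ :=
  ENNReal.continuous_ofReal.comp (Real.continuous_rpow_const hθ)

/-- Both time exponents are positive; this is the starting point of the continuity argument. -/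
lemma wgt_zero {δ : ℝ} (hδ : δ < 1) (v : ℝ → Rn n → Cn n) : wgt δ v 0 = 0 := by
  have h : ∀ θ : ℝ, 0 < θ → pw 0 θ = 0 := fun θ hθ => by simp [pw, Real.zero_rpow hθ.ne']
  rw [wgt, h _ (by linarith), h _ (by norm_num)]
  simp

namespace IsCoulombSolution

variable {lam T : ℝ} {u : ℝ → Rn n → Cn n} {a₀ : ℝ → Rn n → ℝ} {a : ℝ → Rn n → Rn n}

/-- For `n ≥ 2` both `δ` and `1` are at most `n/2`, so interpolation with `L²` applies to `u` and
`∇u`. The norms are finite up to `t = 0`, where the weights are still continuous. -/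
lemma continuousOn_wgt (hn : 2 ≤ n) {δ : ℝ} (hδ : 0 < δ) (hδ1 : δ < 1)
    (hS : IsCoulombSolution n lam T u a₀ a) : ContinuousOn (wgt δ u) (Set.Icc 0 T) := by
  have hn0 : 0 < n := by omega
  have hn' : (2:ℝ) ≤ n := by exact_mod_cast hn
  have hgu : ∀ q : Fin n × Fin n, ContHInfty T fun t x => grad (u t) x q :=
    fun q => (hS.hu q.2).pd q.1
  have c1 := continuousOn_nr hn0 hδ (by linarith) hS.hu
  have c2 := continuousOn_nr (b := 1) hn0 one_pos (by linarith) hgu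
  unfold wgt
  refine ContinuousOn.sup ?_ ?_
  · exact (continuous_pw (by linarith)).continuousOn.ennreal_mul c1
      (fun t ht => Or.inr (nr_vec_ne_top hn0 hδ (by linarith) hS.hu ht))
      (fun t _ => Or.inr (pw_ne_top _ _))
  · exact (continuous_pw (by norm_num)).continuousOn.ennreal_mul c2
      (fun t ht => Or.inr (nr_vec_ne_top hn0 one_pos (by linarith) hgu ht))
      (fun t _ => Or.inr (pw_ne_top _ _))

lemma wgt_ne_top (hn : 2 ≤ n) {δ : ℝ} (hδ : 0 < δ) (hδ1 : δ < 1)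
    (hS : IsCoulombSolution n lam T u a₀ a) {t : ℝ} (ht : t ∈ Set.Icc 0 T) : wgt δ u t ≠ ⊤ := by
  have hn0 : 0 < n := by omega
  have hn' : (2:ℝ) ≤ n := by exact_mod_cast hn
  have hgu : ∀ q : Fin n × Fin n, ContHInfty T fun t x => grad (u t) x q :=
    fun q => (hS.hu q.2).pd q.1
  unfold wgt
  refine (max_lt (ENNReal.mul_lt_top (pw_ne_top _ _).lt_top ?_)
    (ENNReal.mul_lt_top (pw_ne_top _ _).lt_top ?_)).ne
  · exact (nr_vec_ne_top hn0 hδ (by linarith) hS.hu ht).lt_top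
  · exact (nr_vec_ne_top hn0 one_pos (by linarith) hgu ht).lt_top

/-- A continuous finite weight attains a finite maximum on `[0,T]`. Finiteness is also required
before the nonlinear estimate can be applied with `R` as its bound. -/
lemma weightR_lt_top (hn : 2 ≤ n) {δ : ℝ} (hδ : 0 < δ) (hδ1 : δ < 1)
    (hS : IsCoulombSolution n lam T u a₀ a) {t : ℝ} (ht : t ∈ Set.Icc 0 T) :
    weightR δ u t < ⊤ := by
  have hT : (0:ℝ) ≤ T := ht.1.trans ht.2
  obtain ⟨s, hs, hmax⟩ := isCompact_Icc.exists_isMaxOn (Set.nonempty_Icc.2 hT)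
    (hS.continuousOn_wgt hn hδ hδ1)
  rw [weightR_eq (by omega) hδ]
  refine (iSup₂_le fun τ hτ => ?_).trans_lt (hS.wgt_ne_top hn hδ hδ1 hs).lt_top
  exact hmax ⟨hτ.1.le, hτ.2.le.trans ht.2⟩

end IsCoulombSolution

/-! ### Linear estimates and the integral inequality for `R`. -/

lemma measurable_nlin_uncurry {v : ℝ → Rn n → Cn n}
    (hv : Measurable fun p : ℝ × Rn n => ‖v p.1 p.2‖ₑ)
    (hg : Measurable fun p : ℝ × Rn n => ‖grad (v p.1) p.2‖ₑ) :
    Measurable (Function.uncurry fun s => nlin (v s)) := by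
  have m1 := measurable_nlinGrad_uncurry hv hg
  have m2 : Measurable (Function.uncurry fun s y => ‖v s y‖ₑ ^ 3) := hv.pow_const 3
  have m3 := measurable_nlinQuintic_uncurry hv
  have e : (Function.uncurry fun s => nlin (v s)) = fun p =>
      (Function.uncurry fun s => nlinGrad (v s)) p + (Function.uncurry fun s y => ‖v s y‖ₑ ^ 3) p +
        (Function.uncurry fun s => nlinQuintic (v s)) p := by
    funext p
    exact nlin_eq (measurable_section hv p.1) (measurable_section hg p.1) p.2
  rw [e]
  exact (m1.add m2).add m3

lemma pw_mul_pw_neg {s : ℝ} (hs : 0 < s) (θ : ℝ) : pw s θ * pw s (-θ) = 1 := by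
  rw [← pw_add hs, add_neg_cancel, pw_zero]

lemma le_mul_pw_neg {s θ : ℝ} (hs : 0 < s) {N R : ℝ≥0∞} (h : pw s θ * N ≤ R) :
    N ≤ R * pw s (-θ) :=
  calc N = (pw s θ * N) * pw s (-θ) := by
        rw [mul_right_comm, pw_mul_pw_neg hs, one_mul]
    _ ≤ _ := by gcongr

/-- A perturbation which is small in the weighted norm. -/
lemma pw_mul_nr_le {E : Type*} [NormedAddCommGroup E] (hn : 0 < n) {β θ τ : ℝ} (hβ : 0 < β)
    (hβn : β ≤ n) (hτ : 0 < τ) {f g : Rn n → E} {d : Rn n → ℝ≥0∞} {c : ℝ≥0} {M : ℝ≥0∞}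
    (hg : Measurable fun x => ‖g x‖ₑ) (hd : Measurable d) (h : ∀ x, ‖f x - g x‖ₑ ≤ c * d x)
    (hM : nr β d ≤ M * pw τ (-θ)) :
    pw τ θ * nr β (fun x => ‖f x‖ₑ) ≤ pw τ θ * nr β (fun x => ‖g x‖ₑ) + c * M := by
  calc pw τ θ * nr β (fun x => ‖f x‖ₑ)
      ≤ pw τ θ * (nr β (fun x => ‖g x‖ₑ) + c * (M * pw τ (-θ))) := by
        gcongr
        refine (nr_mono (g := fun x => ‖g x‖ₑ + c * d x) hβ.le fun x => ?_).trans
          ((nr_add hβ hβn hg (hd.const_mul _)).trans ?_)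
        · have := enorm_add_le (g x) (f x - g x)
          rw [add_sub_cancel] at this
          exact this.trans (add_le_add_right (h x) _)
        · rw [nr_const_mul hn hβ d hd]
          gcongr
    _ = pw τ θ * nr β (fun x => ‖g x‖ₑ) + c * M * (pw τ θ * pw τ (-θ)) := by ring
    _ = _ := by rw [pw_mul_pw_neg hτ, mul_one]

lemma MemHInfty.bounded (hn : 0 < n) {f : Rn n → ℂ} (hf : MemHInfty f) : ∃ B : ℝ, ∀ x, ‖f x‖ ≤ B := by
  obtain ⟨C, M, -, h⟩ := sobolev_embedding hn
  exact ⟨_, h f hf⟩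

lemma pd_cv_heatK (hn : 0 < n) {w : ℂ} (hw : 0 < w.re) {t : ℝ} (ht : 0 < t) {f : Rn n → ℂ}
    (hf : MemHInfty f) (j : Fin n) (x : Rn n) :
    pd j (cv (heatK w t) f) x = cv (heatD w j t) f x := by
  obtain ⟨B, hB⟩ := hf.bounded hn
  choose B' hB' using fun i => (hf.pd i).bounded hn
  exact (isHeatKernel_heatK hw).pd_cv (by linarith) ht hf hB hB' j x

section Linear

variable {lam : ℝ} {f : Rn n → Cn n}

lemma measurable_semigroupS (hlam : 0 < lam) {t : ℝ} (ht : 0 < t)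
    (hf : ∀ l, MemHInfty fun y => f y l) : Measurable fun x => ‖semigroupS lam t f x‖ₑ := by
  have h : Measurable (semigroupS lam t f) := by
    refine (WithLp.measurable_toLp 2 _).comp
      (f := fun x => WithLp.ofLp (semigroupS lam t f x)) (measurable_pi_lambda _ fun l => ?_)
    simp_rw [semigroupS_apply hlam ht hf]
    exact measurable_cv (continuous_heatK _ _) (hf l).1.continuous
  exact h.enorm

lemma measurable_grad_semigroupS (hn : 0 < n) (hlam : 0 < lam) {t : ℝ} (ht : 0 < t)
    (hf : ∀ l, MemHInfty fun y => f y l) : Measurable fun x => ‖grad (semigroupS lam t f) x‖ₑ := by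
  have h : Measurable (grad (semigroupS lam t f)) := by
    refine (WithLp.measurable_toLp 2 _).comp
      (f := fun x => WithLp.ofLp (grad (semigroupS lam t f) x)) (measurable_pi_lambda _ fun q => ?_)
    obtain ⟨k, l⟩ := q
    simp_rw [grad_semigroupS_apply hlam ht hf, pd_cv_heatK hn (wS_re_pos hlam) ht (hf l)]
    exact measurable_cv ((isHeatKernel_heatD (wS_re_pos hlam) k).cont t ht) (hf l).1.continuous
  exact h.enorm

/-- The order `κ` costs `t^(-κ/2)` and the gain from index `1` to `β` costs `t^(-(1-β)/2)`; the
total is the same power of `t` as in the Duhamel estimate. -/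
lemma IsHeatKernel.nr_cv_le (hn : 0 < n) {z : ℂ} {c κ : ℝ} {K : ℝ → Rn n → ℂ}
    {D D2 : Fin n → ℝ → Rn n → ℂ} (H : IsHeatKernel z c κ K D D2) (hc : 0 < c) {β : ℝ} (hβ : 0 < β)
    (hβ1 : β ≤ 1) : ∃ C : ℝ≥0, ∀ t, 0 < t → ∀ f : Rn n → ℂ, Continuous f →
      nr β (fun x => ‖cv (K t) f x‖ₑ) ≤ C * pw t (-((1 + κ - β) / 2)) * nr 1 (fun x => ‖f x‖ₑ) := by
  obtain ⟨C, hC⟩ := H.enorm_cv_le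
  obtain ⟨C', hC'⟩ := nr_gconv_le hn hβ hβ1 (by exact_mod_cast hn) hc
  refine ⟨C * C', fun t ht f hf => ?_⟩
  have hfm := hf.measurable.enorm
  have hm := measurable_gconv_right c t hfm
  refine (nr_mono hβ.le (hC t ht f hf)).trans ?_
  rw [nr_const_mul hn hβ _ (by fun_prop), nr_const_mul hn hβ _ hm,
    show -((1 + κ - β) / 2) = -(κ / 2) + -((1 - β) / 2) by ring, pw_add ht]
  calc _ ≤ C * (pw t (-(κ / 2)) * (C' * pw t (-((1 - β) / 2)) * nr 1 fun x => ‖f x‖ₑ)) := by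
        gcongr
        exact hC' t ht _ hfm
    _ = _ := by push_cast; ring

/-- The linear estimate of the Fujita-Kato quantity of the free evolution. -/
lemma wgt_semigroupS_le (hn : 0 < n) (hlam : 0 < lam) {δ : ℝ} (hδ : 0 < δ) (hδ1 : δ ≤ 1) :
    ∃ C : ℝ≥0, ∀ f : Rn n → Cn n, Continuous f → (∀ l, MemHInfty fun y => f y l) → ∀ t, 0 < t →
      wgt δ (fun τ => semigroupS lam τ f) t ≤ C * nr 1 (fun x => ‖f x‖ₑ) := by
  have hw := wS_re_pos hlam
  have hc : 0 < (wS lam).re / 2 := by linarith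
  have hn1 : (1:ℝ) ≤ n := by exact_mod_cast hn
  obtain ⟨C, hC⟩ := (isHeatKernel_heatK (n := n) hw).nr_cv_le hn hc hδ hδ1
  choose C' hC' using fun j => (isHeatKernel_heatD (n := n) hw j).nr_cv_le hn hc one_pos le_rfl
  refine ⟨n * C + ∑ q : Fin n × Fin n, C' q.1, fun f hfc hf t ht => ?_⟩
  set N := nr 1 (fun x => ‖f x‖ₑ)
  have hl : ∀ l, nr 1 (fun x => ‖f x l‖ₑ) ≤ N := fun l =>
    nr_mono zero_le_one fun x => enorm_coord_le f x l
  have h1 : nr δ (fun x => ‖semigroupS lam t f x‖ₑ) ≤ (n * C) * N * pw t (-((1 - δ) / 2)) := by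
    refine (nr_mono hδ.le fun x => enorm_le_sum _).trans ((nr_sum hn hδ (hδ1.trans hn1) _
      fun l => ?_).trans ((Finset.sum_le_sum (g := fun _ => C * N * pw t (-((1 - δ) / 2)))
        fun l _ => ?_).trans (by simp [mul_assoc])))
    · simp_rw [semigroupS_apply hlam ht hf]
      exact (measurable_cv (continuous_heatK _ _) (hf l).1.continuous).enorm
    · simp_rw [semigroupS_apply hlam ht hf]
      refine (hC t ht _ (hf l).1.continuous).trans ?_
      rw [add_zero, mul_right_comm]
      gcongr
      exact hl l
  have h2 : nr 1 (fun x => ‖grad (semigroupS lam t f) x‖ₑ) ≤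
      (∑ q : Fin n × Fin n, (C' q.1 : ℝ≥0∞)) * N * pw t (-(1 / 2)) := by
    rw [Finset.sum_mul, Finset.sum_mul]
    refine (nr_mono zero_le_one fun x => enorm_le_sum _).trans ((nr_sum hn one_pos hn1 _
      fun q => ?_).trans (Finset.sum_le_sum fun q _ => ?_))
    · obtain ⟨k, l⟩ := q
      simp_rw [grad_semigroupS_apply hlam ht hf, pd_cv_heatK hn hw ht (hf l)]
      exact (measurable_cv ((isHeatKernel_heatD hw k).cont t ht) (hf l).1.continuous).enorm
    · obtain ⟨k, l⟩ := q
      simp_rw [grad_semigroupS_apply hlam ht hf, pd_cv_heatK hn hw ht (hf l)]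
      refine (hC' k t ht _ (hf l).1.continuous).trans ?_
      rw [add_sub_cancel_right, mul_right_comm]
      gcongr
      exact hl l
  unfold wgt
  push_cast
  refine max_le ?_ ?_
  · calc _ ≤ pw t ((1 - δ) / 2) * ((n * C) * N * pw t (-((1 - δ) / 2))) := by gcongr
      _ = (n * C) * N * (pw t ((1 - δ) / 2) * pw t (-((1 - δ) / 2))) := by ring
      _ = (n * C) * N := by rw [pw_mul_pw_neg ht, mul_one]
      _ ≤ _ := by gcongr; exact le_self_add
  · calc _ ≤ pw t (1 / 2) * ((∑ q : Fin n × Fin n, (C' q.1 : ℝ≥0∞)) * N * pw t (-(1 / 2))) := by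
          gcongr
      _ = (∑ q : Fin n × Fin n, (C' q.1 : ℝ≥0∞)) * N * (pw t (1 / 2) * pw t (-(1 / 2))) := by ring
      _ = (∑ q : Fin n × Fin n, (C' q.1 : ℝ≥0∞)) * N := by rw [pw_mul_pw_neg ht, mul_one]
      _ ≤ _ := by gcongr; exact le_add_self

lemma wgt_le_weightR_of_lt (hn : 0 < n) {δ : ℝ} (hδ : 0 < δ) (v : ℝ → Rn n → Cn n) {τ t : ℝ}
    (hτ : τ ∈ Set.Ioo 0 t) : wgt δ v τ ≤ weightR δ v t := by
  rw [weightR_eq hn hδ]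
  exact le_iSup₂ (f := fun τ (_ : τ ∈ Set.Ioo 0 t) => wgt δ v τ) τ hτ

end Linear

lemma wgt_le {δ : ℝ} {v : ℝ → Rn n → Cn n} {t : ℝ} {M : ℝ≥0∞}
    (h₁ : pw t ((1 - δ) / 2) * nr δ (fun x => ‖v t x‖ₑ) ≤ M)
    (h₂ : pw t (1 / 2) * nr 1 (fun x => ‖grad (v t) x‖ₑ) ≤ M) : wgt δ v t ≤ M := max_le h₁ h₂

lemma pw_mul_nr_le_wgt (δ : ℝ) (v : ℝ → Rn n → Cn n) (t : ℝ) :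
    pw t ((1 - δ) / 2) * nr δ (fun x => ‖v t x‖ₑ) ≤ wgt δ v t := le_max_left _ _

lemma pw_mul_nr_grad_le_wgt (δ : ℝ) (v : ℝ → Rn n → Cn n) (t : ℝ) :
    pw t (1 / 2) * nr 1 (fun x => ‖grad (v t) x‖ₑ) ≤ wgt δ v t := le_max_right _ _

namespace IsCoulombSolution

variable {lam T : ℝ} {u : ℝ → Rn n → Cn n} {a₀ : ℝ → Rn n → ℝ} {a : ℝ → Rn n → Rn n}

/-- The integral inequality for the Fujita-Kato quantity. -/
lemma weightR_le (hn : 3 ≤ n) (hlam : 0 < lam) {δ : ℝ} (hδ : δ ∈ Set.Ioo (3 / 5 : ℝ) (2 / 3)) :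
    ∃ C : ℝ≥0, ∀ {T : ℝ} {u : ℝ → Rn n → Cn n} {a₀ : ℝ → Rn n → ℝ} {a : ℝ → Rn n → Rn n},
      IsCoulombSolution n lam T u a₀ a → ∀ t ∈ Set.Icc 0 T,
        weightR δ u t ≤ weightR₀ lam δ (u 0) t +
          C * (weightR δ u t ^ 3 + weightR δ u t ^ 5) := by
  have hn0 : 0 < n := by omega
  have hn' : (3:ℝ) ≤ n := by exact_mod_cast hn
  have hδ0 : 0 < δ := by linarith [hδ.1]
  have hδ1 : δ < 1 := by linarith [hδ.2]
  have hc : 0 < (wS lam).re / 2 := half_pos (wS_re_pos hlam)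
  obtain ⟨C1, hC1⟩ := enorm_sub_semigroupS_le (n := n) hn0 hlam
  obtain ⟨C2, hC2⟩ := enorm_grad_sub_semigroupS_le (n := n) hn0 hlam
  obtain ⟨D1, hD1⟩ := nr_duh_nlin_le hn hδ (β := δ) (κ := 0) hδ0 hδ1.le le_rfl (by linarith) hc
  obtain ⟨D2, hD2⟩ := nr_duh_nlin_le hn hδ (β := 1) (κ := 1) one_pos le_rfl zero_le_one
    (by linarith) hc
  refine ⟨C1 * D1 + C2 * D2, fun {T u a₀ a} hS t ht => ?_⟩
  have hT : (0:ℝ) ≤ T := ht.1.trans ht.2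
  have hf : ∀ l, MemHInfty fun y => u 0 y l := fun l => (hS.hu l).1 0 ⟨le_rfl, hT⟩
  have hR : weightR δ u t ≠ ⊤ := (hS.weightR_lt_top (by omega) hδ0 hδ1 ht).ne
  set R := weightR δ u t with hRdef
  set P := R ^ 3 + R ^ 5
  have hmv := hS.measurable_u hn0 hT
  have hmg := hS.measurable_grad_u hn0 hT
  have hmn := measurable_nlin_uncurry (v := fun s => u (clamp T s)) hmv hmg
  have hw : ∀ s ∈ Set.Ioo 0 t, wgt δ u s ≤ R := fun s hs => wgt_le_weightR_of_lt hn0 hδ0 u hs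
  conv_lhs => rw [hRdef, weightR_eq hn0 hδ0]
  -- The Duhamel integral at `τ < t` involves only times `s < τ`, at which the weighted norms are
  -- bounded by `R(t)`.
  refine iSup₂_le fun τ hτ => ?_
  have hτT : τ ∈ Set.Ioc 0 T := ⟨hτ.1, hτ.2.le.trans ht.2⟩
  have b1 : ∀ s ∈ Set.Ioo 0 τ, nr δ (fun y => ‖u (clamp T s) y‖ₑ) ≤ R * pw s (-((1 - δ) / 2)) := by
    intro s hs
    rw [clamp_eq ⟨hs.1.le, hs.2.le.trans hτT.2⟩]
    exact le_mul_pw_neg hs.1 ((pw_mul_nr_le_wgt δ u s).trans (hw s ⟨hs.1, hs.2.trans hτ.2⟩))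
  have b2 : ∀ s ∈ Set.Ioo 0 τ, nr 1 (fun y => ‖grad (u (clamp T s)) y‖ₑ) ≤ R * pw s (-(1 / 2)) := by
    intro s hs
    rw [clamp_eq ⟨hs.1.le, hs.2.le.trans hτT.2⟩]
    exact le_mul_pw_neg hs.1 ((pw_mul_nr_grad_le_wgt δ u s).trans (hw s ⟨hs.1, hs.2.trans hτ.2⟩))
  have h0 : wgt δ (fun τ => semigroupS lam τ (u 0)) τ ≤ weightR₀ lam δ (u 0) t :=
    wgt_le_weightR_of_lt hn0 hδ0 _ hτ
  have f1 := (pw_mul_nr_le_wgt δ (fun τ => semigroupS lam τ (u 0)) τ).trans h0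
  have f2 := (pw_mul_nr_grad_le_wgt δ (fun τ => semigroupS lam τ (u 0)) τ).trans h0
  have d1 := hD1 τ hτ.1 (fun s => u (clamp T s)) hmv hmg R hR b1 b2
  have d2 := hD2 τ hτ.1 (fun s => u (clamp T s)) hmv hmg R hR b1 b2
  rw [add_zero] at d1
  rw [add_sub_cancel_right] at d2
  have e1 := hC1 hS τ hτT
  have e2 := hC2 hS τ hτT
  generalize (fun s => nlin (u (clamp T s))) = F at *
  have k1 := pw_mul_nr_le hn0 hδ0 (by linarith) hτ.1
    (measurable_semigroupS hlam hτ.1 hf) (measurable_duh ((wS lam).re / 2) 0 τ hmn) e1 d1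
  have k2 := pw_mul_nr_le hn0 one_pos (by linarith) hτ.1
    (measurable_grad_semigroupS hn0 hlam hτ.1 hf) (measurable_duh ((wS lam).re / 2) 1 τ hmn) e2 d2
  push_cast
  refine wgt_le (k1.trans (add_le_add f1 ?_)) (k2.trans (add_le_add f2 ?_))
  · rw [← mul_assoc]; exact mul_le_mul' le_self_add le_rfl
  · rw [← mul_assoc]; exact mul_le_mul' le_add_self le_rfl

/-- The supremum in `R(t)` omits the time `t`, which is recovered by left continuity of the weight.
Both the continuity argument and the final estimate at `t = T` need it. -/
lemma wgt_le_weightR (hn : 2 ≤ n) {δ : ℝ} (hδ : 0 < δ) (hδ1 : δ < 1)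
    (hS : IsCoulombSolution n lam T u a₀ a) {t : ℝ} (ht : t ∈ Set.Ioc 0 T) :
    wgt δ u t ≤ weightR δ u t := by
  have h1 := (hS.continuousOn_wgt hn hδ hδ1 t ⟨ht.1.le, ht.2⟩).mono
    (s := Set.Ioo 0 t) fun s hs => ⟨hs.1.le, hs.2.le.trans ht.2⟩
  have : (𝓝[Set.Ioo 0 t] t).NeBot := by
    rw [← mem_closure_iff_nhdsWithin_neBot, closure_Ioo ht.1.ne]
    exact ⟨ht.1.le, le_rfl⟩
  refine le_of_tendsto h1 ?_
  filter_upwards [self_mem_nhdsWithin] with s hs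
  exact wgt_le_weightR_of_lt (by omega) hδ u hs

end IsCoulombSolution

/-! ### The continuity argument and the a priori estimate. -/

lemma le_two_mul_of_le_add {c r : ℝ≥0} (hc : c * ((3 * r) ^ 2 + (3 * r) ^ 4) ≤ 1 / 3) {R R₀ : ℝ≥0∞}
    (hR : R ≤ 3 * r) (h : R ≤ R₀ + c * (R ^ 3 + R ^ 5)) : R ≤ 2 * R₀ := by
  by_cases h0 : R₀ = ⊤
  · simp [h0]
  have hRt : R ≠ ⊤ := ne_top_of_le_ne_top (by finiteness) hR
  lift R to ℝ≥0 using hRt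
  lift R₀ to ℝ≥0 using h0
  norm_cast at *
  -- As long as `R ≤ 3r`, the nonlinear term is at most `R/3` and can be absorbed, giving `R ≤ (3/2)
  -- R₀`.
  have h1 : c * (R ^ 3 + R ^ 5) ≤ 1 / 3 * R :=
    calc c * (R ^ 3 + R ^ 5) = c * (R ^ 2 + R ^ 4) * R := by ring
      _ ≤ c * ((3 * r) ^ 2 + (3 * r) ^ 4) * R := by gcongr
      _ ≤ _ := by gcongr
  rw [← NNReal.coe_le_coe] at *
  push_cast at *
  linarith [R.coe_nonneg]

lemma exists_small (c : ℝ≥0) : ∃ r : ℝ≥0, 0 < r ∧ c * ((3 * r) ^ 2 + (3 * r) ^ 4) ≤ 1 / 3 := by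
  -- With this choice `m = 3r` equals `1/(6(c + 1)) ≤ 1`, so `c(m² + m⁴) ≤ (c + 1) · 2m = 1/3`.
  refine ⟨1 / (18 * (c + 1)), by positivity, ?_⟩
  set m : ℝ≥0 := 1 / (6 * (c + 1)) with hm
  have e : 3 * (1 / (18 * (c + 1))) = m := by rw [hm]; field_simp; norm_num
  have hm1 : m ≤ 1 := by
    rw [hm]
    refine (div_le_one (by positivity)).2 ?_
    calc (1:ℝ≥0) ≤ 6 * 1 := by norm_num
      _ ≤ 6 * (c + 1) := by gcongr; simp
  rw [e]
  calc c * (m ^ 2 + m ^ 4) ≤ (c + 1) * (m + m) := by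
        gcongr
        · simp
        · exact pow_le_of_le_one zero_le hm1 (by norm_num)
        · exact pow_le_of_le_one zero_le hm1 (by norm_num)
    _ = 1 / 3 := by rw [hm]; field_simp; norm_num

/-- The continuity argument. -/
lemma bootstrap {T : ℝ} {W R R₀ : ℝ → ℝ≥0∞} {c r : ℝ≥0} (hr : 0 < r)
    (hc : c * ((3 * r) ^ 2 + (3 * r) ^ 4) ≤ 1 / 3) (hW : ContinuousOn W (Set.Icc 0 T)) (hW0 : W 0 = 0)
    (hWR : ∀ t ∈ Set.Ioc 0 T, W t ≤ R t) (hRW : ∀ t M, (∀ τ ∈ Set.Ioo 0 t, W τ ≤ M) → R t ≤ M)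
    (h : ∀ t ∈ Set.Icc 0 T, R t ≤ R₀ t + c * (R t ^ 3 + R t ^ 5))
    (hR₀ : ∀ t ∈ Set.Icc 0 T, R₀ t ≤ r) {t : ℝ} (ht : t ∈ Set.Icc 0 T) : R t ≤ 2 * R₀ t := by
  suffices hlt : ∀ τ ∈ Set.Icc 0 T, W τ < 3 * r from
    le_two_mul_of_le_add hc (hRW t _ fun τ hτ => (hlt τ ⟨hτ.1.le, hτ.2.le.trans ht.2⟩).le) (h t ht)
  by_contra! hne
  -- At the first time `s` at which `W` reaches `3r` one has `R s ≤ 3r`, hence `R s ≤ 2 R₀ s ≤ 2r`.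
  -- This contradicts `3r ≤ W s ≤ R s`; the first time exists because `W` is continuous, and is
  -- positive because `W 0 = 0`.
  set S : Set ℝ := Set.Icc 0 T ∩ W ⁻¹' Set.Ici (3 * r) with hS
  have hSc : IsCompact S := isCompact_Icc.of_isClosed_subset
    (hW.preimage_isClosed_of_isClosed isClosed_Icc isClosed_Ici) Set.inter_subset_left
  obtain ⟨s, hsS, hmin⟩ := hSc.exists_isLeast hne
  have hr3 : (0:ℝ≥0∞) < 3 * r := by positivity
  have hs0 : 0 < s := by
    refine lt_of_le_of_ne hsS.1.1 fun h0 => ?_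
    have h3 : 3 * (r : ℝ≥0∞) ≤ W s := hsS.2
    rw [← h0, hW0] at h3
    exact absurd h3 (not_le.2 hr3)
  have hRs : R s ≤ 3 * r := hRW s _ fun τ hτ => by
    by_contra! hτ'
    exact absurd (hmin ⟨⟨hτ.1.le, hτ.2.le.trans hsS.1.2⟩, hτ'.le⟩) (not_le.2 hτ.2)
  have h1 : R s ≤ 2 * R₀ s := le_two_mul_of_le_add hc hRs (h s hsS.1)
  have h2 : 3 * (r : ℝ≥0∞) ≤ 2 * r :=
    calc 3 * (r : ℝ≥0∞) ≤ W s := hsS.2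
      _ ≤ R s := hWR s ⟨hs0, hsS.1.2⟩
      _ ≤ 2 * R₀ s := h1
      _ ≤ 2 * r := by gcongr; exact hR₀ s hsS.1
  norm_cast at h2
  have h3 : (0:ℝ) < r := hr
  rw [← NNReal.coe_le_coe] at h2
  push_cast at h2
  linarith

/-- The smallness hypothesis takes its supremum over the open interval, whereas the continuity
argument also uses `t = T`. Every `τ < t` lies below the midpoint of `τ` and `t`, which is still
less than `T`. -/
lemma weightR₀_le_biSup (hn : 0 < n) {lam δ T : ℝ} (hδ : 0 < δ) (f : Rn n → Cn n) {t : ℝ}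
    (ht : t ∈ Set.Icc 0 T) :
    weightR₀ lam δ f t ≤ ⨆ s ∈ Set.Ioo 0 T, weightR₀ lam δ f s := by
  unfold weightR₀
  conv_lhs => rw [weightR_eq hn hδ]
  refine iSup₂_le fun τ hτ => ?_
  have hm : (τ + t) / 2 ∈ Set.Ioo 0 T := ⟨by linarith [hτ.1, hτ.2], by linarith [hτ.2, ht.2]⟩
  refine (wgt_le_weightR_of_lt hn hδ _ (t := (τ + t) / 2) ⟨hτ.1, by linarith [hτ.2]⟩).trans ?_
  exact le_iSup₂ (f := fun s (_ : s ∈ Set.Ioo 0 T) =>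
    weightR δ (fun τ => semigroupS lam τ f) s) _ hm

namespace IsCoulombSolution

lemma weightR_le_two_mul (hn : 3 ≤ n) {lam : ℝ} (hlam : 0 < lam) {δ : ℝ}
    (hδ : δ ∈ Set.Ioo (3 / 5 : ℝ) (2 / 3)) : ∃ c₀ r₀ : ℝ≥0, 0 < c₀ ∧ 0 < r₀ ∧
    ∀ {T : ℝ} {u : ℝ → Rn n → Cn n} {a₀ : ℝ → Rn n → ℝ} {a : ℝ → Rn n → Rn n},
      IsCoulombSolution n lam T u a₀ a →
        (∀ t ∈ Set.Icc 0 T, weightR δ u t ≤ weightR₀ lam δ (u 0) t +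
          c₀ * (weightR δ u t ^ 3 + weightR δ u t ^ 5)) ∧
        ((∀ t ∈ Set.Icc 0 T, weightR₀ lam δ (u 0) t ≤ r₀) →
          ∀ t ∈ Set.Icc 0 T, weightR δ u t ≤ 2 * weightR₀ lam δ (u 0) t) := by
  have hδ0 : 0 < δ := by linarith [hδ.1]
  have hδ1 : δ < 1 := by linarith [hδ.2]
  obtain ⟨c, hc⟩ := weightR_le (n := n) hn hlam hδ
  -- Enlarging `c` by one makes the constant strictly positive.
  obtain ⟨r, hr, hcr⟩ := exists_small (c + 1)
  have hle : ∀ {T : ℝ} {u : ℝ → Rn n → Cn n} {a₀ : ℝ → Rn n → ℝ} {a : ℝ → Rn n → Rn n},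
      IsCoulombSolution n lam T u a₀ a → ∀ t ∈ Set.Icc 0 T,
        weightR δ u t ≤ weightR₀ lam δ (u 0) t +
          ((c + 1 : ℝ≥0) : ℝ≥0∞) * (weightR δ u t ^ 3 + weightR δ u t ^ 5) := fun hS t ht => by
    refine (hc hS t ht).trans ?_
    gcongr
    simp
  refine ⟨c + 1, r, by positivity, hr, fun {T u a₀ a} hS => ⟨hle hS, fun hR₀ t ht => ?_⟩⟩
  refine bootstrap (W := wgt δ u) (R := weightR δ u) (R₀ := weightR₀ lam δ (u 0)) hr hcr
    (hS.continuousOn_wgt (by omega) hδ0 hδ1) (wgt_zero hδ1 u)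
    (fun t ht => hS.wgt_le_weightR (by omega) hδ0 hδ1 ht) (fun t M h => ?_) (hle hS) hR₀ ht
  rw [weightR_eq (by omega) hδ0]
  exact iSup₂_le h

/-- The a priori estimate for small initial data. -/
lemma wgt_le_of_small (hn : 3 ≤ n) {lam : ℝ} (hlam : 0 < lam) {δ : ℝ}
    (hδ : δ ∈ Set.Ioo (3 / 5 : ℝ) (2 / 3)) : ∃ ρ C : ℝ≥0, 0 < ρ ∧ 0 < C ∧
    ∀ {T : ℝ} {u : ℝ → Rn n → Cn n} {a₀ : ℝ → Rn n → ℝ} {a : ℝ → Rn n → Rn n},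
      IsCoulombSolution n lam T u a₀ a → nr 1 (fun x => ‖u 0 x‖ₑ) < ρ →
        ∀ t ∈ Set.Ioc 0 T, wgt δ u t ≤ C * nr 1 (fun x => ‖u 0 x‖ₑ) := by
  have hn0 : 0 < n := by omega
  have hδ0 : 0 < δ := by linarith [hδ.1]
  have hδ1 : δ < 1 := by linarith [hδ.2]
  obtain ⟨c₀, r₀, -, hr₀, h⟩ := weightR_le_two_mul hn hlam hδ
  obtain ⟨C, hC⟩ := wgt_semigroupS_le (n := n) hn0 hlam hδ0 hδ1.le
  -- The linear estimate gives `R₀ ≤ (C + 1) ‖u(0)‖`, which is at most `r₀` below this threshold;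
  -- the factor `2` comes from `R ≤ 2 R₀`.
  refine ⟨r₀ / (C + 1), 2 * (C + 1), by positivity, by positivity,
    fun {T u a₀ a} hS hu t ht => ?_⟩
  have h0 : (0:ℝ) ∈ Set.Icc 0 T := ⟨le_rfl, ht.1.le.trans ht.2⟩
  set N := nr 1 (fun x => ‖u 0 x‖ₑ)
  have hR₀ : ∀ t, weightR₀ lam δ (u 0) t ≤ ((C + 1 : ℝ≥0) : ℝ≥0∞) * N := fun t => by
    unfold weightR₀
    rw [weightR_eq hn0 hδ0]
    refine iSup₂_le fun τ hτ => (hC (u 0) (hS.continuous_u h0)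
      (fun l => (hS.hu l).1 0 h0) τ hτ.1).trans ?_
    gcongr
    simp
  have hr : ∀ t ∈ Set.Icc 0 T, weightR₀ lam δ (u 0) t ≤ r₀ := fun t _ =>
    calc weightR₀ lam δ (u 0) t ≤ ((C + 1 : ℝ≥0) : ℝ≥0∞) * N := hR₀ t
      _ ≤ ((C + 1 : ℝ≥0) : ℝ≥0∞) * ((r₀ / (C + 1) : ℝ≥0) : ℝ≥0∞) := by gcongr
      _ = r₀ := by
        rw [← ENNReal.coe_mul]
        congr 1
        field_simp
  calc wgt δ u t ≤ weightR δ u t := hS.wgt_le_weightR (by omega) hδ0 hδ1 ht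
    _ ≤ 2 * weightR₀ lam δ (u 0) t := (h hS).2 hr t ⟨ht.1.le, ht.2⟩
    _ ≤ 2 * (((C + 1 : ℝ≥0) : ℝ≥0∞) * N) := by gcongr; exact hR₀ t
    _ = _ := by push_cast; ring

end IsCoulombSolution

end CovLLG

theorem mainTheorem3 (n : ℕ) (hn : 3 ≤ n) (lam : ℝ) (hlam : 0 < lam)
    (δ : ℝ) (hδ : δ ∈ Set.Ioo (3 / 5 : ℝ) (2 / 3)) :
    -- the integral inequality for `R` and the resulting bound by `R₀`
    (∃ c₀ : ℝ, 0 < c₀ ∧ ∃ r₀ : ℝ, 0 < r₀ ∧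
      ∀ (T : ℝ), 0 < T → ∀ (u : ℝ → CovLLG.Rn n → CovLLG.Cn n)
        (a₀ : ℝ → CovLLG.Rn n → ℝ) (a : ℝ → CovLLG.Rn n → CovLLG.Rn n),
        CovLLG.IsCoulombSolution n lam T u a₀ a →
          (∀ t ∈ Set.Icc 0 T,
            CovLLG.weightR δ u t < ⊤ ∧
            CovLLG.weightR δ u t ≤ CovLLG.weightR₀ lam δ (u 0) t +
              ENNReal.ofReal c₀ * (CovLLG.weightR δ u t ^ 3 + CovLLG.weightR δ u t ^ 5)) ∧
          ((⨆ t ∈ Set.Ioo 0 T, CovLLG.weightR₀ lam δ (u 0) t) < ENNReal.ofReal r₀ →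
            ∀ t ∈ Set.Icc 0 T,
              CovLLG.weightR δ u t ≤ 2 * CovLLG.weightR₀ lam δ (u 0) t)) ∧
    -- the a priori estimate under smallness of `‖u(0)‖_{L^n}`
    (∃ ρ : ℝ, 0 < ρ ∧ ∃ c : ℝ, 0 < c ∧
      ∀ (T : ℝ), 0 < T → ∀ (u : ℝ → CovLLG.Rn n → CovLLG.Cn n)
        (a₀ : ℝ → CovLLG.Rn n → ℝ) (a : ℝ → CovLLG.Rn n → CovLLG.Rn n),
        CovLLG.IsCoulombSolution n lam T u a₀ a →
        MeasureTheory.eLpNorm (u 0) (n : ℝ≥0∞) MeasureTheory.volume < ENNReal.ofReal ρ →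
        ∀ t ∈ Set.Ioc 0 T,
          ENNReal.ofReal (t ^ ((1 - δ) / 2)) *
              MeasureTheory.eLpNorm (u t) (ENNReal.ofReal (n / δ)) MeasureTheory.volume +
            ENNReal.ofReal (t ^ (1 / 2 : ℝ)) *
              MeasureTheory.eLpNorm (CovLLG.grad (u t)) (n : ℝ≥0∞) MeasureTheory.volume
          ≤ ENNReal.ofReal c *
              MeasureTheory.eLpNorm (u 0) (n : ℝ≥0∞) MeasureTheory.volume) := by
  have hn0 : 0 < n := by omega
  have hδ0 : 0 < δ := by linarith [hδ.1]
  have hδ1 : δ < 1 := by linarith [hδ.2]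
  obtain ⟨c₀, r₀, hc₀, hr₀, h⟩ := CovLLG.IsCoulombSolution.weightR_le_two_mul hn hlam hδ
  obtain ⟨ρ, C, hρ, hC, h'⟩ := CovLLG.IsCoulombSolution.wgt_le_of_small hn hlam hδ
  refine ⟨⟨c₀, hc₀, r₀, hr₀, fun T _ u a₀ a hS => ⟨fun t ht => ⟨?_, ?_⟩, fun hR t ht => ?_⟩⟩,
    ⟨ρ, hρ, 2 * C, by positivity, fun T _ u a₀ a hS hu t ht => ?_⟩⟩
  · exact hS.weightR_lt_top (by omega) hδ0 hδ1 ht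
  · rw [ENNReal.ofReal_coe_nnreal]
    exact (h hS).1 t ht
  · rw [ENNReal.ofReal_coe_nnreal] at hR
    exact (h hS).2 (fun s hs => (CovLLG.weightR₀_le_biSup hn0 hδ0 (u 0) hs).trans hR.le) t ht
  -- The weight is a maximum while the claim concerns a sum, hence the factor `2` in the constant.
  · rw [CovLLG.eLpNorm_natCast_eq_nr hn0, ENNReal.ofReal_coe_nnreal] at hu
    have hw := h' hS hu t ht
    rw [CovLLG.eLpNorm_eq_nr hn0 hδ0, CovLLG.eLpNorm_natCast_eq_nr hn0,
      CovLLG.eLpNorm_natCast_eq_nr hn0, ENNReal.ofReal_mul (by norm_num), ENNReal.ofReal_coe_nnreal,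
      ENNReal.ofReal_ofNat, mul_assoc, two_mul]
    exact add_le_add ((CovLLG.pw_mul_nr_le_wgt δ u t).trans hw)
      ((CovLLG.pw_mul_nr_grad_le_wgt δ u t).trans hw)
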